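/- Let $(X,\omega)$ be an integral symplectic manifold, that is, $X$ is a closed (compact, without boundary) smooth manifold and $\omega$ is a symplectic form on $X$ such that $\int_c\omega\in\mathbf Z$ for every (smooth singular) integral $2$-cycle $c$ in $X$. Let $Q\subset X$ be an embedded submanifold (without boundary, not necessarily closed) with $\dim Q=\frac12\dim X$. Call $Q$ a Bohr–Sommerfeld Lagrangian submanifold if $\omega|_Q=0$ and the homomorphism $H_2(X,Q;\mathbf Z)\to\mathbf R$ defined by integration of $\omega$ takes its values in $\mathbf Z$. Then $Q$ is a Bohr–Sommerfeld Lagrangian submanifold if and only if there exist a Hermitian line bundle $L\to X$ and a unitary connection $\nabla$ on $L$ of curvature $-2i\pi\omega$ such that $(L,\nabla)|_Q$ is a trivial flat Hermitian bundle, that is, $L|_Q$ has a global unit section that is parallel for the restricted connection. Moreover, if $Q$ is a Bohr–Sommerfeld Lagrangian submanifold and $J$ is an (integrable) complex structure on $X$ for which $(X,\omega,J)$ is Kähler, then one can take for $(L,\nabla)$ a holomorphic Hermitian line bundle over $(X,J)$ with its Chern connection: there exists a holomorphic Hermitian line bundle $L\to X$ whose Chern connection $\nabla$ has curvature $-2i\pi\omega$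 and such that $(L,\nabla)|_Q$ is a trivial flat Hermitian bundle. -/

import Mathlib

open scoped Manifold ContDiff Bundle
open Bundle Module

noncomputable section

namespace BohrSommerfeld

section Forms

variable {E : Type*} [NormedAddCommGroup E] [NormedSpace ℝ E]
  {X : Type*} [TopologicalSpace X] [ChartedSpace E X]

variable (E X) in
/-- Fields of alternating real bilinear forms on the tangent spaces of a manifold `X` (without
boundary) modelled on `E`. Smoothness is a separate condition. -/
abbrev TwoForm : Type _ :=
  (x : X) → (TangentSpace 𝓘(ℝ, E) x) [⋀^Fin 2]→L[ℝ] ℝ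

/-- The expression of a 2-form in a chart `e`, that is, its pullback by the inverse of `e`. -/
def TwoForm.inChart (Ω : TwoForm E X) (e : OpenPartialHomeomorph X E) : E → E [⋀^Fin 2]→L[ℝ] ℝ :=
  fun u ↦ (Ω (e.symm u)).compContinuousLinearMap (mfderiv 𝓘(ℝ, E) 𝓘(ℝ, E) e.symm u)

/-- A symplectic form: a smooth, closed, nondegenerate 2-form. -/
structure IsSymplectic (Ω : TwoForm E X) : Prop where
  smooth : ∀ x : X, ContDiffOn ℝ ∞ (Ω.inChart (chartAt E x)) (chartAt E x).target
  closed : ∀ x : X, ∀ u ∈ (chartAt E x).target, extDeriv (Ω.inChart (chartAt E x)) u = 0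
  nondegenerate : ∀ (x : X) (v : TangentSpace 𝓘(ℝ, E) x),
    (∀ w : TangentSpace 𝓘(ℝ, E) x, Ω x ![v, w] = 0) → v = 0

/-- `(X, Ω, J)` is a Kähler manifold: `J` is an almost complex structure which is constant in
suitable smooth coordinates around each point (so that `(X, J)` is a complex manifold), which
preserves `Ω`, and for which `Ω(·, J·)` is positive definite. (Here `Ω` is meant to be
symplectic.) -/
structure IsKahler (Ω : TwoForm E X)
    (J : (x : X) → TangentSpace 𝓘(ℝ, E) x →L[ℝ] TangentSpace 𝓘(ℝ, E) x) : Prop where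
  sq : ∀ (x : X) (v : TangentSpace 𝓘(ℝ, E) x), J x (J x v) = -v
  integrable : ∀ x : X, ∃ e ∈ IsManifold.maximalAtlas 𝓘(ℝ, E) ∞ X, x ∈ e.source ∧
    ∃ j : E →L[ℝ] E, ∀ y ∈ e.source, ∀ v : TangentSpace 𝓘(ℝ, E) y,
      mfderiv 𝓘(ℝ, E) 𝓘(ℝ, E) e y (J y v) = j (mfderiv 𝓘(ℝ, E) 𝓘(ℝ, E) e y v)
  compatible : ∀ (x : X) (v w : TangentSpace 𝓘(ℝ, E) x), Ω x ![J x v, J x w] = Ω x ![v, w]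
  positive : ∀ (x : X) (v : TangentSpace 𝓘(ℝ, E) x), v ≠ 0 → 0 < Ω x ![v, J x v]

/-- A function is holomorphic on an open set `U` of the complex manifold `(X, J)` if it is
differentiable there with complex linear differential. -/
def IsHolomorphicOn (J : (x : X) → TangentSpace 𝓘(ℝ, E) x →L[ℝ] TangentSpace 𝓘(ℝ, E) x)
    (f : X → ℂ) (U : Set X) : Prop :=
  ∀ x ∈ U, MDifferentiableAt 𝓘(ℝ, E) 𝓘(ℝ, ℂ) f x ∧
    ∀ v : TangentSpace 𝓘(ℝ, E) x, mvfderiv 𝓘(ℝ, E) f x (J x v) =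
      Complex.I * mvfderiv 𝓘(ℝ, E) f x v

end Forms

section Chains

variable (E : Type*) [NormedAddCommGroup E] [NormedSpace ℝ E]
  (X : Type*) [TopologicalSpace X] [ChartedSpace E X]

/-- A smooth singular `k`-simplex: a map from the standard `k`-simplex to `X` that extends to a
smooth map on the ambient space `ℝ^(k+1)`. -/
@[ext]
structure SmoothSimplex (k : ℕ) where
  toFun : stdSimplex ℝ (Fin (k + 1)) → X
  smooth : ∃ f : (Fin (k + 1) → ℝ) → X,
    ContMDiff 𝓘(ℝ, Fin (k + 1) → ℝ) 𝓘(ℝ, E) ∞ f ∧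
      ∀ t : stdSimplex ℝ (Fin (k + 1)), f t = toFun t

/-- Smooth singular `k`-chains with integral coefficients. -/
abbrev SmoothChain (k : ℕ) : Type _ := SmoothSimplex E X k →₀ ℤ

variable {E X}

namespace SmoothSimplex

/-- The `i`-th face of a smooth simplex, opposite to the `i`-th vertex. -/
def face {k : ℕ} (σ : SmoothSimplex E X (k + 1)) (i : Fin (k + 2)) : SmoothSimplex E X k where
  toFun t := σ.toFun (stdSimplex.map i.succAbove t)
  smooth := by
    obtain ⟨f, hf, h⟩ := σ.smooth
    let φ : (Fin (k + 1) → ℝ) →L[ℝ] (Fin (k + 2) → ℝ) :=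
      LinearMap.toContinuousLinearMap (FunOnFinite.linearMap ℝ ℝ i.succAbove)
    refine ⟨f ∘ φ, hf.comp φ.contDiff.contMDiff, fun t ↦ ?_⟩
    rw [← h]
    rfl

/-- A chosen smooth extension of a smooth simplex to the ambient space. -/
def extension {k : ℕ} (σ : SmoothSimplex E X k) : (Fin (k + 1) → ℝ) → X :=
  σ.smooth.choose

/-- A smooth 2-simplex in the coordinates `(s, t)`, where `0 ≤ s`, `0 ≤ t` and `s + t ≤ 1`: the
barycentric coordinates of the point are `(1 - s - t, s, t)`. -/
def param (σ : SmoothSimplex E X 2) (p : ℝ × ℝ) : X :=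
  σ.extension ![1 - p.1 - p.2, p.1, p.2]

/-- The integral of a 2-form over a smooth 2-simplex, that is, the integral over the triangle
`0 ≤ s`, `0 ≤ t`, `s + t ≤ 1` of `Ω(∂σ/∂s, ∂σ/∂t)`. The partial derivatives on the triangle do not
depend on the chosen extension. -/
def integral (Ω : TwoForm E X) (σ : SmoothSimplex E X 2) : ℝ :=
  ∫ s in (0 : ℝ)..1, ∫ t in (0 : ℝ)..(1 - s),
    Ω (σ.param (s, t))
      ![mfderiv 𝓘(ℝ, ℝ × ℝ) 𝓘(ℝ, E) σ.param (s, t) ((1, 0) : ℝ × ℝ),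
        mfderiv 𝓘(ℝ, ℝ × ℝ) 𝓘(ℝ, E) σ.param (s, t) ((0, 1) : ℝ × ℝ)]

end SmoothSimplex

namespace SmoothChain

/-- The boundary operator on smooth singular chains. -/
def boundary {k : ℕ} : SmoothChain E X (k + 1) →ₗ[ℤ] SmoothChain E X k :=
  Finsupp.linearCombination ℤ fun σ : SmoothSimplex E X (k + 1) ↦
    ∑ i : Fin (k + 2), Finsupp.single (σ.face i) ((-1 : ℤ) ^ (i : ℕ))

/-- The integral of a 2-form over a smooth 2-chain. -/
def integral (Ω : TwoForm E X) : SmoothChain E X 2 →ₗ[ℤ] ℝ :=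
  Finsupp.linearCombination ℤ fun σ : SmoothSimplex E X 2 ↦ σ.integral Ω

/-- A chain lies in a subset `A` if all its simplices do. -/
def LiesIn {k : ℕ} (c : SmoothChain E X k) (A : Set X) : Prop :=
  ∀ σ ∈ c.support, ∀ t, σ.toFun t ∈ A

end SmoothChain

/-- `Ω` has integral periods: it integrates to an integer over every 2-cycle. -/
def HasIntegralPeriods (Ω : TwoForm E X) : Prop :=
  ∀ c : SmoothChain E X 2, SmoothChain.boundary c = 0 → ∃ n : ℤ, SmoothChain.integral Ω c = n

/-- Integration of `Ω` takes integral values on the relative 2-cycles of `(X, A)`. -/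
def HasIntegralRelativePeriods (Ω : TwoForm E X) (A : Set X) : Prop :=
  ∀ c : SmoothChain E X 2, (SmoothChain.boundary c).LiesIn A →
    ∃ n : ℤ, SmoothChain.integral Ω c = n

end Chains

section Lagrangian

variable {E : Type*} [NormedAddCommGroup E] [NormedSpace ℝ E]
  {X : Type*} [TopologicalSpace X] [ChartedSpace E X]
  (F : Type*) [NormedAddCommGroup F] [NormedSpace ℝ F]
  {Q : Type*} [TopologicalSpace Q] [ChartedSpace F Q]

/-- The submanifold given by an embedding `ι : Q → X` is Lagrangian: it has half the dimension
of `X` and `Ω` vanishes on it. -/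
structure IsLagrangian (Ω : TwoForm E X) (ι : Q → X) : Prop where
  half_dim : finrank ℝ E = 2 * finrank ℝ F
  isotropic : ∀ (q : Q) (v w : TangentSpace 𝓘(ℝ, F) q),
    Ω (ι q) ![mfderiv 𝓘(ℝ, F) 𝓘(ℝ, E) ι q v, mfderiv 𝓘(ℝ, F) 𝓘(ℝ, E) ι q w] = 0

/-- A Lagrangian submanifold that satisfies the Bohr-Sommerfeld condition. -/
structure IsBohrSommerfeldLagrangian (Ω : TwoForm E X) (ι : Q → X) : Prop where
  lagrangian : IsLagrangian F Ω ι
  integral : HasIntegralRelativePeriods Ω (Set.range ι)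

end Lagrangian

section LineBundles

variable (E : Type*) [NormedAddCommGroup E] [NormedSpace ℝ E]
  (X : Type*) [TopologicalSpace X] [ChartedSpace E X]

/-- A smooth complex line bundle over `X`: a smooth real vector bundle with typical fibre `ℂ`,
with complex vector spaces as fibres and complex linear local trivializations. -/
structure LineBundle where
  Fiber : X → Type
  [addCommGroup : ∀ x, AddCommGroup (Fiber x)]
  [module : ∀ x, Module ℂ (Fiber x)]
  [topologicalSpaceFiber : ∀ x, TopologicalSpace (Fiber x)]
  [isTopologicalAddGroup : ∀ x, IsTopologicalAddGroup (Fiber x)]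
  [continuousSMul : ∀ x, ContinuousSMul ℝ (Fiber x)]
  [topologicalSpaceTotal : TopologicalSpace (TotalSpace ℂ Fiber)]
  [fiberBundle : FiberBundle ℂ Fiber]
  [vectorBundle : VectorBundle ℝ ℂ Fiber]
  [contMDiffVectorBundle : ContMDiffVectorBundle ∞ ℂ Fiber 𝓘(ℝ, E)]
  complex_linear : ∀ (e : Trivialization ℂ (π ℂ Fiber)) [MemTrivializationAtlas e],
    ∀ x ∈ e.baseSet, ∀ (a : ℂ) (v : Fiber x), (e ⟨x, a • v⟩).2 = a * (e ⟨x, v⟩).2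

attribute [instance] LineBundle.addCommGroup LineBundle.module LineBundle.topologicalSpaceFiber
  LineBundle.isTopologicalAddGroup LineBundle.continuousSMul LineBundle.topologicalSpaceTotal
  LineBundle.fiberBundle LineBundle.vectorBundle LineBundle.contMDiffVectorBundle

variable {E X}

namespace LineBundle

/-- A global section is smooth. -/
def IsSmoothSection (L : LineBundle E X) (σ : (x : X) → L.Fiber x) : Prop :=
  ContMDiff 𝓘(ℝ, E) (𝓘(ℝ, E).prod 𝓘(ℝ, ℂ)) ∞ fun x ↦ TotalSpace.mk' ℂ x (σ x)

/-- A section is differentiable at a point. -/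
def DifferentiableSectionAt (L : LineBundle E X) (σ : (x : X) → L.Fiber x) (x : X) : Prop :=
  MDifferentiableAt 𝓘(ℝ, E) (𝓘(ℝ, E).prod 𝓘(ℝ, ℂ)) (fun y ↦ TotalSpace.mk' ℂ y (σ y)) x

/-- A smooth Hermitian metric on a line bundle (antilinear in the first variable). -/
structure HermitianMetric (L : LineBundle E X) where
  inner : (x : X) → L.Fiber x →ₗ⋆[ℂ] L.Fiber x →ₗ[ℂ] ℂ
  conj_symm : ∀ (x : X) (u v : L.Fiber x), starRingEnd ℂ (inner x u v) = inner x v u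
  pos : ∀ (x : X) (v : L.Fiber x), v ≠ 0 → 0 < (inner x v v).re
  smooth : ∀ σ τ : (x : X) → L.Fiber x, L.IsSmoothSection σ → L.IsSmoothSection τ →
    ContMDiff 𝓘(ℝ, E) 𝓘(ℝ, ℂ) ∞ fun x ↦ inner x (σ x) (τ x)

/-- Covariant derivatives on (the real vector bundle underlying) a line bundle; `D σ x v` is the
derivative of the section `σ` at the point `x` in the direction `v`. -/
abbrev Connection (L : LineBundle E X) : Type _ := CovariantDerivative 𝓘(ℝ, E) ℂ L.Fiber

variable {L : LineBundle E X}

/-- `D` is a smooth unitary connection on the Hermitian line bundle `(L, h)`. -/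
structure IsUnitary [IsManifold 𝓘(ℝ, E) ∞ X] (D : L.Connection) (h : L.HermitianMetric) :
    Prop where
  smooth : CovariantDerivative.ContMDiffCovariantDerivative D ∞
  complex_linear : ∀ (σ : (x : X) → L.Fiber x) (x : X), L.DifferentiableSectionAt σ x →
    ∀ v : TangentSpace 𝓘(ℝ, E) x, D (fun y ↦ Complex.I • σ y) x v = Complex.I • D σ x v
  metric : ∀ (σ τ : (x : X) → L.Fiber x) (x : X), L.DifferentiableSectionAt σ x →
    L.DifferentiableSectionAt τ x → ∀ v : TangentSpace 𝓘(ℝ, E) x,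
      mvfderiv 𝓘(ℝ, E) (fun y ↦ h.inner y (σ y) (τ y)) x v =
        h.inner x (D σ x v) (τ x) + h.inner x (σ x) (D τ x v)

/-- The curvature of `D` is `-2iπΩ`, that is,
`D_U D_V σ - D_V D_U σ - D_[U,V] σ = -2iπ Ω(U, V) σ`
for all smooth vector fields `U`, `V` and all smooth sections `σ`. -/
def HasCurvature [IsManifold 𝓘(ℝ, E) ∞ X] (D : L.Connection) (Ω : TwoForm E X) : Prop :=
  ∀ U V : (x : X) → TangentSpace 𝓘(ℝ, E) x,
    ContMDiff 𝓘(ℝ, E) 𝓘(ℝ, E).tangent ∞ (fun x ↦ (⟨x, U x⟩ : TangentBundle 𝓘(ℝ, E) X)) →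
    ContMDiff 𝓘(ℝ, E) 𝓘(ℝ, E).tangent ∞ (fun x ↦ (⟨x, V x⟩ : TangentBundle 𝓘(ℝ, E) X)) →
    ∀ σ : (x : X) → L.Fiber x, L.IsSmoothSection σ → ∀ x : X,
      D (fun y ↦ D σ y (V y)) x (U x) - D (fun y ↦ D σ y (U y)) x (V x)
          - D σ x (VectorField.mlieBracket 𝓘(ℝ, E) U V x) =
        (-2 * Complex.I * Real.pi * (Ω x ![U x, V x] : ℝ) : ℂ) • σ x

/-- The restriction of `(L, h, D)` to the submanifold given by an embedding `ι : Q → X` is a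
trivial flat Hermitian bundle: it has a global unit section `s` that is parallel for the restricted
connection. The restricted connection is computed, as usual, on local extensions of `s` to smooth
sections of `L` over `X`. -/
def IsTrivialFlatAlong (F : Type*) [NormedAddCommGroup F] [NormedSpace ℝ F]
    {Q : Type*} [TopologicalSpace Q] [ChartedSpace F Q]
    (D : L.Connection) (h : L.HermitianMetric) (ι : Q → X) : Prop :=
  ∃ s : (q : Q) → L.Fiber (ι q),
    (∀ q : Q, h.inner (ι q) (s q) (s q) = 1) ∧
    ∀ q : Q, ∃ σ : (x : X) → L.Fiber x, L.IsSmoothSection σ ∧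
      (∀ᶠ q' in nhds q, σ (ι q') = s q') ∧
      ∀ v : TangentSpace 𝓘(ℝ, F) q, D σ (ι q) (mfderiv 𝓘(ℝ, F) 𝓘(ℝ, E) ι q v) = 0

/-- `L` is a holomorphic line bundle over the complex manifold `(X, J)`: the transition functions
between the trivializations of its atlas are holomorphic. -/
def IsHolomorphic (L : LineBundle E X)
    (J : (x : X) → TangentSpace 𝓘(ℝ, E) x →L[ℝ] TangentSpace 𝓘(ℝ, E) x) : Prop :=
  ∀ (e e' : Trivialization ℂ (π ℂ L.Fiber)) [MemTrivializationAtlas e] [MemTrivializationAtlas e'],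
    IsHolomorphicOn J (fun x ↦ e.coordChange e' x 1) (e.baseSet ∩ e'.baseSet)

/-- `D` is the Chern connection of the holomorphic Hermitian line bundle `(L, h)`: it is unitary
and its `(0,1)`-part annihilates the local holomorphic frames given by the trivializations. -/
structure IsChernConnection [IsManifold 𝓘(ℝ, E) ∞ X] (D : L.Connection) (h : L.HermitianMetric)
    (J : (x : X) → TangentSpace 𝓘(ℝ, E) x →L[ℝ] TangentSpace 𝓘(ℝ, E) x) : Prop where
  unitary : IsUnitary D h
  holomorphic : ∀ (e : Trivialization ℂ (π ℂ L.Fiber)) [MemTrivializationAtlas e],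
    ∀ x ∈ e.baseSet, ∀ v : TangentSpace 𝓘(ℝ, E) x,
      D (fun y ↦ e.symm y (1 : ℂ)) x (J x v) = Complex.I • D (fun y ↦ e.symm y (1 : ℂ)) x v

end LineBundle

end LineBundles

end BohrSommerfeld

end

noncomputable section

set_option maxSynthPendingDepth 3
set_option linter.unusedSectionVars false

namespace BohrSommerfeld

/-! ### Calculus preliminaries: integrals with parameters and bootstrapping of smoothness. -/

section ParametricIntegral

open MeasureTheory Set intervalIntegral
open scoped Convolution Topology

variable {V G : Type*} [NormedAddCommGroup V] [NormedSpace ℝ V]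
  [NormedAddCommGroup G] [NormedSpace ℝ G]

/-! A line bundle with connection is encoded by a `PrequantumAtlas`. Each local frame is `c a` times
one global frame, which need not be continuous, and carries a connection form `θ a` with `d (θ a) =
-2πi Ω`; the quotients `c a / c b` have logarithmic derivative `θ a - θ b`. The global frame has
norm one for a parallel metric when `|c a|²` has logarithmic derivative `2 Re (θ a)`
(`IsHermitian`), and it is parallel along `Q` when `c a ∘ ι` has logarithmic derivative `ι^* (θ a)`
(`IsFlatAlong`). Bundles and atlases are converted into each other by
`LineBundle.IsUnitary.exists_prequantumAtlas` in one direction, and by `PrequantumAtlas.lineBundle`,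
`metric` and `connection` in the other.

From a bundle to periods. Along `Q` the forms `ι^* (θ a)` are logarithmic derivatives, hence closed,
so `ι^* Ω = 0` (`PrequantumAtlas.isotropic`). Holonomy extends to a homomorphism from 1-chains to
`ℂˣ`, and Stokes on one triangle (`hol_boundary`) shows that its value on a boundary `∂c` is `exp
(2πi ∫_c Ω)`. Paths in `Q` have trivial holonomy because the global frame is parallel there, so the
integral is an integer as soon as `∂c` lies in `Q`.

From periods to a bundle. Relative integrality says that `∫ Ω` modulo `ℤ` depends only on the
boundary of a 2-chain modulo chains in `Q`. Since `ℝ/ℤ` is divisible, this homomorphism extends to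
all 1-chains and vanishes on `Q`: a `PathCharacter`, to be thought of as parallel transport. It
comes without any continuity. Nevertheless, put `c a x` equal to its value on the ray from `a` to
`x` in a convex chart around `a`. Sweeping a square by rays shows that, along a path `δ` in the
chart, this function varies by the value of the character on `δ` times the exponential of an
integral of the radial primitive of `Ω` (`toFun_mul_frame`). The value on `δ` does not depend on
`a`, so it cancels in `c a / c b`; and it is one if `δ` lies in `Q`. Hence the quotients are smooth
and the global frame is parallel along `Q`.

Kähler case. Since `Ω` is invariant under `J`, the curvature has type `(1,1)`, and the Dolbeault
lemma yields local functions `f` such that `θ a + df` has type `(1,0)`. Multiplying the frames by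
`exp f` changes neither the global frame nor the metric, but makes the transition functions
holomorphic and the connection that of Chern. The Dolbeault lemma is proved one complex direction at
a time, with a Cauchy transform along a complex line. -/

/-- An integral over `[0, 1]` depends smoothly on the parameters of the integrand. -/
theorem contDiffOn_integral_unitInterval {U : Set V} (hU : IsOpen U) {F : V × ℝ → G}
    (hF : ContDiffOn ℝ ∞ F (U ×ˢ univ)) :
    ContDiffOn ℝ ∞ (fun v ↦ ∫ r in (0 : ℝ)..1, F (v, r)) U := by
  -- The integral is the value at 0 of the convolution of the indicator of `(0, 1]` with `x ↦ F (v,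
  -- -x)`. The bump makes the second factor compactly supported, and it equals 1 on `[-2, 2]`, which
  -- contains every point `-r` that matters.
  let η : ContDiffBump (0 : ℝ) := ⟨2, 3, by norm_num, by norm_num⟩
  let f : ℝ → ℝ := indicator (Ioc 0 1) 1
  let g : V → ℝ → G := fun p x ↦ η x • F (p, -x)
  have hf : LocallyIntegrable f volume := by
    refine Integrable.locallyIntegrable ?_
    exact (integrable_indicator_iff measurableSet_Ioc).2
      (integrableOn_const (C := (1 : ℝ)) (by simp))
  have key := contDiffOn_convolution_right_with_param (𝕜 := ℝ) (n := (⊤ : ℕ∞))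
    (ContinuousLinearMap.lsmul ℝ ℝ) (g := g) (μ := volume) hU (k := Metric.closedBall 0 3)
    (isCompact_closedBall _ _) (by
      intro p x _ hx
      have : η x = 0 := η.zero_of_le_dist (not_le.1 fun h ↦ hx h).le
      simp [g, this]) hf (by
      refine ContDiffOn.smul ?_ (hF.comp (by fun_prop) fun q hq ↦ ⟨hq.1, mem_univ _⟩)
      exact (η.contDiff.comp contDiff_snd).contDiffOn)
  have h2 := key.comp (f := fun v : V ↦ (v, (0 : ℝ))) (s := U) (by fun_prop)
    (fun v hv ↦ ⟨hv, mem_univ _⟩)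
  refine h2.congr fun v hv ↦ ?_
  simp only [Function.comp, convolution, ContinuousLinearMap.lsmul_apply, f, g]
  rw [integral_of_le zero_le_one, ← MeasureTheory.integral_indicator measurableSet_Ioc]
  refine integral_congr_ae (.of_forall fun r ↦ ?_)
  by_cases hr : r ∈ Ioc (0 : ℝ) 1
  · have : η (0 - r) = 1 := η.one_of_mem_closedBall (by
      simp only [η, zero_sub, mem_closedBall_zero_iff, norm_neg, Real.norm_eq_abs]
      rw [abs_le]; constructor <;> linarith [hr.1, hr.2])
    rw [zero_sub] at this
    simp [hr, this]
  · simp [hr]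

/-- Differentiation under the integral sign over `[0, 1]`. -/
theorem hasFDerivAt_integral_unitInterval [FiniteDimensional ℝ V] {U : Set V} (hU : IsOpen U)
    {F : V × ℝ → G} (hF : ContDiffOn ℝ ∞ F (U ×ˢ univ)) {v : V} (hv : v ∈ U) :
    HasFDerivAt (fun v ↦ ∫ r in (0 : ℝ)..1, F (v, r))
      (∫ r in (0 : ℝ)..1, (fderiv ℝ F (v, r)).comp (.inl ℝ V ℝ)) v := by
  have hO : IsOpen (U ×ˢ (univ : Set ℝ)) := hU.prod isOpen_univ
  have hd : ContinuousOn (fun q : V × ℝ ↦ (fderiv ℝ F q).comp (.inl ℝ V ℝ)) (U ×ˢ univ) :=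
    ((hF.continuousOn_fderiv_of_isOpen hO (by simp)).clm_comp continuousOn_const)
  obtain ⟨ε, hε, hεU⟩ := Metric.nhds_basis_closedBall.mem_iff.1 (hU.mem_nhds hv)
  -- The dominating constant is a bound of the partial derivative on a closed ball times `[0, 1]`,
  -- compact because `V` has finite dimension.
  obtain ⟨C, hC⟩ := ((isCompact_closedBall v ε).prod (isCompact_Icc (a := (0 : ℝ)) (b := 1))
    ).exists_bound_of_continuousOn (hd.mono (prod_mono hεU (subset_univ _)))
  have hcont : ∀ w ∈ U, Continuous fun r : ℝ ↦ F (w, r) := fun w hw ↦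
    continuousOn_univ.1 (hF.continuousOn.comp (by fun_prop) fun r _ ↦ ⟨hw, mem_univ _⟩)
  refine hasFDerivAt_integral_of_dominated_of_fderiv_le (μ := volume) (bound := fun _ ↦ C)
    (F' := fun v r ↦ (fderiv ℝ F (v, r)).comp (.inl ℝ V ℝ)) (Metric.closedBall_mem_nhds v hε)
    ?_ ((hcont v hv).intervalIntegrable _ _) ?_ ?_ (by simp) ?_
  · filter_upwards [hU.mem_nhds hv] with w hw using (hcont w hw).aestronglyMeasurable
  · exact (continuousOn_univ.1 (hd.comp (f := fun r : ℝ ↦ (v, r)) (s := univ) (by fun_prop)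
      fun r _ ↦ ⟨hv, mem_univ _⟩)).aestronglyMeasurable
  · refine .of_forall fun r hr w hw ↦ hC (w, r) ⟨hw, ?_⟩
    rw [uIoc_of_le zero_le_one] at hr
    exact Ioc_subset_Icc_self hr
  · refine .of_forall fun r hr w hw ↦ ?_
    have h1 : HasFDerivAt F (fderiv ℝ F (w, r)) (w, r) :=
      ((hF.contDiffAt (hO.mem_nhds ⟨hεU hw, mem_univ _⟩)).differentiableAt (by simp)).hasFDerivAt
    exact h1.comp w (hasFDerivAt_prodMk_left w r)

end ParametricIntegral

section Bootstrap

variable {V : Type*} [NormedAddCommGroup V] [NormedSpace ℝ V]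

/-- A function whose logarithmic derivative is smooth is smooth. -/
theorem contDiffOn_of_hasFDerivAt_smul {U : Set V} (hU : IsOpen U) {g : V → ℂ}
    {κ : V → V →L[ℝ] ℂ} (hκ : ContDiffOn ℝ ∞ κ U)
    (hg : ∀ u ∈ U, HasFDerivAt g (g u • κ u) u) : ContDiffOn ℝ ∞ g U := by
  rw [contDiffOn_infty]
  intro n
  -- If `g` is of class `C^n`, so is its derivative `g • κ`, and then `g` is of class `C^(n+1)`.
  induction n with
  | zero =>
    rw [Nat.cast_zero, contDiffOn_zero]
    exact fun u hu ↦ (hg u hu).continuousAt.continuousWithinAt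
  | succ n ih =>
    rw [Nat.cast_succ, contDiffOn_succ_iff_fderiv_of_isOpen hU]
    refine ⟨fun u hu ↦ (hg u hu).differentiableAt.differentiableWithinAt, by simp, ?_⟩
    refine (ih.smul (hκ.of_le (by exact_mod_cast le_top))).congr fun u hu ↦ (hg u hu).fderiv

end Bootstrap

/-! ### Alternating forms of degree two and their exterior derivative. -/

section TwoForms

variable {E : Type*} [NormedAddCommGroup E] [NormedSpace ℝ E]

/-- Alternating forms of degree two as bilinear forms. -/
def altToBilin : (E [⋀^Fin 2]→L[ℝ] ℝ) →L[ℝ] E →L[ℝ] E →L[ℝ] ℝ :=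
  (ContinuousLinearMap.compL ℝ E _ _
    ((continuousMultilinearCurryFin1 ℝ E ℝ).toContinuousLinearEquiv :
      ContinuousMultilinearMap ℝ (fun _ : Fin 1 ↦ E) ℝ →L[ℝ] E →L[ℝ] ℝ)) ∘L
  ((continuousMultilinearCurryLeftEquiv ℝ (fun _ : Fin 2 ↦ E) ℝ).toContinuousLinearEquiv :
      ContinuousMultilinearMap ℝ (fun _ : Fin 2 ↦ E) ℝ →L[ℝ] _) ∘L
  (ContinuousAlternatingMap.toContinuousMultilinearMapCLM ℝ)

@[simp] theorem altToBilin_apply (Φ : E [⋀^Fin 2]→L[ℝ] ℝ) (v w : E) :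
    altToBilin Φ v w = Φ ![v, w] := by
  change Φ (Fin.cons v (Fin.snoc 0 w)) = _
  congr 1
  ext i
  fin_cases i <;> rfl

theorem alt_swap (Φ : E [⋀^Fin 2]→L[ℝ] ℝ) (v w : E) : Φ ![w, v] = -Φ ![v, w] := by
  have := Φ.toAlternatingMap.map_swap ![v, w] (i := 0) (j := 1) (by simp)
  rw [show (![v, w] : Fin 2 → E) ∘ Equiv.swap 0 1 = ![w, v] by
    ext i; fin_cases i <;> rfl] at this
  exact this

theorem extDeriv_two_apply {Φ : E → E [⋀^Fin 2]→L[ℝ] ℝ} {u : E} (h : DifferentiableAt ℝ Φ u)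
    (x y z : E) : extDeriv Φ u ![x, y, z] =
      fderiv ℝ Φ u x ![y, z] - fderiv ℝ Φ u y ![x, z] + fderiv ℝ Φ u z ![x, y] := by
  rw [extDeriv_apply h]
  have h0 : (0 : Fin 3).removeNth ![x, y, z] = ![y, z] := by ext i; fin_cases i <;> rfl
  have h1 : (1 : Fin 3).removeNth ![x, y, z] = ![x, z] := by ext i; fin_cases i <;> rfl
  have h2 : (2 : Fin 3).removeNth ![x, y, z] = ![x, y] := by ext i; fin_cases i <;> rfl
  have e (v : E) (w : Fin 2 → E) : fderiv ℝ (fun x ↦ Φ x w) u v = fderiv ℝ Φ u v w := by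
    have := (((ContinuousAlternatingMap.toContinuousMultilinearMapCLM ℝ).hasFDerivAt.comp u
      h.hasFDerivAt))
    have h3 := ((ContinuousMultilinearMap.apply ℝ (fun _ : Fin 2 ↦ E) ℝ w).hasFDerivAt.comp u this)
    exact congrArg (fun l : E →L[ℝ] ℝ ↦ l v) h3.fderiv
  simp [Fin.sum_univ_three, h0, h1, h2, e]
  ring

end TwoForms

end BohrSommerfeld

namespace BohrSommerfeld

/-! ### The Poincaré lemma on convex sets. -/

section PoincareLemma

open Set intervalIntegral MeasureTheory

variable {E : Type*} [NormedAddCommGroup E] [NormedSpace ℝ E]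

local notation "ρ" => Real.smoothTransition

theorem smoothTransition_mem (r : ℝ) : ρ r ∈ Icc (0 : ℝ) 1 :=
  ⟨Real.smoothTransition.nonneg r, Real.smoothTransition.le_one r⟩

theorem contDiff_smoothTransition : ContDiff ℝ ∞ ρ := Real.smoothTransition.contDiff

theorem contDiff_deriv_smoothTransition : ContDiff ℝ ∞ (deriv ρ) :=
  (contDiff_infty_iff_deriv.1 contDiff_smoothTransition).2

theorem hasDerivAt_smoothTransition (r : ℝ) : HasDerivAt ρ (deriv ρ r) r :=
  (contDiff_smoothTransition.differentiable (by simp) r).hasDerivAt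

/-- The point `ρ r` of the segment from `a` to `u`, where `ρ` is the smooth transition. -/
def ray (a u : E) (r : ℝ) : E := a + ρ r • (u - a)

@[simp] theorem ray_zero (a u : E) : ray a u 0 = a := by simp [ray]

@[simp] theorem ray_one (a u : E) : ray a u 1 = u := by simp [ray]

/-- The smooth transition takes values in `[0, 1]` at every real number, so the ray is a smooth path
defined on the whole line that never leaves the segment. This is what allows rays to serve as
arguments of characters of globally smooth paths. -/
theorem Convex.ray_mem {S : Set E} (hS : Convex ℝ S) {a u : E} (ha : a ∈ S) (hu : u ∈ S) (r : ℝ) :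
    ray a u r ∈ S :=
  hS.add_smul_sub_mem ha hu (smoothTransition_mem r)

theorem contDiff_ray : ContDiff ℝ ∞ fun q : E × E × ℝ ↦ ray q.1 q.2.1 q.2.2 := by
  unfold ray
  have := contDiff_smoothTransition
  fun_prop

theorem hasDerivAt_ray (a u : E) (r : ℝ) : HasDerivAt (ray a u) (deriv ρ r • (u - a)) r :=
  ((hasDerivAt_smoothTransition r).smul_const (u - a)).const_add a

/-- The radial primitive of a two-form. -/
def radialPrimitive (B : E → E →L[ℝ] E →L[ℝ] ℝ) (a u : E) : E →L[ℝ] ℝ :=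
  ∫ r in (0 : ℝ)..1, (ρ r * deriv ρ r) • B (ray a u r) (u - a)

variable {S : Set E} {B : E → E →L[ℝ] E →L[ℝ] ℝ} {a : E}

theorem contDiffOn_radialPrimitive_integrand (hS : Convex ℝ S) (ha : a ∈ S)
    (hB : ContDiffOn ℝ ∞ B S) :
    ContDiffOn ℝ ∞ (fun q : E × ℝ ↦ (ρ q.2 * deriv ρ q.2) • B (ray a q.1 q.2) (q.1 - a))
      (S ×ˢ univ) := by
  have h1 := contDiff_smoothTransition
  have h2 := contDiff_deriv_smoothTransition
  have h3 : ContDiff ℝ ∞ fun q : E × ℝ ↦ ρ q.2 * deriv ρ q.2 := by fun_prop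
  have h4 : ContDiff ℝ ∞ fun q : E × ℝ ↦ q.1 - a := by fun_prop
  refine h3.contDiffOn.smul (ContDiffOn.clm_apply ?_ h4.contDiffOn)
  exact hB.comp ((contDiff_ray.comp (f := fun q : E × ℝ ↦ (a, q.1, q.2)) (by fun_prop)).contDiffOn)
    fun q hq ↦ Convex.ray_mem hS ha hq.1 _

theorem contDiffOn_radialPrimitive (hS : Convex ℝ S) (hSo : IsOpen S) (ha : a ∈ S)
    (hB : ContDiffOn ℝ ∞ B S) : ContDiffOn ℝ ∞ (radialPrimitive B a) S :=
  contDiffOn_integral_unitInterval hSo (contDiffOn_radialPrimitive_integrand hS ha hB)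

theorem hasFDerivAt_radialPrimitive_integrand {u : E} {r : ℝ}
    (hB : HasFDerivAt B (fderiv ℝ B (ray a u r)) (ray a u r)) :
    HasFDerivAt (fun u ↦ (ρ r * deriv ρ r) • B (ray a u r) (u - a))
      ((ρ r * deriv ρ r) • (B (ray a u r) +
        ((fderiv ℝ B (ray a u r)).comp (ρ r • ContinuousLinearMap.id ℝ E)).flip (u - a))) u := by
  have h3 : HasFDerivAt (fun u ↦ ray a u r) (ρ r • ContinuousLinearMap.id ℝ E) u :=
    (((hasFDerivAt_id u).sub_const a).const_smul (ρ r)).const_add a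
  have h4 : HasFDerivAt (fun u ↦ B (ray a u r))
      ((fderiv ℝ B (ray a u r)).comp (ρ r • ContinuousLinearMap.id ℝ E)) u :=
    HasFDerivAt.comp (g := B) (f := fun u ↦ ray a u r) u hB h3
  have h5 : HasFDerivAt (fun u ↦ u - a) (ContinuousLinearMap.id ℝ E) u :=
    (hasFDerivAt_id u).sub_const a
  exact (h4.clm_apply h5).const_smul (ρ r * deriv ρ r)

/-- This is the antiderivative of the homotopy formula: for closed `B` its derivative is the
integrand of `dα (v, w)`, where `α` is the radial primitive. The function vanishes at `r = 0` and
equals `B u v w` at `r = 1`. -/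
theorem hasDerivAt_sq_smul_ray {u : E} {r : ℝ}
    (hB : HasFDerivAt B (fderiv ℝ B (ray a u r)) (ray a u r)) (v w : E) :
    HasDerivAt (fun r ↦ ρ r ^ 2 * B (ray a u r) v w)
      (2 * ρ r * deriv ρ r * B (ray a u r) v w +
        ρ r ^ 2 * (deriv ρ r * fderiv ℝ B (ray a u r) (u - a) v w)) r := by
  have h1 : HasDerivAt (fun r ↦ B (ray a u r)) (fderiv ℝ B (ray a u r) (deriv ρ r • (u - a))) r :=
    HasFDerivAt.comp_hasDerivAt (l := B) (f := ray a u) r hB (hasDerivAt_ray a u r)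
  let ev : (E →L[ℝ] E →L[ℝ] ℝ) →L[ℝ] ℝ :=
    (ContinuousLinearMap.apply ℝ ℝ w).comp (ContinuousLinearMap.apply ℝ (E →L[ℝ] ℝ) v)
  have h2 : HasDerivAt (fun r ↦ B (ray a u r) v w)
      (deriv ρ r * fderiv ℝ B (ray a u r) (u - a) v w) r := by
    refine (ev.hasFDerivAt.comp_hasDerivAt r h1).congr_deriv ?_
    rw [map_smul, map_smul]
    rfl
  have h3 := ((hasDerivAt_smoothTransition r).pow 2).mul h2
  refine h3.congr_deriv ?_
  norm_num

/-- The Poincaré lemma for two-forms. -/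
theorem fderiv_radialPrimitive [FiniteDimensional ℝ E] (hS : Convex ℝ S) (hSo : IsOpen S)
    (ha : a ∈ S) (hB : ContDiffOn ℝ ∞ B S) (hanti : ∀ u ∈ S, ∀ x y, B u x y = -B u y x)
    (hclosed : ∀ u ∈ S, ∀ x y z,
      fderiv ℝ B u x y z - fderiv ℝ B u y x z + fderiv ℝ B u z x y = 0)
    {u : E} (hu : u ∈ S) (v w : E) :
    fderiv ℝ (radialPrimitive B a) u v w - fderiv ℝ (radialPrimitive B a) u w v = B u v w := by
  set F : E × ℝ → E →L[ℝ] ℝ := fun q ↦ (ρ q.2 * deriv ρ q.2) • B (ray a q.1 q.2) (q.1 - a)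
  have hF : ContDiffOn ℝ ∞ F (S ×ˢ univ) := contDiffOn_radialPrimitive_integrand hS ha hB
  have hO : IsOpen (S ×ˢ (univ : Set ℝ)) := hSo.prod isOpen_univ
  have hBd (r : ℝ) : HasFDerivAt B (fderiv ℝ B (ray a u r)) (ray a u r) :=
    ((hB.contDiffAt (hSo.mem_nhds (Convex.ray_mem hS ha hu r))).differentiableAt
      (by simp)).hasFDerivAt
  have hderiv := hasFDerivAt_integral_unitInterval hSo hF hu
  have hFd (r : ℝ) (x : E) : (fderiv ℝ F (u, r)).comp (.inl ℝ E ℝ) x =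
      (ρ r * deriv ρ r) • (ρ r • fderiv ℝ B (ray a u r) x (u - a) + B (ray a u r) x) := by
    have h1 : HasFDerivAt F (fderiv ℝ F (u, r)) (u, r) :=
      ((hF.contDiffAt (hO.mem_nhds ⟨hu, mem_univ _⟩)).differentiableAt (by simp)).hasFDerivAt
    have h2 : HasFDerivAt (fun u ↦ F (u, r)) ((fderiv ℝ F (u, r)).comp (.inl ℝ E ℝ)) u :=
      HasFDerivAt.comp (f := fun e : E ↦ (e, r)) u h1 (hasFDerivAt_prodMk_left u r)
    rw [h2.unique (hasFDerivAt_radialPrimitive_integrand (hBd r))]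
    simp only [smul_apply, add_apply, ContinuousLinearMap.flip_apply,
      ContinuousLinearMap.comp_apply, map_smul, ContinuousLinearMap.id_apply]
    rw [add_comm]
  have hint : Continuous fun r : ℝ ↦ (fderiv ℝ F (u, r)).comp (.inl ℝ E ℝ) :=
    (continuousOn_univ.1 ((hF.continuousOn_fderiv_of_isOpen hO (by simp)).comp
      (f := fun r : ℝ ↦ (u, r)) (s := univ) (by fun_prop) fun r _ ↦ ⟨hu, mem_univ _⟩)).clm_comp
      continuous_const
  have happ (x y : E) : fderiv ℝ (radialPrimitive B a) u x y =
      ∫ r in (0 : ℝ)..1, (fderiv ℝ F (u, r)).comp (.inl ℝ E ℝ) x y := by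
    rw [show radialPrimitive B a = fun v ↦ ∫ r in (0 : ℝ)..1, F (v, r) from rfl, hderiv.fderiv,
      ContinuousLinearMap.intervalIntegral_apply (hint.intervalIntegrable _ _),
      ContinuousLinearMap.intervalIntegral_apply
        ((hint.clm_apply continuous_const).intervalIntegrable _ _)]
  have hG (r : ℝ) : HasDerivAt (fun r ↦ ρ r ^ 2 * B (ray a u r) v w)
      (2 * ρ r * deriv ρ r * B (ray a u r) v w +
        ρ r ^ 2 * (deriv ρ r * fderiv ℝ B (ray a u r) (u - a) v w)) r :=
    hasDerivAt_sq_smul_ray (hBd r) v w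
  -- Closedness, applied to `u - a`, `v`, `w`, trades the antisymmetrized derivative for the
  -- derivative along the ray; antisymmetry of `B` supplies the factor 2.
  have hsub (r : ℝ) : (fderiv ℝ F (u, r)).comp (.inl ℝ E ℝ) v w -
      (fderiv ℝ F (u, r)).comp (.inl ℝ E ℝ) w v =
      2 * ρ r * deriv ρ r * B (ray a u r) v w +
        ρ r ^ 2 * (deriv ρ r * fderiv ℝ B (ray a u r) (u - a) v w) := by
    have hm := Convex.ray_mem hS ha hu r
    have h1 := hclosed _ hm (u - a) v w
    have h2 := hanti _ hm w v
    rw [hFd, hFd]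
    simp only [smul_apply, add_apply, smul_eq_mul]
    linear_combination (ρ r ^ 2 * deriv ρ r) * (-h1) - ρ r * deriv ρ r * h2
  have hi (x y : E) : IntervalIntegrable
      (fun r ↦ (fderiv ℝ F (u, r)).comp (.inl ℝ E ℝ) x y) volume 0 1 :=
    ((hint.clm_apply continuous_const).clm_apply continuous_const).intervalIntegrable _ _
  rw [happ, happ, ← integral_sub (hi v w) (hi w v)]
  simp only [hsub]
  rw [integral_eq_sub_of_hasDerivAt (fun r _ ↦ hG r)]
  · simp
  · have := ((hint.clm_apply (continuous_const (y := v))).clm_apply (continuous_const (y := w))).sub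
      ((hint.clm_apply (continuous_const (y := w))).clm_apply (continuous_const (y := v)))
    exact (this.congr hsub).intervalIntegrable _ _

end PoincareLemma

end BohrSommerfeld

namespace BohrSommerfeld

/-! ### Two-forms in the charts of the maximal atlas. -/

section Charts

open Set

variable {E : Type*} [NormedAddCommGroup E] [NormedSpace ℝ E]
  {X : Type*} [TopologicalSpace X] [ChartedSpace E X] [IsManifold 𝓘(ℝ, E) ∞ X]
  {V : Type*} [NormedAddCommGroup V] [NormedSpace ℝ V]
  {M : Type*} [TopologicalSpace M] [ChartedSpace V M]
  {e e' : OpenPartialHomeomorph X E}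

theorem contMDiffAt_chart (he : e ∈ IsManifold.maximalAtlas 𝓘(ℝ, E) ∞ X) {x : X}
    (hx : x ∈ e.source) : ContMDiffAt 𝓘(ℝ, E) 𝓘(ℝ, E) ∞ e x :=
  (contMDiffOn_of_mem_maximalAtlas he).contMDiffAt (e.open_source.mem_nhds hx)

theorem contMDiffAt_chart_symm (he : e ∈ IsManifold.maximalAtlas 𝓘(ℝ, E) ∞ X) {u : E}
    (hu : u ∈ e.target) : ContMDiffAt 𝓘(ℝ, E) 𝓘(ℝ, E) ∞ e.symm u :=
  (contMDiffOn_symm_of_mem_maximalAtlas he).contMDiffAt (e.open_target.mem_nhds hu)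

theorem mdifferentiableAt_chart (he : e ∈ IsManifold.maximalAtlas 𝓘(ℝ, E) ∞ X) {x : X}
    (hx : x ∈ e.source) : MDifferentiableAt 𝓘(ℝ, E) 𝓘(ℝ, E) e x :=
  (contMDiffAt_chart he hx).mdifferentiableAt (by simp)

theorem mdifferentiableAt_chart_symm (he : e ∈ IsManifold.maximalAtlas 𝓘(ℝ, E) ∞ X) {u : E}
    (hu : u ∈ e.target) : MDifferentiableAt 𝓘(ℝ, E) 𝓘(ℝ, E) e.symm u :=
  (contMDiffAt_chart_symm he hu).mdifferentiableAt (by simp)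

theorem chart_mdifferentiable (he : e ∈ IsManifold.maximalAtlas 𝓘(ℝ, E) ∞ X) :
    e.MDifferentiable 𝓘(ℝ, E) 𝓘(ℝ, E) :=
  ⟨fun _ hx ↦ (mdifferentiableAt_chart he hx).mdifferentiableWithinAt,
    fun _ hu ↦ (mdifferentiableAt_chart_symm he hu).mdifferentiableWithinAt⟩

theorem mfderiv_chart_symm_chart (he : e ∈ IsManifold.maximalAtlas 𝓘(ℝ, E) ∞ X) {x : X}
    (hx : x ∈ e.source) (v : TangentSpace 𝓘(ℝ, E) x) :
    mfderiv 𝓘(ℝ, E) 𝓘(ℝ, E) e.symm (e x) (mfderiv 𝓘(ℝ, E) 𝓘(ℝ, E) e x v) = v :=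
  congrArg (fun l : E →L[ℝ] E ↦ l v) ((chart_mdifferentiable he).symm_comp_deriv hx)

theorem mfderiv_chart_chart_symm (he : e ∈ IsManifold.maximalAtlas 𝓘(ℝ, E) ∞ X) {u : E}
    (hu : u ∈ e.target) (v : E) :
    mfderiv 𝓘(ℝ, E) 𝓘(ℝ, E) e (e.symm u) (mfderiv 𝓘(ℝ, E) 𝓘(ℝ, E) e.symm u v) = v :=
  congrArg (fun l : E →L[ℝ] E ↦ l v) ((chart_mdifferentiable he).comp_symm_deriv hu)

theorem mfderiv_chart_comp (he : e ∈ IsManifold.maximalAtlas 𝓘(ℝ, E) ∞ X) {f : M → X} {p : M}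
    (hf : MDifferentiableAt 𝓘(ℝ, V) 𝓘(ℝ, E) f p) (hp : f p ∈ e.source)
    (v : TangentSpace 𝓘(ℝ, V) p) :
    mfderiv 𝓘(ℝ, V) 𝓘(ℝ, E) (e ∘ f) p v =
      mfderiv 𝓘(ℝ, E) 𝓘(ℝ, E) e (f p) (mfderiv 𝓘(ℝ, V) 𝓘(ℝ, E) f p v) :=
  congrArg (fun l : V →L[ℝ] E ↦ l v) (mfderiv_comp p (mdifferentiableAt_chart he hp) hf)

theorem TwoForm.inChart_apply (Ω : TwoForm E X) (u v w : E) : Ω.inChart e u ![v, w] =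
    Ω (e.symm u) ![mfderiv 𝓘(ℝ, E) 𝓘(ℝ, E) e.symm u v, mfderiv 𝓘(ℝ, E) 𝓘(ℝ, E) e.symm u w] := by
  change Ω (e.symm u) _ = _
  congr 1
  ext i
  fin_cases i <;> rfl

/-- The values of a two-form computed in a chart. -/
theorem TwoForm.inChart_mfderiv (Ω : TwoForm E X) (he : e ∈ IsManifold.maximalAtlas 𝓘(ℝ, E) ∞ X)
    {x : X} (hx : x ∈ e.source) (v w : TangentSpace 𝓘(ℝ, E) x) :
    Ω.inChart e (e x) ![mfderiv 𝓘(ℝ, E) 𝓘(ℝ, E) e x v, mfderiv 𝓘(ℝ, E) 𝓘(ℝ, E) e x w] =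
      Ω x ![v, w] := by
  have key : ∀ (y : X) (hy : y = x) (v' w' : E), v' = v → w' = w →
      Ω y ![(v' : TangentSpace 𝓘(ℝ, E) y), w'] = Ω x ![v, w] := by
    rintro y rfl v' w' rfl rfl
    rfl
  exact (Ω.inChart_apply _ _ _).trans (key _ (e.left_inv hx) _ _ (mfderiv_chart_symm_chart he hx v)
    (mfderiv_chart_symm_chart he hx w))

/-- The pullback of a two-form computed in a chart. -/
theorem TwoForm.pullback_eq (Ω : TwoForm E X) (he : e ∈ IsManifold.maximalAtlas 𝓘(ℝ, E) ∞ X)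
    {f : M → X} {p : M} (hf : MDifferentiableAt 𝓘(ℝ, V) 𝓘(ℝ, E) f p) (hp : f p ∈ e.source)
    (v w : TangentSpace 𝓘(ℝ, V) p) :
    Ω (f p) ![mfderiv 𝓘(ℝ, V) 𝓘(ℝ, E) f p v, mfderiv 𝓘(ℝ, V) 𝓘(ℝ, E) f p w] =
      Ω.inChart e (e (f p)) ![mfderiv 𝓘(ℝ, V) 𝓘(ℝ, E) (e ∘ f) p v,
        mfderiv 𝓘(ℝ, V) 𝓘(ℝ, E) (e ∘ f) p w] := by
  rw [mfderiv_chart_comp he hf hp, mfderiv_chart_comp he hf hp, Ω.inChart_mfderiv he hp]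

theorem contDiffAt_chart_comp (he : e ∈ IsManifold.maximalAtlas 𝓘(ℝ, E) ∞ X) {f : V → X} {p : V}
    (hf : ContMDiffAt 𝓘(ℝ, V) 𝓘(ℝ, E) ∞ f p) (hp : f p ∈ e.source) :
    ContDiffAt ℝ ∞ (e ∘ f) p :=
  ((contMDiffAt_chart he hp).comp p hf).contDiffAt

theorem contDiffAt_transition (he : e ∈ IsManifold.maximalAtlas 𝓘(ℝ, E) ∞ X)
    (he' : e' ∈ IsManifold.maximalAtlas 𝓘(ℝ, E) ∞ X) {u : E} (hu : u ∈ e.target)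
    (hu' : e.symm u ∈ e'.source) : ContDiffAt ℝ ∞ (e' ∘ e.symm) u :=
  contDiffAt_chart_comp he' (contMDiffAt_chart_symm he hu) hu'

theorem TwoForm.inChart_transition (Ω : TwoForm E X)
    (he : e ∈ IsManifold.maximalAtlas 𝓘(ℝ, E) ∞ X)
    (he' : e' ∈ IsManifold.maximalAtlas 𝓘(ℝ, E) ∞ X) {u : E} (hu : u ∈ e.target)
    (hu' : e.symm u ∈ e'.source) :
    Ω.inChart e u = (Ω.inChart e' ((e' ∘ e.symm) u)).compContinuousLinearMap
      (fderiv ℝ (e' ∘ e.symm) u) := by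
  ext v
  have hv : v = ![v 0, v 1] := by ext i; fin_cases i <;> rfl
  have h := Ω.pullback_eq he' (mdifferentiableAt_chart_symm he hu) hu' (v 0) (v 1)
  rw [mfderiv_eq_fderiv] at h
  rw [hv, TwoForm.inChart_apply]
  refine h.trans ?_
  change _ = Ω.inChart e' _ _
  congr 1
  ext i
  fin_cases i <;> rfl

theorem TwoForm.eventually_inChart_eq (Ω : TwoForm E X)
    (he : e ∈ IsManifold.maximalAtlas 𝓘(ℝ, E) ∞ X) (he' : e' ∈ IsManifold.maximalAtlas 𝓘(ℝ, E) ∞ X)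
    {u : E} (hu : u ∈ e.target) (hu' : e.symm u ∈ e'.source) :
    Ω.inChart e =ᶠ[nhds u] fun u ↦ (Ω.inChart e' ((e' ∘ e.symm) u)).compContinuousLinearMap
      (fderiv ℝ (e' ∘ e.symm) u) := by
  have h := (e.symm.continuousAt hu).preimage_mem_nhds (e'.open_source.mem_nhds hu')
  filter_upwards [h, e.open_target.mem_nhds hu] with v hv hv'
  exact Ω.inChart_transition he he' hv' hv

/-- The definition of a symplectic form speaks only of the preferred charts; the form in another
chart is the pullback by a smooth transition map. -/
theorem IsSymplectic.differentiableAt_inChart {Ω : TwoForm E X} (hΩ : IsSymplectic Ω)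
    (he : e ∈ IsManifold.maximalAtlas 𝓘(ℝ, E) ∞ X) {u : E} (hu : u ∈ e.target) :
    DifferentiableAt ℝ (Ω.inChart e) u := by
  set x := e.symm u
  have hx : e.symm u ∈ (chartAt E x).source := mem_chart_source E x
  have hc := IsManifold.chart_mem_maximalAtlas (I := 𝓘(ℝ, E)) (n := ∞) x
  have ht := contDiffAt_transition he hc hu hx
  refine DifferentiableAt.congr_of_eventuallyEq ?_
    (TwoForm.eventually_inChart_eq Ω he hc hu hx)
  have h1 : DifferentiableAt ℝ (fun u ↦ Ω.inChart (chartAt E x) ((chartAt E x ∘ e.symm) u)) u :=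
    DifferentiableAt.comp (g := Ω.inChart (chartAt E x)) u (((hΩ.smooth x).contDiffAt
      ((chartAt E x).open_target.mem_nhds ((chartAt E x).map_source hx))).differentiableAt
        (by simp)) (ht.differentiableAt (by simp))
  exact h1.continuousAlternatingMapCompContinuousLinearMap
    ((ht.fderiv_right (m := ∞) (by simp)).differentiableAt (by simp))

/-- The exterior derivative commutes with the pullback by the transition map to a preferred chart.
-/
theorem IsSymplectic.extDeriv_inChart {Ω : TwoForm E X} (hΩ : IsSymplectic Ω)
    (he : e ∈ IsManifold.maximalAtlas 𝓘(ℝ, E) ∞ X) {u : E} (hu : u ∈ e.target) :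
    extDeriv (Ω.inChart e) u = 0 := by
  set x := e.symm u
  have hx : e.symm u ∈ (chartAt E x).source := mem_chart_source E x
  have hc := IsManifold.chart_mem_maximalAtlas (I := 𝓘(ℝ, E)) (n := ∞) x
  have ht := contDiffAt_transition he hc hu hx
  have hm := (chartAt E x).map_source hx
  rw [(TwoForm.eventually_inChart_eq Ω he hc hu hx).extDeriv_eq,
    extDeriv_pullback (f := chartAt E x ∘ e.symm) (r := ∞) (((hΩ.smooth x).contDiffAt
      ((chartAt E x).open_target.mem_nhds hm)).differentiableAt (by simp)) ht
      (by rw [minSmoothness_of_isRCLikeNormedField]; exact WithTop.coe_le_coe.2 (le_top (a := (2 : ℕ∞))))]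
  rw [show extDeriv (Ω.inChart (chartAt E x)) ((chartAt E x ∘ e.symm) u) = 0 from hΩ.closed x _ hm]
  ext v
  rfl

/-- A two-form in a chart, as a field of bilinear forms. -/
def TwoForm.bilin (Ω : TwoForm E X) (e : OpenPartialHomeomorph X E) (u : E) : E →L[ℝ] E →L[ℝ] ℝ :=
  altToBilin (Ω.inChart e u)

@[simp] theorem TwoForm.bilin_apply (Ω : TwoForm E X) (u v w : E) :
    Ω.bilin e u v w = Ω.inChart e u ![v, w] := altToBilin_apply _ _ _

theorem IsSymplectic.contDiffOn_bilin {Ω : TwoForm E X} (hΩ : IsSymplectic Ω)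
    (he : e ∈ IsManifold.maximalAtlas 𝓘(ℝ, E) ∞ X) : ContDiffOn ℝ ∞ (Ω.bilin e) e.target := by
  intro u hu
  set x := e.symm u
  have hx : e.symm u ∈ (chartAt E x).source := mem_chart_source E x
  have hc := IsManifold.chart_mem_maximalAtlas (I := 𝓘(ℝ, E)) (n := ∞) x
  have ht := contDiffAt_transition he hc hu hx
  have hB : ContDiffAt ℝ ∞ (fun u ↦ Ω.bilin (chartAt E x) ((chartAt E x ∘ e.symm) u)) u :=
    ContDiffAt.comp (g := Ω.bilin (chartAt E x)) u (ContDiffAt.comp (g := altToBilin) _ (altToBilin (E := E)).contDiff.contDiffAt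
      ((hΩ.smooth x).contDiffAt ((chartAt E x).open_target.mem_nhds
        ((chartAt E x).map_source hx)))) ht
  have hd : ContDiffAt ℝ ∞ (fderiv ℝ (chartAt E x ∘ e.symm)) u := ht.fderiv_right (by simp)
  have h2 := ((ContinuousLinearMap.compL ℝ E E ℝ).flip.contDiff.contDiffAt.comp u hd).clm_comp
    (hB.clm_comp hd)
  refine (h2.congr_of_eventuallyEq ?_).contDiffWithinAt
  filter_upwards [TwoForm.eventually_inChart_eq Ω he hc hu hx] with w hw
  ext y z
  rw [TwoForm.bilin_apply, hw]
  change Ω.inChart _ _ _ = Ω.bilin _ _ _ _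
  rw [TwoForm.bilin_apply]
  congr 1
  ext i
  fin_cases i <;> rfl

theorem IsSymplectic.bilin_closed {Ω : TwoForm E X} (hΩ : IsSymplectic Ω)
    (he : e ∈ IsManifold.maximalAtlas 𝓘(ℝ, E) ∞ X) {u : E} (hu : u ∈ e.target) (x y z : E) :
    fderiv ℝ (Ω.bilin e) u x y z - fderiv ℝ (Ω.bilin e) u y x z +
      fderiv ℝ (Ω.bilin e) u z x y = 0 := by
  have hd := hΩ.differentiableAt_inChart he hu
  have h1 : fderiv ℝ (Ω.bilin e) u = altToBilin ∘L fderiv ℝ (Ω.inChart e) u :=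
    (altToBilin.hasFDerivAt.comp u hd.hasFDerivAt).fderiv
  have := extDeriv_two_apply hd x y z
  rw [hΩ.extDeriv_inChart he hu] at this
  simp only [h1, ContinuousLinearMap.comp_apply, altToBilin_apply]
  exact this.symm

theorem TwoForm.bilin_swap (Ω : TwoForm E X) (u x y : E) :
    Ω.bilin e u x y = -Ω.bilin e u y x := by
  rw [bilin_apply, bilin_apply, alt_swap]

end Charts

end BohrSommerfeld

namespace BohrSommerfeld

/-! ### Pullbacks of one-forms. -/

section OneForms

variable {E : Type*} [NormedAddCommGroup E] [NormedSpace ℝ E]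
  {V : Type*} [NormedAddCommGroup V] [NormedSpace ℝ V]
  {W : Type*} [NormedAddCommGroup W] [NormedSpace ℝ W]

/-- The pullback of a one-form. -/
def pullbackForm (θ : E → E →L[ℝ] W) (g : V → E) (p : V) : V →L[ℝ] W :=
  (θ (g p)).comp (fderiv ℝ g p)

theorem contDiffAt_pullbackForm {θ : E → E →L[ℝ] W} {g : V → E} {p : V}
    (hθ : ContDiffAt ℝ ∞ θ (g p)) (hg : ContDiffAt ℝ ∞ g p) :
    ContDiffAt ℝ ∞ (pullbackForm θ g) p :=
  (ContDiffAt.comp (g := θ) p hθ hg).clm_comp (hg.fderiv_right (by simp))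

/-- The terms containing the second derivative of `g` cancel by its symmetry. -/
theorem fderiv_pullbackForm_sub {θ : E → E →L[ℝ] W} {g : V → E} {p : V}
    (hθ : DifferentiableAt ℝ θ (g p)) (hg : ContDiffAt ℝ ∞ g p) (v w : V) :
    fderiv ℝ (pullbackForm θ g) p v w - fderiv ℝ (pullbackForm θ g) p w v =
      fderiv ℝ θ (g p) (fderiv ℝ g p v) (fderiv ℝ g p w) -
        fderiv ℝ θ (g p) (fderiv ℝ g p w) (fderiv ℝ g p v) := by
  have h1 : HasFDerivAt (fun p ↦ θ (g p)) ((fderiv ℝ θ (g p)).comp (fderiv ℝ g p)) p :=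
    HasFDerivAt.comp (g := θ) p hθ.hasFDerivAt (hg.differentiableAt (by simp)).hasFDerivAt
  have h2 : HasFDerivAt (fderiv ℝ g) (fderiv ℝ (fderiv ℝ g) p) p :=
    ((hg.fderiv_right (m := ∞) (by simp)).differentiableAt (by simp)).hasFDerivAt
  have hs : IsSymmSndFDerivAt ℝ g p := hg.isSymmSndFDerivAt (by
    rw [minSmoothness_of_isRCLikeNormedField]
    exact WithTop.coe_le_coe.2 (le_top (a := (2 : ℕ∞))))
  have h3 := (h1.clm_comp h2).fderiv
  have h4 : fderiv ℝ (pullbackForm θ g) p = _ := h3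
  rw [h4]
  simp only [add_apply, ContinuousLinearMap.comp_apply, ContinuousLinearMap.compL_apply,
    ContinuousLinearMap.flip_apply, hs.eq v w]
  abel

end OneForms

/-! ### Prequantum atlases: local frames and connection forms. -/

section Atlas

open Set

variable {E : Type*} [NormedAddCommGroup E] [NormedSpace ℝ E]
  {X : Type*} [TopologicalSpace X] [ChartedSpace E X]

/-- A family of local frames `c a` of a line bundle over `X` with connection of curvature
`-2iπΩ`, written with respect to a (discontinuous) global frame, with the connection forms `θ a`
in charts. -/
structure PrequantumAtlas (Ω : TwoForm E X) where
  chart : X → OpenPartialHomeomorph X E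
  chart_mem : ∀ a, chart a ∈ IsManifold.maximalAtlas 𝓘(ℝ, E) ∞ X
  mem_source : ∀ a, a ∈ (chart a).source
  c : X → X → ℂ
  c_ne_zero : ∀ a x, c a x ≠ 0
  θ : X → E → E →L[ℝ] ℂ
  contDiffOn_θ : ∀ a, ContDiffOn ℝ ∞ (θ a) (chart a).target
  curvature : ∀ a, ∀ u ∈ (chart a).target, ∀ v w : E,
    fderiv ℝ (θ a) u v w - fderiv ℝ (θ a) u w v =
      -2 * Complex.I * Real.pi * (Ω.inChart (chart a) u ![v, w] : ℝ)
  compat : ∀ a b, ∀ x ∈ (chart a).source, x ∈ (chart b).source →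
    HasMFDerivAt 𝓘(ℝ, E) 𝓘(ℝ, ℂ) (fun y ↦ c a y / c b y) x
      ((c a x / c b x) •
        ((θ a (chart a x)).comp (mfderiv 𝓘(ℝ, E) 𝓘(ℝ, E) (chart a) x) -
          (θ b (chart b x)).comp (mfderiv 𝓘(ℝ, E) 𝓘(ℝ, E) (chart b) x) : E →L[ℝ] ℂ))

namespace PrequantumAtlas

variable {Ω : TwoForm E X} (P : PrequantumAtlas Ω)

/-- The connection form of the local frame `c a`. -/
def form (a x : X) : E →L[ℝ] ℂ :=
  (P.θ a (P.chart a x)).comp (mfderiv 𝓘(ℝ, E) 𝓘(ℝ, E) (P.chart a) x)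

/-- The local frames have smooth norms and the connection is unitary. -/
def IsHermitian : Prop := ∀ a, ∀ x ∈ (P.chart a).source,
  HasMFDerivAt 𝓘(ℝ, E) 𝓘(ℝ, ℝ) (fun y ↦ Complex.normSq (P.c a y)) x
    ((2 * Complex.normSq (P.c a x)) • (Complex.reCLM.comp (P.form a x)) : E →L[ℝ] ℝ)

/-- The global frame is smooth and parallel along the map `ι`. -/
def IsFlatAlong {F : Type*} [NormedAddCommGroup F] [NormedSpace ℝ F]
    {Q : Type*} [TopologicalSpace Q] [ChartedSpace F Q] (ι : Q → X) : Prop :=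
  ∀ a q, ι q ∈ (P.chart a).source →
    HasMFDerivAt 𝓘(ℝ, F) 𝓘(ℝ, ℂ) (fun q' ↦ P.c a (ι q')) q
      (P.c a (ι q) • (P.form a (ι q)).comp (mfderiv 𝓘(ℝ, F) 𝓘(ℝ, E) ι q) : F →L[ℝ] ℂ)

variable [IsManifold 𝓘(ℝ, E) ∞ X] {V : Type*} [NormedAddCommGroup V] [NormedSpace ℝ V]

theorem contDiffAt_θ {a x : X} (hx : x ∈ (P.chart a).source) :
    ContDiffAt ℝ ∞ (P.θ a) (P.chart a x) :=
  (P.contDiffOn_θ a).contDiffAt ((P.chart a).open_target.mem_nhds ((P.chart a).map_source hx))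

theorem form_comp_mfderiv {f : V → X} {p : V} (hf : MDifferentiableAt 𝓘(ℝ, V) 𝓘(ℝ, E) f p) {a : X}
    (hp : f p ∈ (P.chart a).source) :
    (P.form a (f p)).comp (mfderiv 𝓘(ℝ, V) 𝓘(ℝ, E) f p : V →L[ℝ] E) =
      pullbackForm (P.θ a) (P.chart a ∘ f) p := by
  ext v
  change P.θ a _ (mfderiv 𝓘(ℝ, E) 𝓘(ℝ, E) (P.chart a) (f p) (mfderiv 𝓘(ℝ, V) 𝓘(ℝ, E) f p v)) = _
  rw [← mfderiv_chart_comp (P.chart_mem a) hf hp, mfderiv_eq_fderiv]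
  rfl

theorem contDiffAt_pullback {f : V → X} {p : V} (hf : ContMDiffAt 𝓘(ℝ, V) 𝓘(ℝ, E) ∞ f p) {a : X}
    (hp : f p ∈ (P.chart a).source) :
    ContDiffAt ℝ ∞ (pullbackForm (P.θ a) (P.chart a ∘ f)) p :=
  contDiffAt_pullbackForm (P.contDiffAt_θ hp) (contDiffAt_chart_comp (P.chart_mem a) hf hp)

/-- The curvature of the pulled back connection. -/
theorem fderiv_pullback_sub {f : V → X} {p : V} (hf : ContMDiffAt 𝓘(ℝ, V) 𝓘(ℝ, E) ∞ f p) {a : X}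
    (hp : f p ∈ (P.chart a).source) (v w : V) :
    fderiv ℝ (pullbackForm (P.θ a) (P.chart a ∘ f)) p v w -
      fderiv ℝ (pullbackForm (P.θ a) (P.chart a ∘ f)) p w v =
      -2 * Complex.I * Real.pi * (Ω (f p) ![mfderiv 𝓘(ℝ, V) 𝓘(ℝ, E) f p v,
        mfderiv 𝓘(ℝ, V) 𝓘(ℝ, E) f p w] : ℝ) := by
  rw [fderiv_pullbackForm_sub (g := P.chart a ∘ f) ((P.contDiffAt_θ hp).differentiableAt (by simp))
    (contDiffAt_chart_comp (P.chart_mem a) hf hp),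
    P.curvature a ((P.chart a ∘ f) p) ((P.chart a).map_source hp)]
  have h := Ω.pullback_eq (P.chart_mem a) (hf.mdifferentiableAt (by simp)) hp v w
  rw [mfderiv_eq_fderiv] at h
  exact congrArg (fun r : ℝ ↦ (-2 * Complex.I * Real.pi * r : ℂ)) h.symm

end PrequantumAtlas

end Atlas

/-! ### A flat trivialization along a submanifold forces isotropy. -/

section Isotropic

variable {E : Type*} [NormedAddCommGroup E] [NormedSpace ℝ E]
  {X : Type*} [TopologicalSpace X] [ChartedSpace E X] [IsManifold 𝓘(ℝ, E) ∞ X]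
  {F : Type*} [NormedAddCommGroup F] [NormedSpace ℝ F]
  {Q : Type*} [TopologicalSpace Q] [ChartedSpace F Q] [IsManifold 𝓘(ℝ, F) ∞ Q]

/-- A function whose logarithmic derivative is differentiable has a closed logarithmic
derivative. -/
theorem fderiv_symm_of_hasFDerivAt_smul {u : F → ℂ} {κ : F → F →L[ℝ] ℂ} {p : F}
    (hu : ∀ᶠ y in nhds p, HasFDerivAt u (u y • κ y) y) (hκ : DifferentiableAt ℝ κ p)
    (h0 : u p ≠ 0) (v w : F) : fderiv ℝ κ p v w = fderiv ℝ κ p w v := by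
  have h1 := (hu.self_of_nhds.smul hκ.hasFDerivAt)
  -- The second derivative of `u` is `u (κ ⊗ κ + Dκ)`. It is symmetric, and so is `κ ⊗ κ`, hence so
  -- is `Dκ` where `u` does not vanish.
  have h2 := second_derivative_symmetric_of_eventually hu h1 v w
  simp only [add_apply, smul_apply, ContinuousLinearMap.smulRight_apply, smul_eq_mul] at h2
  have h3 : u p * fderiv ℝ κ p v w = u p * fderiv ℝ κ p w v := by linear_combination h2
  exact mul_left_cancel₀ h0 h3

theorem PrequantumAtlas.IsFlatAlong.hasFDerivAt_comp {Ω : TwoForm E X} {P : PrequantumAtlas Ω}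
    {ι : Q → X} (hP : P.IsFlatAlong (F := F) ι) (hι : ContMDiff 𝓘(ℝ, F) 𝓘(ℝ, E) ∞ ι)
    {V : Type*} [NormedAddCommGroup V] [NormedSpace ℝ V] {g : V → Q} {y : V}
    (hg : MDifferentiableAt 𝓘(ℝ, V) 𝓘(ℝ, F) g y) {a : X} (hy : ι (g y) ∈ (P.chart a).source) :
    HasFDerivAt (fun y ↦ P.c a (ι (g y)))
      (P.c a (ι (g y)) • pullbackForm (P.θ a) (P.chart a ∘ ι ∘ g) y) y := by
  have h1 := (hP a (g y) hy).comp y hg.hasMFDerivAt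
  have hιd : MDifferentiableAt 𝓘(ℝ, F) 𝓘(ℝ, E) ι (g y) := hι.mdifferentiable (by simp) _
  have h2 := P.form_comp_mfderiv (f := ι ∘ g) (hιd.comp y hg) hy
  rw [← h2]
  refine HasFDerivAt.congr_fderiv h1.hasFDerivAt ?_
  ext v
  have h3 := congrArg (fun l : V →L[ℝ] E ↦ l v) (mfderiv_comp y hιd hg)
  change _ = P.c a (ι (g y)) • P.form a (ι (g y)) (mfderiv 𝓘(ℝ, V) 𝓘(ℝ, E) (ι ∘ g) y v)
  rw [show mfderiv 𝓘(ℝ, V) 𝓘(ℝ, E) (ι ∘ g) y v = _ from h3]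
  rfl

/-- Along `Q` the pulled back connection form is the logarithmic derivative of `c a ∘ ι`, hence
closed; but its differential is `-2πi ι^* Ω`. -/
theorem PrequantumAtlas.isotropic {Ω : TwoForm E X} (P : PrequantumAtlas Ω) {ι : Q → X}
    (hι : ContMDiff 𝓘(ℝ, F) 𝓘(ℝ, E) ∞ ι) (hP : P.IsFlatAlong (F := F) ι) (q : Q)
    (v w : TangentSpace 𝓘(ℝ, F) q) :
    Ω (ι q) ![mfderiv 𝓘(ℝ, F) 𝓘(ℝ, E) ι q v, mfderiv 𝓘(ℝ, F) 𝓘(ℝ, E) ι q w] = 0 := by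
  set a := ι q
  have he := IsManifold.chart_mem_maximalAtlas (I := 𝓘(ℝ, F)) (n := ∞) q
  set e := chartAt F q
  have hq : q ∈ e.source := mem_chart_source F q
  have hqt : e q ∈ e.target := e.map_source hq
  have hS : (P.chart a).source ∈ nhds (ι (e.symm (e q))) := by
    rw [e.left_inv hq]
    exact (P.chart a).open_source.mem_nhds (P.mem_source a)
  have hf : ContMDiffAt 𝓘(ℝ, F) 𝓘(ℝ, E) ∞ (ι ∘ e.symm) (e q) :=
    hι.contMDiffAt.comp _ (contMDiffAt_chart_symm he hqt)
  have hev : ∀ᶠ y in nhds (e q), HasFDerivAt (fun y ↦ P.c a (ι (e.symm y)))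
      (P.c a (ι (e.symm y)) • pullbackForm (P.θ a) (P.chart a ∘ ι ∘ e.symm) y) y := by
    filter_upwards [e.open_target.mem_nhds hqt, hf.continuousAt.preimage_mem_nhds hS] with y hy hy'
    exact hP.hasFDerivAt_comp hι (mdifferentiableAt_chart_symm he hy) hy'
  have hS' := mem_of_mem_nhds hS
  have hsymm := fderiv_symm_of_hasFDerivAt_smul hev
    ((P.contDiffAt_pullback hf hS').differentiableAt (by simp)) (P.c_ne_zero _ _)
  have key := P.fderiv_pullback_sub hf hS' (mfderiv 𝓘(ℝ, F) 𝓘(ℝ, F) e q v)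
    (mfderiv 𝓘(ℝ, F) 𝓘(ℝ, F) e q w)
  have hm (x : TangentSpace 𝓘(ℝ, F) q) : mfderiv 𝓘(ℝ, F) 𝓘(ℝ, E) (ι ∘ e.symm) (e q)
      (mfderiv 𝓘(ℝ, F) 𝓘(ℝ, F) e q x) = mfderiv 𝓘(ℝ, F) 𝓘(ℝ, E) ι q x := by
    have h3 := congrArg (fun l : F →L[ℝ] E ↦ l (mfderiv 𝓘(ℝ, F) 𝓘(ℝ, F) e q x))
      (mfderiv_comp (e q) (hι.mdifferentiable (by simp) (e.symm (e q)))
        (mdifferentiableAt_chart_symm he hqt))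
    refine h3.trans ?_
    change mfderiv 𝓘(ℝ, F) 𝓘(ℝ, E) ι (e.symm (e q)) (mfderiv 𝓘(ℝ, F) 𝓘(ℝ, F) e.symm (e q)
      (mfderiv 𝓘(ℝ, F) 𝓘(ℝ, F) e q x)) = _
    rw [mfderiv_chart_symm_chart he hq]
    have : ∀ q' : Q, q' = q → (mfderiv 𝓘(ℝ, F) 𝓘(ℝ, E) ι q' : F →L[ℝ] E) x =
      (mfderiv 𝓘(ℝ, F) 𝓘(ℝ, E) ι q : F →L[ℝ] E) x := by rintro _ rfl; rfl
    exact this _ (e.left_inv hq)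
  replace key := (sub_eq_zero.2 (hsymm _ _)).symm.trans key
  rw [hm, hm] at key
  have hz : (Ω (ι (e.symm (e q)))
      ![mfderiv 𝓘(ℝ, F) 𝓘(ℝ, E) ι q v, mfderiv 𝓘(ℝ, F) 𝓘(ℝ, E) ι q w] : ℝ) = 0 := by
    have h4 : (-2 * Complex.I * Real.pi : ℂ) ≠ 0 := by simp [Real.pi_ne_zero]
    exact_mod_cast (mul_eq_zero.1 key.symm).resolve_left h4
  have : ∀ (x : X) (v' w' : E), x = ι q → Ω x ![v', w'] = Ω (ι q) ![v', w'] := by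
    rintro _ v' w' rfl; rfl
  exact (this _ _ _ (congrArg ι (e.left_inv hq))).symm.trans hz

end Isotropic

end BohrSommerfeld

namespace BohrSommerfeld

/-! ### Absence of monodromy on compact convex sets. -/

section Monodromy

open Set

variable {V : Type*} [NormedAddCommGroup V] [NormedSpace ℝ V]

/-- Local nonvanishing functions on a compact convex set that agree up to constants can be glued
to a global one. -/
theorem exists_global_of_local {T : Set V} (hT : IsCompact T) (hc : Convex ℝ T)
    {B : V → Set V} (hB : ∀ p ∈ T, IsOpen (B p)) (hpB : ∀ p ∈ T, p ∈ B p) {l : V → V → ℂ}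
    (hl : ∀ p ∈ T, ∀ x ∈ B p, l p x ≠ 0)
    (hcompat : ∀ p ∈ T, ∀ q ∈ T, ∀ x ∈ B p ∩ B q, ∀ y ∈ B p ∩ B q, l p x / l q x = l p y / l q y) :
    ∃ ψ : V → ℂ, (∀ x ∈ T, ψ x ≠ 0) ∧
      ∀ p ∈ T, ∀ᶠ x in nhdsWithin p T, ψ x = ψ p / l p p * l p x := by
  rcases T.eq_empty_or_nonempty with rfl | ⟨x₀, hx₀⟩
  · exact ⟨1, by simp, by simp⟩
  obtain ⟨δ, hδ, hleb⟩ := lebesgue_number_lemma_of_metric (ι := T) (c := fun p ↦ B p) hT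
    (fun p ↦ hB p p.2) (fun p hp ↦ mem_iUnion.2 ⟨⟨p, hp⟩, hpB p hp⟩)
  have : Nonempty T := ⟨⟨x₀, hx₀⟩⟩
  choose! i hi using hleb
  -- `K x y` is the transport from `x` to a point `y` at distance less than the Lebesgue number,
  -- inside a piece containing both. As the local functions agree up to constants on overlaps, `K`
  -- is multiplicative on triples of close points.
  let K : V → V → ℂ := fun x y ↦ l (i x) y / l (i x) x
  have hmem {x y : V} (hx : x ∈ T) (h : dist x y < δ) : y ∈ B (i x) :=
    hi x hx (by rwa [Metric.mem_ball, dist_comm])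
  have hne {x y : V} (hx : x ∈ T) (h : dist x y < δ) : l (i x) y ≠ 0 :=
    hl _ (i x).2 _ (hmem hx h)
  have hself {x : V} : dist x x < δ := by simpa using hδ
  have hKK {x y z : V} (hx : x ∈ T) (hy : y ∈ T) (hxy : dist x y < δ) (hyz : dist y z < δ)
      (hxz : dist x z < δ) : K x y * K y z = K x z := by
    have h := hcompat _ (i x).2 _ (i y).2 y ⟨hmem hx hxy, hmem hy hself⟩ z
      ⟨hmem hx hxz, hmem hy hyz⟩
    have h1 := hne hx hxy
    have h2 := hne hx hxz
    have h3 := hne hx hself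
    have h4 := hne hy hself
    have h5 := hne hy hyz
    simp only [K]
    rw [div_eq_div_iff h4 h5] at h
    field_simp
    linear_combination h
  have hK1 {x : V} (hx : x ∈ T) : K x x = 1 := div_self (hne hx hself)
  have hKne {x y : V} (hx : x ∈ T) (h : dist x y < δ) : K x y ≠ 0 :=
    div_ne_zero (hne hx h) (hne hx hself)
  obtain ⟨C, hC⟩ := hT.isBounded.subset_closedBall x₀
  -- The set lies in the ball of radius `C` around `x₀`, so `N` equal steps cut every segment
  -- issuing from `x₀` into pieces shorter than `δ / 2`.
  obtain ⟨N, hN⟩ := exists_nat_gt (2 * C / δ)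
  have hC0 : 0 ≤ C := by simpa using hC hx₀
  have hN0 : (0 : ℝ) < N := lt_of_le_of_lt (by positivity) hN
  let q : ℕ → V → V := fun k y ↦ x₀ + ((k : ℝ) / N) • (y - x₀)
  have hqT {k : ℕ} (hk : k ≤ N) {y : V} (hy : y ∈ T) : q k y ∈ T :=
    hc.add_smul_sub_mem hx₀ hy ⟨by positivity, div_le_one_of_le₀ (by exact_mod_cast hk) hN0.le⟩
  have hq1 {k : ℕ} {y : V} (hy : y ∈ T) : dist (q k y) (q (k + 1) y) < δ / 2 := by
    have h1 : q k y - q (k + 1) y = (-(1 / N : ℝ)) • (y - x₀) := by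
      simp only [q]
      push_cast
      module
    rw [dist_eq_norm, h1, norm_smul, norm_neg, Real.norm_of_nonneg (by positivity)]
    have h2 : ‖y - x₀‖ ≤ C := by simpa [dist_eq_norm] using hC hy
    calc 1 / (N : ℝ) * ‖y - x₀‖ ≤ 1 / N * C := by gcongr
      _ < δ / 2 := by
        rw [div_lt_iff₀ hδ] at hN
        rw [one_div, inv_mul_lt_iff₀ hN0]
        linarith
  have hq2 {k : ℕ} (hk : k ≤ N) {x y : V} : dist (q k x) (q k y) ≤ dist x y := by
    have h1 : q k x - q k y = ((k : ℝ) / N) • (x - y) := by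
      simp only [q]
      module
    rw [dist_eq_norm, h1, norm_smul, Real.norm_of_nonneg (by positivity), dist_eq_norm]
    exact mul_le_of_le_one_left (norm_nonneg _)
      (div_le_one_of_le₀ (by exact_mod_cast hk) hN0.le)
  have hqN (y : V) : q N y = y := by simp [q, div_self hN0.ne']
  have hq0 (y : V) : q 0 y = x₀ := by simp [q]
  let ψ : V → ℂ := fun y ↦ ∏ k ∈ Finset.range N, K (q k y) (q (k + 1) y)
  -- The subdivided segments from `x₀` to `x` and to `y` form a ladder. The two products are
  -- compared rung by rung, each quadrilateral being cut by the diagonal from `q n x` to `q (n + 1)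
  -- y`.
  have hind {x y : V} (hx : x ∈ T) (hy : y ∈ T) (hxy : dist x y < δ / 2) (n : ℕ) (hn : n ≤ N) :
      (∏ k ∈ Finset.range n, K (q k x) (q (k + 1) x)) * K (q n x) (q n y) =
        ∏ k ∈ Finset.range n, K (q k y) (q (k + 1) y) := by
    induction n with
    | zero => simp [hq0, hK1 hx₀]
    | succ n ih =>
      have hn' : n ≤ N := by omega
      have h1 := (hq2 hn').trans_lt hxy
      have h2 := (hq2 hn).trans_lt hxy
      have h3 := hq1 (k := n) hx
      have h4 := hq1 (k := n) hy
      have h5 : dist (q n x) (q (n + 1) y) < δ := by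
        linarith [dist_triangle (q n x) (q n y) (q (n + 1) y)]
      rw [Finset.prod_range_succ, Finset.prod_range_succ, ← ih hn', mul_assoc, mul_assoc,
        hKK (hqT hn' hx) (hqT hn hx) (by linarith) (by linarith) h5,
        hKK (hqT hn' hx) (hqT hn' hy) (by linarith) (by linarith) h5]
  have hψ {x y : V} (hx : x ∈ T) (hy : y ∈ T) (hxy : dist x y < δ / 2) : ψ y = ψ x * K x y := by
    have := hind hx hy hxy N le_rfl
    rw [hqN, hqN] at this
    exact this.symm
  refine ⟨ψ, fun x hx ↦ Finset.prod_ne_zero_iff.2 fun k hk ↦ hKne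
    (hqT (Finset.mem_range.1 hk).le hx) (by linarith [hq1 (k := k) hx]), fun p hp ↦ ?_⟩
  filter_upwards [self_mem_nhdsWithin,
    mem_nhdsWithin_of_mem_nhds (Metric.ball_mem_nhds p (half_pos hδ)),
    mem_nhdsWithin_of_mem_nhds ((hB p hp).mem_nhds (hpB p hp))] with x hx hxp hxB
  rw [Metric.mem_ball, dist_comm] at hxp
  have hxp' : dist p x < δ := by linarith
  rw [hψ hp hx hxp]
  have h := hcompat p hp _ (i p).2 p ⟨hpB p hp, hmem hp hself⟩ x ⟨hxB, hmem hp hxp'⟩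
  have h1 := hne hp hself
  have h2 := hne hp hxp'
  have h3 := hl p hp p (hpB p hp)
  simp only [K]
  rw [div_eq_div_iff h1 h2] at h
  rw [div_mul_eq_mul_div, mul_div_assoc', div_eq_div_iff h1 h3]
  linear_combination (ψ p) * h

end Monodromy

/-! ### Parallel sections along paths. -/

section Paths

open Set

variable {E : Type*} [NormedAddCommGroup E] [NormedSpace ℝ E]
  {X : Type*} [TopologicalSpace X] [ChartedSpace E X]
  {Ω : TwoForm E X}

/-- The function `y` gives the coordinates, in the global frame, of a parallel section along the
path `δ`, parametrized by `[0, 1]`. -/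
structure PrequantumAtlas.IsParallel (P : PrequantumAtlas Ω) (δ : ℝ → X) (y : ℝ → ℂ) : Prop where
  ne_zero : ∀ t ∈ Icc (0 : ℝ) 1, y t ≠ 0
  continuousWithinAt : ∀ a, ∀ t ∈ Icc (0 : ℝ) 1, δ t ∈ (P.chart a).source →
    ContinuousWithinAt (fun t ↦ y t / P.c a (δ t)) (Icc 0 1) t
  hasDerivAt : ∀ a, ∀ t ∈ Ioo (0 : ℝ) 1, δ t ∈ (P.chart a).source →
    HasDerivAt (fun t ↦ y t / P.c a (δ t))
      (-(P.form a (δ t) (mfderiv 𝓘(ℝ, ℝ) 𝓘(ℝ, E) δ t (1 : ℝ))) * (y t / P.c a (δ t))) t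

theorem eq_of_hasDerivAt_zero {r : ℝ → ℂ} (hr : ContinuousOn r (Icc 0 1))
    (h : ∀ t ∈ Ioo (0 : ℝ) 1, HasDerivAt r 0 t) : r 1 = r 0 := by
  have hconst : EqOn r (fun _ ↦ r (1 / 2)) (Ioo 0 1) := fun t ht ↦
    isOpen_Ioo.is_const_of_deriv_eq_zero isPreconnected_Ioo
      (fun s hs ↦ (h s hs).differentiableAt.differentiableWithinAt)
      (fun s hs ↦ (h s hs).deriv) ht (by norm_num)
  have := hconst.of_subset_closure hr continuousOn_const Ioo_subset_Icc_self
    (by rw [closure_Ioo (by norm_num)])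
  exact (this (by norm_num : (1 : ℝ) ∈ Icc 0 1)).trans (this (by norm_num : (0 : ℝ) ∈ Icc 0 1)).symm

/-- The parallel transport along a path depends only on the path. -/
theorem PrequantumAtlas.IsParallel.unique {P : PrequantumAtlas Ω} {δ δ' : ℝ → X} {y y' : ℝ → ℂ}
    (h : P.IsParallel δ y) (h' : P.IsParallel δ' y') (hδ : EqOn δ δ' (Icc 0 1)) :
    y 1 / y 0 = y' 1 / y' 0 := by
  have hr (a : X) (t : ℝ) (ht : t ∈ Icc (0 : ℝ) 1) :
      y t / y' t = (y t / P.c a (δ t)) / (y' t / P.c a (δ' t)) := by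
    rw [hδ ht]
    have := P.c_ne_zero a (δ' t)
    have := h'.ne_zero t ht
    field_simp
  have hne' (a : X) (t : ℝ) (ht : t ∈ Icc (0 : ℝ) 1) : y' t / P.c a (δ' t) ≠ 0 :=
    div_ne_zero (h'.ne_zero t ht) (P.c_ne_zero _ _)
  -- The two sections satisfy the same linear equation, so their quotient has zero derivative in the
  -- interior. The factor `c a` drops out of the quotient, and continuity carries constancy to the
  -- endpoints.
  have key : y 1 / y' 1 = y 0 / y' 0 := by
    refine eq_of_hasDerivAt_zero (r := fun t ↦ y t / y' t) (fun t ht ↦ ?_) fun t ht ↦ ?_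
    · have hm := P.mem_source (δ t)
      refine ((h.continuousWithinAt (δ t) t ht hm).div (h'.continuousWithinAt (δ t) t ht
        (by rwa [← hδ ht])) (hne' _ t ht)).congr (fun s hs ↦ hr _ s hs) (hr _ t ht)
    · have ht' := Ioo_subset_Icc_self ht
      have hm := P.mem_source (δ t)
      have hev : δ =ᶠ[nhds t] δ' := by
        filter_upwards [Icc_mem_nhds ht.1 ht.2] with s hs using hδ hs
      have h1 := h.hasDerivAt (δ t) t ht hm
      have h2 := h'.hasDerivAt (δ t) t ht (by rwa [← hδ ht'])
      have h3 := (h1.div h2 (hne' _ t ht'))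
      have h4 : HasDerivAt (fun t ↦ y t / y' t) _ t := h3.congr_of_eventuallyEq (by
        filter_upwards [Icc_mem_nhds ht.1 ht.2] with s hs using hr (δ t) s hs)
      refine h4.congr_deriv ?_
      have h5 : P.form (δ t) (δ' t) (mfderiv 𝓘(ℝ, ℝ) 𝓘(ℝ, E) δ' t (1 : ℝ)) =
          P.form (δ t) (δ t) (mfderiv 𝓘(ℝ, ℝ) 𝓘(ℝ, E) δ t (1 : ℝ)) := by
        have : ∀ x, x = δ t → ∀ l : ℝ →L[ℝ] E, l = mfderiv 𝓘(ℝ, ℝ) 𝓘(ℝ, E) δ t →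
          P.form (δ t) x (l 1) = P.form (δ t) (δ t) (mfderiv 𝓘(ℝ, ℝ) 𝓘(ℝ, E) δ t (1 : ℝ)) := by
            rintro _ rfl _ rfl; rfl
        exact this _ (hδ ht').symm _ hev.symm.mfderiv_eq
      rw [h5]
      have := hne' (δ t) t ht'
      field_simp
      ring
  rw [div_eq_div_iff (h.ne_zero 0 (by simp)) (h'.ne_zero 0 (by simp))]
  rw [div_eq_div_iff (h'.ne_zero 1 (by simp)) (h'.ne_zero 0 (by simp))] at key
  linear_combination key

end Paths

end BohrSommerfeld

namespace BohrSommerfeld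

/-! ### Flat sections of the pulled back bundle twisted by a primitive of the curvature. -/

section TwistedParallel

open Set

variable {E : Type*} [NormedAddCommGroup E] [NormedSpace ℝ E]
  {X : Type*} [TopologicalSpace X] [ChartedSpace E X] [IsManifold 𝓘(ℝ, E) ∞ X]
  {V : Type*} [NormedAddCommGroup V] [NormedSpace ℝ V]
  {Ω : TwoForm E X} (P : PrequantumAtlas Ω) {f : V → X} {β : V → V →L[ℝ] ℝ}

theorem hasFDerivAt_div {u v : V → ℂ} {u' v' : V →L[ℝ] ℂ} {p : V} (hu : HasFDerivAt u u' p)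
    (hv : HasFDerivAt v v' p) (h0 : v p ≠ 0) :
    HasFDerivAt (fun x ↦ u x / v x) ((v p)⁻¹ • u' - (u p / v p ^ 2) • v') p := by
  have h1 : HasFDerivAt (fun x ↦ (v x)⁻¹) _ p :=
    HasFDerivAt.comp (g := fun z : ℂ ↦ z⁻¹) p (hasFDerivAt_inv' (𝕜 := ℝ) h0) hv
  refine ((hu.mul h1).congr_of_eventuallyEq (.of_forall fun x ↦ div_eq_mul_inv _ _)).congr_fderiv ?_
  ext w
  simp only [add_apply, sub_apply, smul_apply, neg_apply, smul_eq_mul,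
    ContinuousLinearMap.comp_apply, ContinuousLinearMap.mulLeftRight_apply]
  field_simp
  ring

namespace PrequantumAtlas

/-- The connection form of the pulled back connection, made flat by a primitive of the curvature. -/
def twist (f : V → X) (β : V → V →L[ℝ] ℝ) (a : X) (p : V) : V →L[ℝ] ℂ :=
  pullbackForm (P.θ a) (P.chart a ∘ f) p + (2 * Real.pi * Complex.I) • (Complex.ofRealCLM ∘L β p)

theorem hasFDerivAt_c_div_c {a b : X} {p : V} (hf : MDifferentiableAt 𝓘(ℝ, V) 𝓘(ℝ, E) f p)
    (ha : f p ∈ (P.chart a).source) (hb : f p ∈ (P.chart b).source) :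
    HasFDerivAt (fun y ↦ P.c a (f y) / P.c b (f y))
      ((P.c a (f p) / P.c b (f p)) • (pullbackForm (P.θ a) (P.chart a ∘ f) p -
        pullbackForm (P.θ b) (P.chart b ∘ f) p)) p := by
  have h1 := (P.compat a b _ ha hb).comp p hf.hasMFDerivAt
  rw [← P.form_comp_mfderiv hf ha, ← P.form_comp_mfderiv hf hb]
  exact h1.hasFDerivAt

theorem differentiableAt_twist {a : X} {p : V} (hf : ContMDiffAt 𝓘(ℝ, V) 𝓘(ℝ, E) ∞ f p)
    (hβ : DifferentiableAt ℝ β p) (hp : f p ∈ (P.chart a).source) :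
    DifferentiableAt ℝ (P.twist f β a) p := by
  have h := (P.contDiffAt_pullback hf hp).differentiableAt (by simp)
  have h2 : DifferentiableAt ℝ (fun p ↦ Complex.ofRealCLM ∘L β p) p :=
    (ContinuousLinearMap.compL ℝ V ℝ ℂ Complex.ofRealCLM).differentiableAt.comp p hβ
  exact h.add (h2.const_smul (2 * Real.pi * Complex.I : ℂ))

/-- The differential of the pulled back form is `-2πi f^* Ω`, and the twist contributes `2πi dβ =
2πi f^* Ω`: the twisted form is closed. -/
theorem fderiv_twist_symm {a : X} {p : V} (hf : ContMDiffAt 𝓘(ℝ, V) 𝓘(ℝ, E) ∞ f p)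
    (hβ : DifferentiableAt ℝ β p) (hp : f p ∈ (P.chart a).source)
    (hdβ : ∀ v w : V, fderiv ℝ β p v w - fderiv ℝ β p w v =
      Ω (f p) ![mfderiv 𝓘(ℝ, V) 𝓘(ℝ, E) f p v, mfderiv 𝓘(ℝ, V) 𝓘(ℝ, E) f p w]) (v w : V) :
    fderiv ℝ (P.twist f β a) p v w = fderiv ℝ (P.twist f β a) p w v := by
  have h := ((P.contDiffAt_pullback hf hp).differentiableAt (by simp)).hasFDerivAt
  have h' := h.add ((((ContinuousLinearMap.compL ℝ V ℝ ℂ Complex.ofRealCLM).hasFDerivAt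
    (x := β p)).comp p hβ.hasFDerivAt).const_smul (2 * Real.pi * Complex.I : ℂ))
  have h2 : fderiv ℝ (P.twist f β a) p = _ := h'.fderiv
  have h3 := P.fderiv_pullback_sub hf hp v w
  rw [h2]
  rw [← hdβ v w] at h3
  simp only [add_apply, smul_apply, ContinuousLinearMap.comp_apply,
    ContinuousLinearMap.compL_apply, Complex.ofRealCLM_apply, smul_eq_mul]
  push_cast at h3
  linear_combination h3

/-- On a compact convex set there is a global parallel section of the pulled back bundle, made
flat by a primitive of the curvature. -/
theorem exists_parallel_of_convex {T : Set V} (hT : IsCompact T) (hc : Convex ℝ T)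
    (hf : ContMDiff 𝓘(ℝ, V) 𝓘(ℝ, E) ∞ f) (hβ : Differentiable ℝ β)
    (hdβ : ∀ p v w : V, fderiv ℝ β p v w - fderiv ℝ β p w v =
      Ω (f p) ![mfderiv 𝓘(ℝ, V) 𝓘(ℝ, E) f p v, mfderiv 𝓘(ℝ, V) 𝓘(ℝ, E) f p w]) :
    ∃ ψ : V → ℂ, (∀ x ∈ T, ψ x ≠ 0) ∧ ∀ a, ∀ p ∈ T, f p ∈ (P.chart a).source →
      HasFDerivWithinAt (fun x ↦ ψ x / P.c a (f x))
        (-(ψ p / P.c a (f p)) • P.twist f β a p) T p := by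
  have hex (p : V) : ∃ r > 0, Metric.ball p r ⊆ f ⁻¹' (P.chart (f p)).source :=
    Metric.mem_nhds_iff.1 (hf.continuous.continuousAt.preimage_mem_nhds
      ((P.chart (f p)).open_source.mem_nhds (P.mem_source _)))
  choose r hr hrs using hex
  have hprim (p : V) : ∃ G : V → ℂ, ∀ x ∈ Metric.ball p (r p),
      HasFDerivAt G (P.twist f β (f p) x) x :=
    (convex_ball p (r p)).exists_forall_hasFDerivAt_of_fderiv_symmetric Metric.isOpen_ball
      (fun x hx ↦ (P.differentiableAt_twist (hf x) (hβ x) (hrs p hx)).differentiableWithinAt)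
      (fun x hx ↦ P.fderiv_twist_symm (hf x) (hβ x) (hrs p hx) (hdβ x))
  choose G hG using hprim
  -- A closed form on a ball has a primitive `G`; dividing the frame by `exp G` makes it flat for
  -- the twisted connection.
  let l : V → V → ℂ := fun p x ↦ P.c (f p) (f x) * Complex.exp (-G p x)
  have hl (p : V) (a : X) {x : V} (hx : x ∈ Metric.ball p (r p)) (ha : f x ∈ (P.chart a).source) :
      HasFDerivAt (fun x ↦ l p x / P.c a (f x)) (-(l p x / P.c a (f x)) • P.twist f β a x) x := by
    have h1 := P.hasFDerivAt_c_div_c ((hf x).mdifferentiableAt (by simp)) (hrs p hx) ha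
    have h2 := h1.mul (hG p x hx).neg.cexp
    refine (h2.congr_of_eventuallyEq (.of_forall fun x ↦ ?_)).congr_fderiv ?_
    · simp only [l, Pi.mul_apply, Pi.neg_apply]; ring
    · ext v
      simp only [l, twist, add_apply, sub_apply, smul_apply, neg_apply, smul_eq_mul, Pi.neg_apply]
      ring
  have hlne (p x : V) : l p x ≠ 0 := mul_ne_zero (P.c_ne_zero _ _) (Complex.exp_ne_zero _)
  -- Two local flat sections have a quotient with zero derivative; it is constant because the
  -- intersection of two balls is convex, hence connected.
  obtain ⟨ψ, hψ, hψl⟩ := exists_global_of_local hT hc (B := fun p ↦ Metric.ball p (r p))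
    (fun p _ ↦ Metric.isOpen_ball) (fun p _ ↦ Metric.mem_ball_self (hr p)) (l := l)
    (fun p _ x _ ↦ hlne p x) (fun p _ q _ x hx y hy ↦ by
      have hd (z : V) (hz : z ∈ Metric.ball p (r p) ∩ Metric.ball q (r q)) :
          HasFDerivAt (𝕜 := ℝ) (fun x ↦ l p x / l q x) 0 z := by
        have h1 := hl p (f z) hz.1 (P.mem_source _)
        have h2 := hl q (f z) hz.2 (P.mem_source _)
        have hz0 : l q z / P.c (f z) (f z) ≠ 0 := div_ne_zero (hlne _ _) (P.c_ne_zero _ _)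
        have h3 := hasFDerivAt_div h1 h2 hz0
        refine (h3.congr_of_eventuallyEq (.of_forall fun x ↦ ?_)).congr_fderiv ?_
        · have := P.c_ne_zero (f z) (f x)
          have := hlne q x
          field_simp
        · ext v
          have := P.c_ne_zero (f z) (f z)
          have := hlne q z
          simp only [sub_apply, smul_apply, smul_eq_mul, zero_apply]
          field_simp
          simp
      exact (Metric.isOpen_ball.inter Metric.isOpen_ball).is_const_of_fderiv_eq_zero
        (𝕜 := ℝ) ((convex_ball _ _).inter (convex_ball _ _)).isPreconnected
        (fun z hz ↦ (hd z hz).differentiableAt.differentiableWithinAt)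
        (fun z hz ↦ (hd z hz).fderiv) hx hy)
  refine ⟨ψ, hψ, fun a p hp ha ↦ ?_⟩
  have h1 := ((hl p a (Metric.mem_ball_self (hr p)) ha).const_mul
    (ψ p / l p p)).hasFDerivWithinAt (s := T)
  refine (HasFDerivWithinAt.congr_of_eventuallyEq h1 ?_ ?_).congr_fderiv ?_
  · filter_upwards [hψl p hp] with x hx
    rw [hx]
    ring
  · have := hlne p p
    field_simp
  · have := hlne p p
    rw [smul_smul]
    congr 1
    field_simp

/-- A flat section of the twisted bundle gives a parallel section along each segment. -/
theorem isParallel_segment {T : Set V} (hc : Convex ℝ T)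
    (hf : ContMDiff 𝓘(ℝ, V) 𝓘(ℝ, E) ∞ f) (hβ : Continuous β) {ψ : V → ℂ} (hψ : ∀ x ∈ T, ψ x ≠ 0)
    (hψ' : ∀ a, ∀ p ∈ T, f p ∈ (P.chart a).source →
      HasFDerivWithinAt (fun x ↦ ψ x / P.c a (f x))
        (-(ψ p / P.c a (f p)) • P.twist f β a p) T p) {p q : V} (hp : p ∈ T) (hq : q ∈ T) :
    P.IsParallel (fun t ↦ f (p + t • (q - p))) (fun t ↦ ψ (p + t • (q - p)) *
      Complex.exp (2 * Real.pi * Complex.I * ∫ r in (0 : ℝ)..t, β (p + r • (q - p)) (q - p))) := by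
  set τ : ℝ → V := fun t ↦ p + t • (q - p)
  have hτ (t : ℝ) : HasDerivAt τ (q - p) t := by
    have h := ((hasDerivAt_id t).smul_const (q - p)).const_add p
    rwa [one_smul] at h
  have hτm : MapsTo τ (Icc 0 1) T := fun t ht ↦ hc.add_smul_sub_mem hp hq ht
  have hτc : Continuous τ := by fun_prop
  have hI (t : ℝ) : HasDerivAt (fun t ↦ ∫ r in (0 : ℝ)..t, β (τ r) (q - p)) (β (τ t) (q - p)) t :=
    (((hβ.comp hτc).clm_apply continuous_const).integral_hasStrictDerivAt 0 t).hasDerivAt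
  -- Differentiating the exponential gives `2πi β` along the segment, which cancels the twist and
  -- leaves the connection form of `P`.
  have key (a : X) (t : ℝ) (ht : t ∈ Icc (0 : ℝ) 1) (ha : f (τ t) ∈ (P.chart a).source) :
      HasDerivWithinAt (fun t ↦ (ψ (τ t) * Complex.exp (2 * Real.pi * Complex.I *
        ((∫ r in (0 : ℝ)..t, β (τ r) (q - p) : ℝ) : ℂ))) / P.c a (f (τ t)))
        (-(P.form a (f (τ t)) (mfderiv 𝓘(ℝ, ℝ) 𝓘(ℝ, E) (fun t ↦ f (τ t)) t (1 : ℝ))) *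
          ((ψ (τ t) * Complex.exp (2 * Real.pi * Complex.I *
            ((∫ r in (0 : ℝ)..t, β (τ r) (q - p) : ℝ) : ℂ))) / P.c a (f (τ t)))) (Icc 0 1) t := by
    have h1 := (hψ' a (τ t) (hτm ht) ha).comp_hasDerivWithinAt t (hτ t).hasDerivWithinAt hτm
    have h2 := (((hI t).ofReal_comp.const_mul (2 * Real.pi * Complex.I : ℂ)).cexp).hasDerivWithinAt
      (s := Icc 0 1)
    refine ((h1.mul h2).congr_of_eventuallyEq_of_mem (.of_forall fun x ↦ ?_) ht).congr_deriv ?_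
    · simp only [Function.comp_apply, Pi.mul_apply]; ring
    · have h3 : P.form a (f (τ t)) (mfderiv 𝓘(ℝ, ℝ) 𝓘(ℝ, E) (fun t ↦ f (τ t)) t (1 : ℝ)) =
          pullbackForm (P.θ a) (P.chart a ∘ f) (τ t) (q - p) := by
        rw [← P.form_comp_mfderiv ((hf _).mdifferentiableAt (by simp)) ha]
        have h4 := congrArg (fun l : ℝ →L[ℝ] E ↦ l 1) (mfderiv_comp t
          ((hf (τ t)).mdifferentiableAt (by simp)) (hτ t).differentiableAt.mdifferentiableAt)
        refine congrArg (P.form a (f (τ t))) (h4.trans ?_)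
        have h5 : mfderiv 𝓘(ℝ, ℝ) 𝓘(ℝ, V) τ t (1 : ℝ) = q - p := by
          rw [mfderiv_eq_fderiv]
          exact (congrArg (fun l : ℝ →L[ℝ] V ↦ l 1) (hτ t).hasFDerivAt.fderiv).trans (one_smul _ _)
        exact congrArg (mfderiv 𝓘(ℝ, V) 𝓘(ℝ, E) f (τ t)) h5
      rw [h3]
      simp only [twist, add_apply, smul_apply, smul_eq_mul, Function.comp_apply,
        ContinuousLinearMap.comp_apply, Complex.ofRealCLM_apply]
      ring
  refine ⟨fun t ht ↦ mul_ne_zero (hψ _ (hτm ht)) (Complex.exp_ne_zero _), fun a t ht ha ↦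
    (key a t ht ha).continuousWithinAt, fun a t ht ha ↦ ?_⟩
  exact (key a t (Ioo_subset_Icc_self ht) ha).hasDerivAt (Icc_mem_nhds ht.1 ht.2)

end PrequantumAtlas

end TwistedParallel

end BohrSommerfeld

namespace BohrSommerfeld

/-! ### Smooth simplices and their edges. -/

section Simplices

open Set

variable {E : Type*} [NormedAddCommGroup E] [NormedSpace ℝ E]
  {X : Type*} [TopologicalSpace X] [ChartedSpace E X]

namespace SmoothSimplex

variable {k : ℕ}

theorem contMDiff_extension (σ : SmoothSimplex E X k) :
    ContMDiff 𝓘(ℝ, Fin (k + 1) → ℝ) 𝓘(ℝ, E) ∞ σ.extension := σ.smooth.choose_spec.1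

theorem extension_apply (σ : SmoothSimplex E X k) (t : stdSimplex ℝ (Fin (k + 1))) :
    σ.extension t = σ.toFun t := σ.smooth.choose_spec.2 t

theorem extension_mk (σ : SmoothSimplex E X k) {t : Fin (k + 1) → ℝ}
    (ht : t ∈ stdSimplex ℝ (Fin (k + 1))) : σ.extension t = σ.toFun ⟨t, ht⟩ :=
  σ.extension_apply ⟨t, ht⟩

theorem vec_mem_stdSimplex {t : ℝ} (ht : t ∈ Icc (0 : ℝ) 1) :
    ![1 - t, t] ∈ stdSimplex ℝ (Fin 2) := by
  refine ⟨fun i ↦ ?_, by simp⟩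
  fin_cases i
  · simpa using ht.2
  · simpa using ht.1

/-- A smooth 1-simplex as a path. -/
def path (σ : SmoothSimplex E X 1) (t : ℝ) : X := σ.extension ![1 - t, t]

theorem contMDiff_path (σ : SmoothSimplex E X 1) : ContMDiff 𝓘(ℝ, ℝ) 𝓘(ℝ, E) ∞ σ.path := by
  have h : ContDiff ℝ ∞ fun t : ℝ ↦ (![1 - t, t] : Fin 2 → ℝ) := by
    rw [contDiff_pi]
    intro i
    fin_cases i
    · exact contDiff_const.sub contDiff_id
    · exact contDiff_id
  exact σ.contMDiff_extension.comp h.contMDiff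

theorem contMDiff_param (σ : SmoothSimplex E X 2) :
    ContMDiff 𝓘(ℝ, ℝ × ℝ) 𝓘(ℝ, E) ∞ σ.param := by
  have h : ContDiff ℝ ∞ fun p : ℝ × ℝ ↦ (![1 - p.1 - p.2, p.1, p.2] : Fin 3 → ℝ) := by
    rw [contDiff_pi]
    intro i
    fin_cases i
    · exact (contDiff_const.sub contDiff_fst).sub contDiff_snd
    · exact contDiff_fst
    · exact contDiff_snd
  exact σ.contMDiff_extension.comp h.contMDiff

theorem path_mem (σ : SmoothSimplex E X 1) {A : Set X} (hA : ∀ t, σ.toFun t ∈ A) {t : ℝ}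
    (ht : t ∈ Icc (0 : ℝ) 1) : σ.path t ∈ A := by
  rw [path, extension_mk σ (vec_mem_stdSimplex ht)]
  exact hA _

theorem path_face (σ : SmoothSimplex E X 2) (i : Fin 3) {t : ℝ} (ht : t ∈ Icc (0 : ℝ) 1) :
    (σ.face i).path t = σ.extension (FunOnFinite.linearMap ℝ ℝ i.succAbove ![1 - t, t]) := by
  rw [path, extension_mk _ (vec_mem_stdSimplex ht)]
  exact (σ.extension_apply _).symm

/-- The restriction to `[0, 1]` is essential here and for the other edges: the extensions chosen for
a simplex and for its face need only agree on the face. -/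
theorem path_face_zero (σ : SmoothSimplex E X 2) {t : ℝ} (ht : t ∈ Icc (0 : ℝ) 1) :
    (σ.face 0).path t = σ.param (1 - t, t) := by
  rw [path_face σ 0 ht, param]
  congr 1
  ext i
  rw [FunOnFinite.linearMap_apply_apply]
  fin_cases i <;> simp [Finset.sum_filter, Fin.sum_univ_two, Fin.succAbove]

theorem path_face_one (σ : SmoothSimplex E X 2) {t : ℝ} (ht : t ∈ Icc (0 : ℝ) 1) :
    (σ.face 1).path t = σ.param (0, t) := by
  rw [path_face σ 1 ht, param]
  congr 1
  ext i
  rw [FunOnFinite.linearMap_apply_apply]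
  fin_cases i <;> simp [Finset.sum_filter, Fin.sum_univ_two, Fin.succAbove]

theorem path_face_two (σ : SmoothSimplex E X 2) {t : ℝ} (ht : t ∈ Icc (0 : ℝ) 1) :
    (σ.face 2).path t = σ.param (t, 0) := by
  rw [path_face σ 2 ht, param]
  congr 1
  ext i
  rw [FunOnFinite.linearMap_apply_apply]
  fin_cases i <;> simp [Finset.sum_filter, Fin.sum_univ_two, Fin.succAbove, Fin.lt_def]

end SmoothSimplex

end Simplices

/-! ### Holonomy along 1-simplices. -/

section Holonomy

open Set

variable {E : Type*} [NormedAddCommGroup E] [NormedSpace ℝ E]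
  {X : Type*} [TopologicalSpace X] [ChartedSpace E X]
  {Ω : TwoForm E X} (P : PrequantumAtlas Ω)

open Classical in
/-- The holonomy of the connection along a path, if there is a parallel section along it. -/
def PrequantumAtlas.hol (σ : SmoothSimplex E X 1) : ℂˣ :=
  if h : ∃ u : ℂˣ, ∃ (δ : ℝ → X) (y : ℝ → ℂ), EqOn δ σ.path (Icc 0 1) ∧ P.IsParallel δ y ∧
    (u : ℂ) = y 1 / y 0 then h.choose else 1

variable {P} in
theorem PrequantumAtlas.IsParallel.hol_eq {δ : ℝ → X} {y : ℝ → ℂ} (h : P.IsParallel δ y)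
    {σ : SmoothSimplex E X 1} (hδ : EqOn δ σ.path (Icc 0 1)) : (P.hol σ : ℂ) = y 1 / y 0 := by
  have hex : ∃ u : ℂˣ, ∃ (δ : ℝ → X) (y : ℝ → ℂ), EqOn δ σ.path (Icc 0 1) ∧ P.IsParallel δ y ∧
      (u : ℂ) = y 1 / y 0 :=
    ⟨Units.mk0 _ (div_ne_zero (h.ne_zero 1 (by simp)) (h.ne_zero 0 (by simp))), δ, y, hδ, h, rfl⟩
  rw [hol, dif_pos hex]
  obtain ⟨δ', y', h1, h2, h3⟩ := hex.choose_spec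
  rw [h3]
  exact h2.unique h (h1.trans hδ.symm)

variable [IsManifold 𝓘(ℝ, E) ∞ X]
  {F : Type*} [NormedAddCommGroup F] [NormedSpace ℝ F]
  {Q : Type*} [TopologicalSpace Q] [ChartedSpace F Q] [IsManifold 𝓘(ℝ, F) ∞ Q]

/-- The global frame is parallel along paths in the submanifold. -/
theorem PrequantumAtlas.IsFlatAlong.isParallel {P : PrequantumAtlas Ω} {ι : Q → X}
    (hP : P.IsFlatAlong (F := F) ι) (hι : Manifold.IsSmoothEmbedding 𝓘(ℝ, F) 𝓘(ℝ, E) ∞ ι) {δ : ℝ → X}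
    (hδ : ContMDiff 𝓘(ℝ, ℝ) 𝓘(ℝ, E) ∞ δ) (hδQ : ∀ t ∈ Icc (0 : ℝ) 1, δ t ∈ range ι) :
    P.IsParallel δ fun _ ↦ 1 := by
  -- The path lies in the submanifold only for times in `[0, 1]`, so it is first made constant
  -- outside. Its lift to `Q` is continuous because `ι` is a topological embedding.
  have hex (t : ℝ) : ∃ q : Q, ι q = δ (projIcc 0 1 zero_le_one t) := hδQ _ (projIcc 0 1 _ t).2
  choose g hg using hex
  have hgc : Continuous g := by
    rw [hι.isEmbedding.continuous_iff, show ι ∘ g = fun t ↦ δ (projIcc 0 1 zero_le_one t) from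
      funext hg]
    exact hδ.continuous.comp (continuous_subtype_val.comp continuous_projIcc)
  have hgI {t : ℝ} (ht : t ∈ Icc (0 : ℝ) 1) : ι (g t) = δ t := by rw [hg, projIcc_of_mem _ ht]
  refine ⟨fun _ _ ↦ one_ne_zero, fun a t ht ha ↦ ?_, fun a t ht ha ↦ ?_⟩
  · have h1 : ContinuousAt (fun t ↦ P.c a (ι (g t))) t :=
      ContinuousAt.comp (g := fun q ↦ P.c a (ι q))
        (hP a (g t) (by rwa [hgI ht])).continuousAt hgc.continuousAt
    have h2 : ContinuousWithinAt (fun t ↦ 1 / P.c a (ι (g t))) (Icc 0 1) t :=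
      continuousWithinAt_const.div h1.continuousWithinAt (P.c_ne_zero _ _)
    exact h2.congr (fun s hs ↦ by rw [hgI hs]) (by rw [hgI ht])
  · have ht' := Ioo_subset_Icc_self ht
    have hev : ι ∘ g =ᶠ[nhds t] δ := by
      filter_upwards [Icc_mem_nhds ht.1 ht.2] with s hs using hgI hs
    -- In the interior the truncated path agrees with `δ`; a continuous lift of a smooth path
    -- through an immersion is smooth.
    have hgs : ContMDiffAt 𝓘(ℝ, ℝ) 𝓘(ℝ, F) ∞ g t :=
      (ContMDiffAt.iff_comp_isImmersionAt (hι.isImmersion.isImmersionAt _)).2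
        ⟨hgc.continuousAt, (hδ t).congr_of_eventuallyEq hev⟩
    have ha' : ι (g t) ∈ (P.chart a).source := by rwa [hgI ht']
    have h1 := hP.hasFDerivAt_comp hι.contMDiff (hgs.mdifferentiableAt (by simp)) ha'
    have h2 := ((hasFDerivAt_div (hasFDerivAt_const (1 : ℂ) t) h1
      (P.c_ne_zero _ _)).hasDerivAt).congr_of_eventuallyEq
      (f₁ := fun t ↦ 1 / P.c a (δ t)) (by
        filter_upwards [Icc_mem_nhds ht.1 ht.2] with s hs
        simp only [hgI hs])
    refine h2.congr_deriv ?_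
    have h3 : pullbackForm (P.θ a) (P.chart a ∘ ι ∘ g) t = pullbackForm (P.θ a) (P.chart a ∘ δ) t := by
      have : P.chart a ∘ ι ∘ g =ᶠ[nhds t] P.chart a ∘ δ := hev.fun_comp _
      rw [pullbackForm, pullbackForm, this.eq_of_nhds, this.fderiv_eq]
    have h4 := congrArg (fun l : ℝ →L[ℝ] ℂ ↦ l 1)
      (P.form_comp_mfderiv ((hδ t).mdifferentiableAt (by simp)) ha)
    rw [h3, hgI ht', show P.form a (δ t) (mfderiv 𝓘(ℝ, ℝ) 𝓘(ℝ, E) δ t (1 : ℝ)) = _ from h4]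
    have := P.c_ne_zero a (δ t)
    simp only [sub_apply, smul_apply, smul_eq_mul, zero_apply]
    field_simp
    simp

end Holonomy

end BohrSommerfeld

namespace BohrSommerfeld

/-! ### Pullbacks of two-forms to vector spaces. -/

section Density

open Set

variable {E : Type*} [NormedAddCommGroup E] [NormedSpace ℝ E]
  {X : Type*} [TopologicalSpace X] [ChartedSpace E X] [IsManifold 𝓘(ℝ, E) ∞ X]
  {V : Type*} [NormedAddCommGroup V] [NormedSpace ℝ V] {Ω : TwoForm E X}

/-- The coefficients of the pullback of a two-form. -/
def TwoForm.density (Ω : TwoForm E X) (f : V → X) (v w p : V) : ℝ :=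
  Ω (f p) ![mfderiv 𝓘(ℝ, V) 𝓘(ℝ, E) f p v, mfderiv 𝓘(ℝ, V) 𝓘(ℝ, E) f p w]

theorem TwoForm.density_eq (Ω : TwoForm E X) {e : OpenPartialHomeomorph X E}
    (he : e ∈ IsManifold.maximalAtlas 𝓘(ℝ, E) ∞ X) {f : V → X} {p : V}
    (hf : MDifferentiableAt 𝓘(ℝ, V) 𝓘(ℝ, E) f p) (hp : f p ∈ e.source) (v w : V) :
    Ω.density f v w p =
      Ω.bilin e (e (f p)) (fderiv ℝ (e ∘ f) p v) (fderiv ℝ (e ∘ f) p w) := by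
  have h := Ω.pullback_eq he hf hp v w
  rw [mfderiv_eq_fderiv] at h
  exact h.trans (Ω.bilin_apply _ _ _).symm

theorem IsSymplectic.contDiffAt_density (hΩ : IsSymplectic Ω) {f : V → X} {p : V}
    (hf : ContMDiffAt 𝓘(ℝ, V) 𝓘(ℝ, E) ∞ f p) (v w : V) :
    ContDiffAt ℝ ∞ (Ω.density f v w) p := by
  have he := IsManifold.chart_mem_maximalAtlas (I := 𝓘(ℝ, E)) (n := ∞) (f p)
  set e := chartAt E (f p)
  have hp : f p ∈ e.source := mem_chart_source E (f p)
  have h1 := contDiffAt_chart_comp he hf hp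
  have h2 : ContDiffAt ℝ ∞ (fun p ↦ Ω.bilin e (e (f p))) p :=
    ContDiffAt.comp (g := Ω.bilin e) p ((hΩ.contDiffOn_bilin he).contDiffAt
      (e.open_target.mem_nhds (e.map_source hp))) h1
  have h3 : ContDiffAt ℝ ∞ (fderiv ℝ (e ∘ f)) p := h1.fderiv_right (by simp)
  refine ((h2.clm_apply (h3.clm_apply (contDiffAt_const (c := v)))).clm_apply
    (h3.clm_apply (contDiffAt_const (c := w)))).congr_of_eventuallyEq ?_
  have h4 : ∀ᶠ q in nhds p, ContMDiffAt 𝓘(ℝ, V) 𝓘(ℝ, E) 1 f q :=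
    (contMDiffAt_iff_contMDiffAt_nhds (by simp)).1 (ContMDiffAt.of_le hf (by simp))
  filter_upwards [h4, hf.continuousAt.preimage_mem_nhds (e.open_source.mem_nhds hp)] with q hq hq'
  exact Ω.density_eq he (hq.mdifferentiableAt (by simp)) hq' v w

theorem SmoothSimplex.integral_eq (σ : SmoothSimplex E X 2) : σ.integral Ω =
    ∫ s in (0 : ℝ)..1, ∫ t in (0 : ℝ)..(1 - s), Ω.density σ.param (1, 0) (0, 1) (s, t) := rfl

end Density

/-! ### Stokes on a triangle: holonomy around its boundary. -/

section Triangle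

open Set intervalIntegral

/-- The primitive in the second variable of a function of two variables. -/
def verticalPrimitive (w : ℝ × ℝ → ℝ) (p : ℝ × ℝ) : ℝ :=
  ∫ r in (0 : ℝ)..1, p.2 * w (p.1, p.2 * r)

/-- The definition is rescaled to the fixed interval `[0, 1]`, so that smooth dependence on the
endpoint becomes smooth dependence on a parameter. This is the usual form, suited to the fundamental
theorem of calculus. -/
theorem verticalPrimitive_eq (w : ℝ × ℝ → ℝ) (s t : ℝ) :
    verticalPrimitive w (s, t) = ∫ r in (0 : ℝ)..t, w (s, r) := by
  have := mul_integral_comp_mul_left (a := 0) (b := 1) (f := fun r ↦ w (s, r)) t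
  simpa [verticalPrimitive] using this

theorem contDiff_verticalPrimitive {w : ℝ × ℝ → ℝ} (hw : ContDiff ℝ ∞ w) :
    ContDiff ℝ ∞ (verticalPrimitive w) := by
  rw [← contDiffOn_univ]
  refine contDiffOn_integral_unitInterval (F := fun q : (ℝ × ℝ) × ℝ ↦ q.1.2 * w (q.1.1, q.1.2 * q.2))
    isOpen_univ (ContDiff.contDiffOn ?_)
  fun_prop

theorem fderiv_verticalPrimitive {w : ℝ × ℝ → ℝ} (hw : ContDiff ℝ ∞ w) (p : ℝ × ℝ) :
    fderiv ℝ (verticalPrimitive w) p (0, 1) = w p := by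
  obtain ⟨s, t⟩ := p
  have h1 : HasDerivAt (fun t ↦ verticalPrimitive w (s, t)) (w (s, t)) t := by
    simp only [verticalPrimitive_eq]
    have hc : Continuous fun r ↦ w (s, r) := hw.continuous.comp (by fun_prop)
    exact (hc.integral_hasStrictDerivAt 0 t).hasDerivAt
  have h2 : HasDerivAt (fun t : ℝ ↦ (s, t)) ((0 : ℝ), (1 : ℝ)) t :=
    (hasDerivAt_const t s).prodMk (hasDerivAt_id t)
  have h3 := HasFDerivAt.comp_hasDerivAt (l := verticalPrimitive w) t
    ((contDiff_verticalPrimitive hw).differentiable (by simp) (s, t)).hasFDerivAt h2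
  exact h3.unique h1

/-- In the plane both sides are multiples of the determinant, so comparing one value is enough. -/
theorem symm_of_basis {D : ℝ × ℝ →L[ℝ] ℝ × ℝ →L[ℝ] ℝ} {b : ℝ × ℝ → ℝ × ℝ → ℝ}
    (hb : ∀ v w, b v w = (v.1 * w.2 - v.2 * w.1) * b (1, 0) (0, 1))
    (h : D (1, 0) (0, 1) - D (0, 1) (1, 0) = b (1, 0) (0, 1)) (v w : ℝ × ℝ) :
    D v w - D w v = b v w := by
  have hv (v : ℝ × ℝ) : v = v.1 • ((1 : ℝ), (0 : ℝ)) + v.2 • ((0 : ℝ), (1 : ℝ)) := by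
    ext <;> simp
  rw [hb, ← h]
  conv_lhs => rw [hv v, hv w]
  simp only [map_add, map_smul, add_apply, smul_apply, smul_eq_mul]
  ring

variable {E : Type*} [NormedAddCommGroup E] [NormedSpace ℝ E]
  {X : Type*} [TopologicalSpace X] [ChartedSpace E X] [IsManifold 𝓘(ℝ, E) ∞ X] {Ω : TwoForm E X}

theorem alt_planar (Φ : E [⋀^Fin 2]→L[ℝ] ℝ) (l : ℝ × ℝ →L[ℝ] E) (v w : ℝ × ℝ) :
    Φ ![l v, l w] = (v.1 * w.2 - v.2 * w.1) * Φ ![l (1, 0), l (0, 1)] := by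
  have hv (v : ℝ × ℝ) : v = v.1 • ((1 : ℝ), (0 : ℝ)) + v.2 • ((0 : ℝ), (1 : ℝ)) := by
    ext <;> simp
  have hs (x y : E) : altToBilin Φ x y = -altToBilin Φ y x := by
    rw [altToBilin_apply, altToBilin_apply, alt_swap]
  have h0 (x : E) : altToBilin Φ x x = 0 := by linarith [hs x x]
  rw [← altToBilin_apply, ← altToBilin_apply]
  conv_lhs => rw [hv v, hv w]
  simp only [map_add, map_smul, add_apply, smul_apply, smul_eq_mul, h0, hs (l (0, 1)) (l (1, 0))]
  ring

theorem TwoForm.density_basis (Ω : TwoForm E X) (f : ℝ × ℝ → X) (p v w : ℝ × ℝ) :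
    Ω.density f v w p = (v.1 * w.2 - v.2 * w.1) * Ω.density f (1, 0) (0, 1) p :=
  alt_planar (E := E) (Ω (f p)) (mfderiv 𝓘(ℝ, ℝ × ℝ) 𝓘(ℝ, E) f p) v w

/-- A one-form on the plane whose differential is a given two-form. -/
def planarPrimitive (w : ℝ × ℝ → ℝ) (p : ℝ × ℝ) : ℝ × ℝ →L[ℝ] ℝ :=
  (-verticalPrimitive w p) • ContinuousLinearMap.fst ℝ ℝ ℝ

theorem contDiff_planarPrimitive {w : ℝ × ℝ → ℝ} (hw : ContDiff ℝ ∞ w) :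
    ContDiff ℝ ∞ (planarPrimitive w) :=
  (contDiff_verticalPrimitive hw).neg.smul contDiff_const

theorem fderiv_planarPrimitive {w : ℝ × ℝ → ℝ} (hw : ContDiff ℝ ∞ w) (p : ℝ × ℝ) :
    fderiv ℝ (planarPrimitive w) p (1, 0) (0, 1) - fderiv ℝ (planarPrimitive w) p (0, 1) (1, 0) =
      w p := by
  have h1 := ((contDiff_verticalPrimitive hw).differentiable (by simp) p).hasFDerivAt
  have h2 : fderiv ℝ (planarPrimitive w) p = _ :=
    (h1.neg.smul_const (ContinuousLinearMap.fst ℝ ℝ ℝ)).fderiv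
  rw [h2]
  simp [fderiv_verticalPrimitive hw]

/-- The holonomy along the boundary of a triangle. -/
theorem PrequantumAtlas.hol_boundary (P : PrequantumAtlas Ω) (hΩ : IsSymplectic Ω)
    (σ : SmoothSimplex E X 2) :
    (P.hol (σ.face 0) * (P.hol (σ.face 1))⁻¹ * P.hol (σ.face 2) : ℂ) =
      Complex.exp (2 * Real.pi * Complex.I * σ.integral Ω) := by
  set w := Ω.density σ.param (1, 0) (0, 1)
  have hw : ContDiff ℝ ∞ w := contDiff_iff_contDiffAt.2 fun p ↦
    hΩ.contDiffAt_density (σ.contMDiff_param p) _ _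
  set β := planarPrimitive w with hβdef
  have hβ : ContDiff ℝ ∞ β := contDiff_planarPrimitive hw
  let T : Set (ℝ × ℝ) := convexHull ℝ {(0, 0), (1, 0), (0, 1)}
  have hT : IsCompact T := (Set.toFinite _).isCompact_convexHull ℝ
  have hc : Convex ℝ T := convex_convexHull ℝ _
  have hsub := subset_convexHull ℝ ({(0, 0), (1, 0), (0, 1)} : Set (ℝ × ℝ))
  have h00 : ((0 : ℝ), (0 : ℝ)) ∈ T := hsub (by simp)
  have h10 : ((1 : ℝ), (0 : ℝ)) ∈ T := hsub (by simp)
  have h01 : ((0 : ℝ), (1 : ℝ)) ∈ T := hsub (by simp)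
  -- One twisted flat section on the whole triangle gives parallel sections along all three edges,
  -- so its values at the vertices cancel around the boundary and only the exponentials of the
  -- integrals of `β` remain.
  obtain ⟨ψ, hψ, hψ'⟩ := P.exists_parallel_of_convex hT hc σ.contMDiff_param
    (hβ.differentiable (by simp))
    (fun p ↦ symm_of_basis (b := fun v w ↦ Ω.density σ.param v w p)
      (Ω.density_basis σ.param p) (fderiv_planarPrimitive hw p))
  have hpar {p q : ℝ × ℝ} (hp : p ∈ T) (hq : q ∈ T) :=
    P.isParallel_segment hc σ.contMDiff_param hβ.continuous hψ hψ' hp hq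
  have h0 := (hpar h10 h01).hol_eq (σ := σ.face 0) (fun t ht ↦ by
    rw [σ.path_face_zero ht]
    simp [sub_eq_add_neg])
  have h1 := (hpar h00 h01).hol_eq (σ := σ.face 1) (fun t ht ↦ by
    rw [σ.path_face_one ht]
    simp)
  have h2 := (hpar h00 h10).hol_eq (σ := σ.face 2) (fun t ht ↦ by
    rw [σ.path_face_two ht]
    simp)
  -- With coordinates `(s, t)`, the form `β` is `-v ds` for the vertical primitive `v`. It vanishes
  -- along the edge `s = 0` since `ds` does, and along the edge `t = 0` since `v` does. The edge
  -- from `(1, 0)` to `(0, 1)` alone contributes, and its contribution is the integral over the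
  -- triangle.
  have hv0 (r : ℝ) : verticalPrimitive w (r, 0) = 0 := by simp [verticalPrimitive_eq]
  have hint : ∫ r in (0 : ℝ)..1, verticalPrimitive w (1 - r, r) = σ.integral Ω := by
    rw [σ.integral_eq]
    have := integral_comp_sub_left (fun s ↦ verticalPrimitive w (s, 1 - s)) (a := 0) (b := 1) 1
    simp only [sub_sub_cancel, sub_self, sub_zero] at this
    rw [this]
    simp only [verticalPrimitive_eq]
    rfl
  rw [Units.val_inv_eq_inv_val, h0, h1, h2, ← hint]
  have e00 := hψ _ h00
  have e10 := hψ _ h10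
  have e01 := hψ _ h01
  simp only [hβdef, planarPrimitive]
  simp [hv0, sub_eq_add_neg] at e00 e10 e01 ⊢
  field_simp

end Triangle

/-! ### Integrality of the relative periods. -/

section RelativePeriods

open Set

variable {E : Type*} [NormedAddCommGroup E] [NormedSpace ℝ E]
  {X : Type*} [TopologicalSpace X] [ChartedSpace E X] [IsManifold 𝓘(ℝ, E) ∞ X] {Ω : TwoForm E X}
  {F : Type*} [NormedAddCommGroup F] [NormedSpace ℝ F]
  {Q : Type*} [TopologicalSpace Q] [ChartedSpace F Q] [IsManifold 𝓘(ℝ, F) ∞ Q]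

/-- The exponential `r ↦ exp (2πi r)`. -/
def unitExp : ℝ →+ Additive ℂˣ where
  toFun r := .ofMul (Units.mk0 (Complex.exp (2 * Real.pi * Complex.I * r)) (Complex.exp_ne_zero _))
  map_zero' := by
    refine congrArg Additive.ofMul (Units.ext ?_)
    simp
  map_add' r s := by
    refine congrArg Additive.ofMul (Units.ext ?_)
    simp [mul_add, Complex.exp_add]

theorem exists_int_of_unitExp_eq_zero {r : ℝ} (h : unitExp r = 0) : ∃ n : ℤ, r = n := by
  have h1 : Complex.exp (2 * Real.pi * Complex.I * r) = 1 :=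
    congrArg (fun u : Additive ℂˣ ↦ ((u.toMul : ℂˣ) : ℂ)) h
  obtain ⟨n, hn⟩ := Complex.exp_eq_one_iff.1 h1
  refine ⟨n, ?_⟩
  have h2 : (2 * Real.pi * Complex.I : ℂ) ≠ 0 := by simp [Real.pi_ne_zero]
  have h3 : (r : ℂ) = n := mul_left_cancel₀ h2 (hn.trans (mul_comm _ _))
  exact_mod_cast h3

/-- Holonomy defines a homomorphism `H` on 1-chains, and `H ∘ ∂` is the exponential of the integral
because this holds on each triangle. Simplices in `Q` have holonomy one since the constant 1 is a
parallel section along them, so `H` kills boundaries lying in `Q`. -/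
theorem PrequantumAtlas.hasIntegralRelativePeriods (P : PrequantumAtlas Ω) (hΩ : IsSymplectic Ω)
    {ι : Q → X} (hι : Manifold.IsSmoothEmbedding 𝓘(ℝ, F) 𝓘(ℝ, E) ∞ ι)
    (hP : P.IsFlatAlong (F := F) ι) : HasIntegralRelativePeriods Ω (range ι) := by
  intro c hc
  let H : SmoothChain E X 1 →ₗ[ℤ] Additive ℂˣ :=
    Finsupp.linearCombination ℤ fun σ ↦ Additive.ofMul (P.hol σ)
  have hH : H ∘ₗ SmoothChain.boundary = unitExp.toIntLinearMap ∘ₗ SmoothChain.integral Ω := by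
    refine Finsupp.lhom_ext' fun σ ↦ LinearMap.ext_ring ?_
    have h1 := P.hol_boundary hΩ σ
    simp only [SmoothChain.boundary, SmoothChain.integral, LinearMap.comp_apply,
      Finsupp.lsingle_apply, Finsupp.linearCombination_single, one_smul, map_sum, H]
    refine Additive.toMul.injective (Units.ext ?_)
    refine Eq.trans ?_ h1
    simp [Fin.sum_univ_three]
  refine exists_int_of_unitExp_eq_zero ?_
  have h2 := LinearMap.congr_fun hH c
  refine (h2.symm.trans ?_ : unitExp (SmoothChain.integral Ω c) = 0)
  change H (SmoothChain.boundary c) = 0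
  rw [Finsupp.linearCombination_apply]
  refine Finset.sum_eq_zero fun σ hσ ↦ ?_
  have h3 := (hP.isParallel hι σ.contMDiff_path fun t ht ↦ σ.path_mem (hc σ hσ) ht).hol_eq
    (Set.eqOn_refl _ _)
  have h4 : P.hol σ = 1 := Units.ext (by simpa using h3)
  simp [h4]

end RelativePeriods

end BohrSommerfeld

namespace BohrSommerfeld

/-! ### Fubini on a triangle and the two halves of a square. -/

section TriangleFubini

open Set MeasureTheory intervalIntegral

/-- Fubini on the unit square for `g` cut off by the indicator of the triangle. -/
theorem integral_triangle_swap {g : ℝ × ℝ → ℝ} (hg : Continuous g) :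
    ∫ s in (0 : ℝ)..1, ∫ t in (0 : ℝ)..(1 - s), g (s, t) =
      ∫ t in (0 : ℝ)..1, ∫ s in (0 : ℝ)..(1 - t), g (s, t) := by
  let S : Set (ℝ × ℝ) := {p | p.1 + p.2 ≤ 1}
  have hS : MeasurableSet S :=
    (isClosed_le (continuous_fst.add continuous_snd) continuous_const).measurableSet
  have key (k : ℝ → ℝ) {s : ℝ} (hs : s ∈ Icc (0 : ℝ) 1) :
      ∫ t in (0 : ℝ)..1, indicator {t | s + t ≤ 1} k t = ∫ t in (0 : ℝ)..(1 - s), k t := by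
    rw [integral_of_le zero_le_one, integral_of_le (by linarith [hs.2]),
      setIntegral_indicator (isClosed_le (by fun_prop) continuous_const).measurableSet]
    congr 2
    ext t
    simp only [mem_inter_iff, mem_Ioc, mem_ofPred_eq]
    constructor
    · rintro ⟨⟨h1, h2⟩, h3⟩; exact ⟨h1, by linarith⟩
    · rintro ⟨h1, h2⟩; exact ⟨⟨h1, by linarith [hs.1]⟩, by linarith⟩
  have h1 : ∫ s in (0 : ℝ)..1, ∫ t in (0 : ℝ)..(1 - s), g (s, t) =
      ∫ s in (0 : ℝ)..1, ∫ t in (0 : ℝ)..1, S.indicator g (s, t) := by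
    refine integral_congr fun s hs ↦ ?_
    rw [uIcc_of_le zero_le_one] at hs
    exact (key (fun t ↦ g (s, t)) hs).symm
  have h2 : ∫ t in (0 : ℝ)..1, ∫ s in (0 : ℝ)..(1 - t), g (s, t) =
      ∫ t in (0 : ℝ)..1, ∫ s in (0 : ℝ)..1, S.indicator g (s, t) := by
    refine integral_congr fun t ht ↦ ?_
    rw [uIcc_of_le zero_le_one] at ht
    refine (key (fun s ↦ g (s, t)) ht).symm.trans (integral_congr fun s _ ↦ ?_)
    simp only [indicator, S, mem_ofPred_eq, add_comm t s]
  rw [h1, h2]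
  refine intervalIntegral_intervalIntegral_swap (F := fun s t ↦ S.indicator g (s, t)) ?_
  refine IntegrableOn.mono_set (t := Icc 0 1 ×ˢ Icc 0 1) ?_ (by
    rw [uIoc_of_le zero_le_one]
    exact prod_mono Ioc_subset_Icc_self Ioc_subset_Icc_self)
  exact (hg.continuousOn.integrableOn_compact (isCompact_Icc.prod isCompact_Icc)).indicator hS

/-- A square is the union of two triangles. -/
theorem integral_square_eq {w : ℝ × ℝ → ℝ} (hw : Continuous w) :
    (∫ s in (0 : ℝ)..1, ∫ t in (0 : ℝ)..(1 - s), w (s + t, t)) +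
      ∫ s in (0 : ℝ)..1, ∫ t in (0 : ℝ)..(1 - s), w (t, s + t) =
      ∫ t in (0 : ℝ)..1, ∫ r in (0 : ℝ)..1, w (r, t) := by
  have h1 := integral_triangle_swap (g := fun p ↦ w (p.1 + p.2, p.2)) (by fun_prop)
  have h2 := integral_triangle_swap (g := fun p ↦ w (p.2, p.1 + p.2)) (by fun_prop)
  have h3 := integral_triangle_swap (g := fun p ↦ w (p.1, 1 - p.2)) (by fun_prop)
  have hcont (t : ℝ) : Continuous fun r ↦ w (r, t) := by fun_prop
  -- Putting `r = s + t` turns the first triangle into the region `t ≤ r` of the square; the second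
  -- one is similarly the region `r ≤ t`.
  have h4 : ∫ s in (0 : ℝ)..1, ∫ t in (0 : ℝ)..(1 - s), w (s + t, t) =
      ∫ t in (0 : ℝ)..1, ∫ r in t..1, w (r, t) := by
    rw [h1]
    refine integral_congr fun t _ ↦ ?_
    simpa using integral_comp_add_right (a := 0) (b := 1 - t) (fun r ↦ w (r, t)) t
  have h5 : ∫ s in (0 : ℝ)..1, ∫ t in (0 : ℝ)..(1 - s), w (t, s + t) =
      ∫ t in (0 : ℝ)..1, ∫ r in (0 : ℝ)..t, w (r, t) := by
    have h6 : ∫ t in (0 : ℝ)..1, ∫ r in (0 : ℝ)..t, w (r, t) =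
        ∫ t in (0 : ℝ)..1, ∫ s in (0 : ℝ)..(1 - t), w (s, 1 - t) := by
      have := integral_comp_sub_left (a := 0) (b := 1) (fun t ↦ ∫ r in (0 : ℝ)..t, w (r, t)) 1
      simpa using this.symm
    rw [h2, h6, ← h3]
    refine integral_congr fun r _ ↦ ?_
    have h7 := integral_comp_sub_left (a := 0) (b := 1 - r) (fun t ↦ w (r, t)) 1
    have h8 := integral_comp_add_right (a := 0) (b := 1 - r) (fun t ↦ w (r, t)) r
    simp only [sub_sub_cancel, sub_zero, zero_add, sub_add_cancel] at h7 h8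
    exact h8.trans h7.symm
  rw [h4, h5, ← intervalIntegral.integral_add]
  · refine integral_congr fun t _ ↦ ?_
    rw [add_comm]
    exact integral_add_adjacent_intervals ((hcont t).intervalIntegrable _ _)
      ((hcont t).intervalIntegrable _ _)
  · refine Continuous.intervalIntegrable ?_ _ _
    have : Continuous fun t : ℝ ↦ ∫ r in (1 : ℝ)..t, w (r, t) :=
      continuous_parametric_intervalIntegral_of_continuous (f := fun t r ↦ w (r, t)) (by fun_prop)
        continuous_id
    exact this.neg.congr fun t ↦ (integral_symm _ _).symm
  · exact Continuous.intervalIntegrable (continuous_parametric_intervalIntegral_of_continuous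
      (f := fun t r ↦ w (r, t)) (by fun_prop) continuous_id) _ _

end TriangleFubini

/-! ### From relative integrality to a unitary character on paths. -/

section PathCharacter

open Set

variable {E : Type*} [NormedAddCommGroup E] [NormedSpace ℝ E]
  {X : Type*} [TopologicalSpace X] [ChartedSpace E X]

namespace SmoothSimplex

/-- The 1-simplex given by a path. -/
def ofPath (δ : ℝ → X) (hδ : ContMDiff 𝓘(ℝ, ℝ) 𝓘(ℝ, E) ∞ δ) : SmoothSimplex E X 1 where
  toFun s := δ (s.1 1)
  smooth := ⟨fun s ↦ δ (s 1), hδ.comp (contDiff_apply ℝ ℝ 1).contMDiff, fun _ ↦ rfl⟩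

/-- The 2-simplex given by a map on the plane. -/
def ofTriangle (f : ℝ × ℝ → X) (hf : ContMDiff 𝓘(ℝ, ℝ × ℝ) 𝓘(ℝ, E) ∞ f) :
    SmoothSimplex E X 2 where
  toFun s := f (s.1 1, s.1 2)
  smooth := ⟨fun s ↦ f (s 1, s 2),
    hf.comp ((contDiff_apply ℝ ℝ 1).prodMk (contDiff_apply ℝ ℝ 2)).contMDiff, fun _ ↦ rfl⟩

variable {f : ℝ × ℝ → X} (hf : ContMDiff 𝓘(ℝ, ℝ × ℝ) 𝓘(ℝ, E) ∞ f)

theorem map_succAbove_val (i : Fin 3) (s : stdSimplex ℝ (Fin 2)) (j : Fin 3) :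
    (stdSimplex.map i.succAbove s).1 j = FunOnFinite.linearMap ℝ ℝ i.succAbove s.1 j := rfl

theorem ofTriangle_face_zero : (ofTriangle f hf).face 0 = ofPath (fun t ↦ f (1 - t, t))
    (hf.comp (ContDiff.contMDiff (by fun_prop))) := by
  ext s
  have hs : s.1 0 = 1 - s.1 1 := by
    have := s.2.2
    rw [Fin.sum_univ_two] at this
    linarith
  change f ((stdSimplex.map (0 : Fin 3).succAbove s).1 1,
    (stdSimplex.map (0 : Fin 3).succAbove s).1 2) = f (1 - s.1 1, s.1 1)
  rw [map_succAbove_val, map_succAbove_val, FunOnFinite.linearMap_apply_apply,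
    FunOnFinite.linearMap_apply_apply, ← hs]
  simp [Finset.sum_filter, Fin.sum_univ_two, Fin.succAbove]

theorem ofTriangle_face_one : (ofTriangle f hf).face 1 = ofPath (fun t ↦ f (0, t))
    (hf.comp (ContDiff.contMDiff (by fun_prop))) := by
  ext s
  change f ((stdSimplex.map (1 : Fin 3).succAbove s).1 1,
    (stdSimplex.map (1 : Fin 3).succAbove s).1 2) = f (0, s.1 1)
  rw [map_succAbove_val, map_succAbove_val, FunOnFinite.linearMap_apply_apply,
    FunOnFinite.linearMap_apply_apply]
  simp [Finset.sum_filter, Fin.sum_univ_two, Fin.succAbove]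

theorem ofTriangle_face_two : (ofTriangle f hf).face 2 = ofPath (fun t ↦ f (t, 0))
    (hf.comp (ContDiff.contMDiff (by fun_prop))) := by
  ext s
  change f ((stdSimplex.map (2 : Fin 3).succAbove s).1 1,
    (stdSimplex.map (2 : Fin 3).succAbove s).1 2) = f (s.1 1, 0)
  rw [map_succAbove_val, map_succAbove_val, FunOnFinite.linearMap_apply_apply,
    FunOnFinite.linearMap_apply_apply]
  simp [Finset.sum_filter, Fin.sum_univ_two, Fin.succAbove, Fin.lt_def]

theorem boundary_ofTriangle :
    SmoothChain.boundary (Finsupp.single (ofTriangle f hf) 1) =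
      Finsupp.single (ofPath (fun t ↦ f (1 - t, t)) (hf.comp (ContDiff.contMDiff (by fun_prop)))) 1 -
      Finsupp.single (ofPath (fun t ↦ f (0, t)) (hf.comp (ContDiff.contMDiff (by fun_prop)))) 1 +
      Finsupp.single (ofPath (fun t ↦ f (t, 0)) (hf.comp (ContDiff.contMDiff (by fun_prop)))) 1 := by
  rw [SmoothChain.boundary, Finsupp.linearCombination_single, one_smul]
  refine (Fin.sum_univ_three fun i : Fin 3 ↦
    Finsupp.single ((ofTriangle f hf).face i) ((-1 : ℤ) ^ (i : ℕ))).trans ?_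
  rw [ofTriangle_face_zero, ofTriangle_face_one, ofTriangle_face_two]
  simp [sub_eq_add_neg, ← Finsupp.single_neg]

/-- The integral of a simplex is computed with a chosen extension, which agrees with `f` on the
closed triangle only. In the interior the derivatives agree as well, and the boundary does not
affect the integral. -/
theorem integral_ofTriangle (Ω : TwoForm E X) : (ofTriangle f hf).integral Ω =
    ∫ s in (0 : ℝ)..1, ∫ t in (0 : ℝ)..(1 - s), Ω.density f (1, 0) (0, 1) (s, t) := by
  rw [integral]
  refine intervalIntegral.integral_congr_Ioo_of_le zero_le_one fun s hs ↦
    intervalIntegral.integral_congr_Ioo_of_le (by linarith [hs.2]) fun t ht ↦ ?_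
  have hO : IsOpen {p : ℝ × ℝ | 0 < p.1 ∧ 0 < p.2 ∧ p.1 + p.2 < 1} :=
    (isOpen_lt continuous_const continuous_fst).inter
      ((isOpen_lt continuous_const continuous_snd).inter
        (isOpen_lt (continuous_fst.add continuous_snd) continuous_const))
  have hev : (ofTriangle f hf).param =ᶠ[nhds (s, t)] f := by
    filter_upwards [hO.mem_nhds ⟨hs.1, ht.1, by linarith [ht.2]⟩] with p hp
    have hmem : ![1 - p.1 - p.2, p.1, p.2] ∈ stdSimplex ℝ (Fin 3) := by
      refine ⟨fun i ↦ ?_, by simp [Fin.sum_univ_three]; ring⟩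
      fin_cases i
      · simpa using by linarith [hp.2.2]
      · simpa using hp.1.le
      · simpa using hp.2.1.le
    rw [param, extension_mk _ hmem]
    simp [ofTriangle]
  have : ∀ (x : X) (l : ℝ × ℝ →L[ℝ] E), x = f (s, t) → l = mfderiv 𝓘(ℝ, ℝ × ℝ) 𝓘(ℝ, E) f (s, t) →
      Ω x ![l (1, 0), l (0, 1)] = Ω.density f (1, 0) (0, 1) (s, t) := by
    rintro _ _ rfl rfl; rfl
  exact this _ _ hev.eq_of_nhds hev.mfderiv_eq

end SmoothSimplex

/-- A unitary character on paths, trivial on the paths in `A`, whose value on the boundary of a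
triangle is given by the integral of `Ω`. -/
structure PathCharacter (Ω : TwoForm E X) (A : Set X) where
  toFun : (ℝ → X) → ℂ
  normSq_eq_one : ∀ δ, Complex.normSq (toFun δ) = 1
  eq_one_of_mem : ∀ δ, ContMDiff 𝓘(ℝ, ℝ) 𝓘(ℝ, E) ∞ δ → (∀ t, δ t ∈ A) → toFun δ = 1
  triangle : ∀ f : ℝ × ℝ → X, ContMDiff 𝓘(ℝ, ℝ × ℝ) 𝓘(ℝ, E) ∞ f →
    toFun (fun t ↦ f (1 - t, t)) * (toFun fun t ↦ f (0, t))⁻¹ * toFun (fun t ↦ f (t, 0)) =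
      Complex.exp (2 * Real.pi * Complex.I * ((∫ s in (0 : ℝ)..1, ∫ t in (0 : ℝ)..(1 - s),
        Ω.density f (1, 0) (0, 1) (s, t) : ℝ) : ℂ))

/-- The hypothesis says exactly that integration modulo `ℤ` vanishes on the kernel of the map from
2-chains to 1-chains modulo 1-chains in `A`. It therefore descends to the image of that map, and it
extends from there to the whole quotient because the divisible group `ℝ/ℤ` is injective. -/
theorem exists_linearMap_addCircle {Ω : TwoForm E X} {A : Set X}
    (h : HasIntegralRelativePeriods Ω A) :
    ∃ χ : SmoothChain E X 1 →ₗ[ℤ] AddCircle (1 : ℝ),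
      (∀ c, χ (SmoothChain.boundary c) = ((SmoothChain.integral Ω c : ℝ) : AddCircle (1 : ℝ))) ∧
      ∀ σ : SmoothSimplex E X 1, (∀ t, σ.toFun t ∈ A) → χ (Finsupp.single σ 1) = 0 := by
  let N : Submodule ℤ (SmoothChain E X 1) :=
    Finsupp.supported ℤ ℤ {σ : SmoothSimplex E X 1 | ∀ t, σ.toFun t ∈ A}
  let f : SmoothChain E X 2 →ₗ[ℤ] SmoothChain E X 1 ⧸ N := N.mkQ ∘ₗ SmoothChain.boundary
  let m : ℝ →+ AddCircle (1 : ℝ) := QuotientAddGroup.mk' _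
  let g : SmoothChain E X 2 →ₗ[ℤ] AddCircle (1 : ℝ) :=
    m.toIntLinearMap ∘ₗ SmoothChain.integral Ω
  have hle : LinearMap.ker f ≤ LinearMap.ker g := by
    intro c hc
    have hc' : SmoothChain.boundary c ∈ N := by
      rwa [LinearMap.mem_ker, LinearMap.comp_apply, Submodule.mkQ_apply,
        Submodule.Quotient.mk_eq_zero] at hc
    obtain ⟨n, hn⟩ := h c fun σ hσ ↦ (Finsupp.mem_supported ℤ _).1 hc' hσ
    change ((SmoothChain.integral Ω c : ℝ) : AddCircle (1 : ℝ)) = 0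
    rw [hn, AddCircle.coe_eq_zero_iff]
    exact ⟨n, by simp⟩
  obtain ⟨χ, hχ⟩ := (Module.Baer.of_divisible (AddCircle (1 : ℝ))).extension_property
    ((LinearMap.ker f).liftQ f le_rfl) (by
      rw [← LinearMap.ker_eq_bot]
      exact Submodule.ker_liftQ_eq_bot _ _ _ le_rfl) ((LinearMap.ker f).liftQ g hle)
  refine ⟨χ ∘ₗ N.mkQ, fun c ↦ LinearMap.congr_fun hχ (Submodule.Quotient.mk c), fun σ hσ ↦ ?_⟩
  have : N.mkQ (Finsupp.single σ 1) = 0 := by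
    rw [Submodule.mkQ_apply, Submodule.Quotient.mk_eq_zero]
    exact Finsupp.single_mem_supported ℤ _ hσ
  rw [LinearMap.comp_apply, this, map_zero]

open Classical in
-- The linear map to `ℝ/ℤ` is composed with the isomorphism onto the unit circle. Paths that are not
-- smooth get the value 1, which the triangle law never sees.
theorem exists_pathCharacter {Ω : TwoForm E X} {A : Set X} (h : HasIntegralRelativePeriods Ω A) :
    Nonempty (PathCharacter Ω A) := by
  obtain ⟨χ, hχ, hχA⟩ := exists_linearMap_addCircle h
  let T : (ℝ → X) → Circle := fun δ ↦ if hδ : ContMDiff 𝓘(ℝ, ℝ) 𝓘(ℝ, E) ∞ δ then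
    AddCircle.toCircle (χ (Finsupp.single (SmoothSimplex.ofPath δ hδ) 1)) else 1
  refine ⟨⟨fun δ ↦ T δ, fun δ ↦ Circle.normSq_coe _, fun δ hδ hA ↦ ?_, fun f hf ↦ ?_⟩⟩
  · simp only [T, dif_pos hδ]
    rw [hχA _ fun t ↦ hA _]
    simp
  · have h0 := hf.comp (f := fun t : ℝ ↦ (1 - t, t)) (ContDiff.contMDiff (by fun_prop))
    have h1 := hf.comp (f := fun t : ℝ ↦ ((0 : ℝ), t)) (ContDiff.contMDiff (by fun_prop))
    have h2 := hf.comp (f := fun t : ℝ ↦ (t, (0 : ℝ))) (ContDiff.contMDiff (by fun_prop))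
    have hsub (x y : AddCircle (1 : ℝ)) : (x - y).toCircle = x.toCircle * y.toCircle⁻¹ := by
      rw [sub_eq_add_neg, AddCircle.toCircle_add, AddCircle.toCircle_neg]
    have key := congrArg (fun z ↦ (AddCircle.toCircle z : ℂ))
      (hχ (Finsupp.single (SmoothSimplex.ofTriangle f hf) 1))
    simp only [SmoothSimplex.boundary_ofTriangle, SmoothChain.integral,
      Finsupp.linearCombination_single, one_smul, SmoothSimplex.integral_ofTriangle, map_add,
      map_sub, hsub, AddCircle.toCircle_add, AddCircle.toCircle_apply_mk, Circle.coe_mul, Circle.coe_inv, Circle.coe_exp] at key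
    have e0 : T (fun t ↦ f (1 - t, t)) = _ := dif_pos h0
    have e1 : T (fun t ↦ f (0, t)) = _ := dif_pos h1
    have e2 : T (fun t ↦ f (t, 0)) = _ := dif_pos h2
    rw [e0, e1, e2]
    refine key.trans (congrArg Complex.exp ?_)
    push_cast
    ring

end PathCharacter

end BohrSommerfeld

namespace BohrSommerfeld

/-! ### Variation of a path character: squares and rays. -/

section Square

open Set

local notation "ρ" => Real.smoothTransition

variable {E : Type*} [NormedAddCommGroup E] [NormedSpace ℝ E]
  {X : Type*} [TopologicalSpace X] [ChartedSpace E X]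
  {V : Type*} [NormedAddCommGroup V] [NormedSpace ℝ V]
  {V' : Type*} [NormedAddCommGroup V'] [NormedSpace ℝ V']

theorem TwoForm.density_comp (Ω : TwoForm E X) {f : V → X} {l : V' →L[ℝ] V} {p : V'}
    (hf : MDifferentiableAt 𝓘(ℝ, V) 𝓘(ℝ, E) f (l p)) (v w : V') :
    Ω.density (fun p ↦ f (l p)) v w p = Ω.density f (l v) (l w) (l p) := by
  have h := mfderiv_comp p hf (l.differentiableAt (x := p)).mdifferentiableAt
  rw [mfderiv_eq_fderiv, l.fderiv] at h
  have hv (v : V') := congrArg (fun m : V' →L[ℝ] E ↦ m v) h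
  have : ∀ x y x' y' : E, x = x' → y = y' → Ω (f (l p)) ![x, y] = Ω (f (l p)) ![x', y'] := by
    rintro _ _ _ _ rfl rfl; rfl
  exact this _ _ _ _ (hv v) (hv w)

variable {Ω : TwoForm E X} {A : Set X} (T : PathCharacter Ω A)

namespace PathCharacter

theorem ne_zero (δ : ℝ → X) : T.toFun δ ≠ 0 := by
  intro h
  simpa [h] using T.normSq_eq_one δ

/-- In the triangle law for a constant map the three edges coincide and the integral is zero. -/
theorem toFun_const (x : X) : T.toFun (fun _ ↦ x) = 1 := by
  have h := T.triangle (fun _ ↦ x) contMDiff_const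
  have h0 : ∀ p, Ω.density (V := ℝ × ℝ) (fun _ ↦ x) (1, 0) (0, 1) p = 0 := by
    intro p
    have : ∀ l : ℝ × ℝ →L[ℝ] E, l = 0 → Ω x ![l (1, 0), l (0, 1)] = 0 := by
      rintro _ rfl
      exact (Ω x).map_coord_zero (i := 0) rfl
    exact this _ mfderiv_const
  simp only [h0, intervalIntegral.integral_zero, Complex.ofReal_zero, mul_zero, Complex.exp_zero,
    mul_inv_cancel₀ (T.ne_zero _), one_mul] at h
  exact h

variable [IsManifold 𝓘(ℝ, E) ∞ X]

/-- The diagonal cuts the square into two triangles, parametrized through `l₁` and `l₂`. The second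
one reverses the orientation, whence the inverse exponential, and the value on the diagonal cancels.
-/
theorem square (hΩ : IsSymplectic Ω) {H : ℝ × ℝ → X}
    (hH : ContMDiff 𝓘(ℝ, ℝ × ℝ) 𝓘(ℝ, E) ∞ H) :
    T.toFun (fun t ↦ H (1, t)) * T.toFun (fun t ↦ H (t, 0)) =
      T.toFun (fun t ↦ H (t, 1)) * T.toFun (fun t ↦ H (0, t)) *
        Complex.exp (2 * Real.pi * Complex.I * ((∫ t in (0 : ℝ)..1, ∫ r in (0 : ℝ)..1,
          Ω.density H (1, 0) (0, 1) (r, t) : ℝ) : ℂ)) := by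
  let l₁ : ℝ × ℝ →L[ℝ] ℝ × ℝ :=
    (ContinuousLinearMap.fst ℝ ℝ ℝ + ContinuousLinearMap.snd ℝ ℝ ℝ).prod
      (ContinuousLinearMap.snd ℝ ℝ ℝ)
  let l₂ : ℝ × ℝ →L[ℝ] ℝ × ℝ := (ContinuousLinearMap.snd ℝ ℝ ℝ).prod
    (ContinuousLinearMap.fst ℝ ℝ ℝ + ContinuousLinearMap.snd ℝ ℝ ℝ)
  have hHd (p : ℝ × ℝ) : MDifferentiableAt 𝓘(ℝ, ℝ × ℝ) 𝓘(ℝ, E) H p :=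
    (hH p).mdifferentiableAt (by simp)
  have h1 := T.triangle (fun p ↦ H (l₁ p)) (hH.comp l₁.contDiff.contMDiff)
  have h2 := T.triangle (fun p ↦ H (l₂ p)) (hH.comp l₂.contDiff.contMDiff)
  have d1 (p : ℝ × ℝ) : Ω.density (fun p ↦ H (l₁ p)) (1, 0) (0, 1) p =
      Ω.density H (1, 0) (0, 1) (p.1 + p.2, p.2) := by
    rw [Ω.density_comp (hHd _), Ω.density_basis]
    simp [l₁]
  have d2 (p : ℝ × ℝ) : Ω.density (fun p ↦ H (l₂ p)) (1, 0) (0, 1) p =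
      -Ω.density H (1, 0) (0, 1) (p.2, p.1 + p.2) := by
    rw [Ω.density_comp (hHd _), Ω.density_basis]
    simp [l₂]
  have hw : Continuous (Ω.density H (1, 0) (0, 1)) := continuous_iff_continuousAt.2 fun p ↦
    (hΩ.contDiffAt_density (hH p) _ _).continuousAt
  rw [← integral_square_eq hw]
  simp only [d1, d2, intervalIntegral.integral_neg] at h1 h2
  simp only [l₁, l₂, ContinuousLinearMap.prod_apply, add_apply, ContinuousLinearMap.coe_fst',
    ContinuousLinearMap.coe_snd', sub_add_cancel, zero_add, add_zero] at h1 h2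
  have hd := T.ne_zero (fun t ↦ H (t, t))
  rw [Complex.ofReal_add, mul_add, Complex.exp_add, ← h1]
  rw [Complex.ofReal_neg, mul_neg, Complex.exp_neg] at h2
  have h3 := Complex.exp_ne_zero (2 * Real.pi * Complex.I *
    ((∫ s in (0 : ℝ)..1, ∫ t in (0 : ℝ)..(1 - s), Ω.density H (1, 0) (0, 1) (t, s + t) : ℝ) : ℂ))
  generalize Complex.exp (2 * Real.pi * Complex.I *
    ((∫ s in (0 : ℝ)..1, ∫ t in (0 : ℝ)..(1 - s),
      Ω.density H (1, 0) (0, 1) (t, s + t) : ℝ) : ℂ)) = z at *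
  have h4 : T.toFun (fun t ↦ H (t, 1)) * (T.toFun fun t ↦ H (t, t))⁻¹ * T.toFun (fun t ↦ H (0, t)) *
      z = 1 := by rw [h2, inv_mul_cancel₀ h3]
  linear_combination (-T.toFun (fun t ↦ H (1, t)) * T.toFun (fun t ↦ H (t, 0))) * h4

/-- The value of the character on the ray from a given point to `x` in a chart. -/
def frame (e : OpenPartialHomeomorph X E) (a₀ : E) (x : X) : ℂ :=
  T.toFun fun r ↦ e.symm (ray a₀ (e x) r)

variable [FiniteDimensional ℝ E] {e : OpenPartialHomeomorph X E} {a₀ : E}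

/-- The value of the character on a path in a chart. -/
theorem toFun_mul_frame (he : e ∈ IsManifold.maximalAtlas 𝓘(ℝ, E) ∞ X)
    (hS : Convex ℝ e.target) (ha₀ : a₀ ∈ e.target) (hΩ : IsSymplectic Ω)
    {δ : ℝ → X} (hδ : ContMDiff 𝓘(ℝ, ℝ) 𝓘(ℝ, E) ∞ δ)
    (hδe : ∀ t, δ t ∈ e.source) :
    T.toFun δ * T.frame e a₀ (δ 0) = T.frame e a₀ (δ 1) * Complex.exp (2 * Real.pi * Complex.I *
      ((∫ t in (0 : ℝ)..1, pullbackForm (radialPrimitive (Ω.bilin e) a₀) (e ∘ δ) t 1 : ℝ) : ℂ)) := by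
  set u : ℝ → E := e ∘ δ
  have hu : ContDiff ℝ ∞ u := contDiff_iff_contDiffAt.2 fun t ↦
    contDiffAt_chart_comp he (hδ t) (hδe t)
  have hut (t : ℝ) : u t ∈ e.target := e.map_source (hδe t)
  -- The square is swept by the rays from `a₀` to the moving point of the path. Its sides are the
  -- constant path at `a₀`, the path `δ`, and the rays to the two endpoints of `δ`.
  let k : ℝ × ℝ → E := fun p ↦ ray a₀ (u p.2) p.1
  have hk : ContDiff ℝ ∞ k :=
    contDiff_ray.comp (contDiff_const.prodMk ((hu.comp contDiff_snd).prodMk contDiff_fst))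
  have hkt (p : ℝ × ℝ) : k p ∈ e.target := Convex.ray_mem hS ha₀ (hut _) _
  let H : ℝ × ℝ → X := fun p ↦ e.symm (k p)
  have hH : ContMDiff 𝓘(ℝ, ℝ × ℝ) 𝓘(ℝ, E) ∞ H := fun p ↦
    (contMDiffAt_chart_symm he (hkt p)).comp p hk.contMDiff.contMDiffAt
  have hsq := T.square hΩ hH
  have hH0 : (fun t ↦ H (0, t)) = fun _ ↦ e.symm a₀ := by ext t; simp [H, k]
  have hH1 : (fun t ↦ H (1, t)) = δ := by
    ext t
    simp only [H, k, ray_one]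
    exact e.left_inv (hδe t)
  have hek : e ∘ H = k := funext fun p ↦ e.right_inv (hkt p)
  have hdens (r t : ℝ) : Ω.density H (1, 0) (0, 1) (r, t) =
      ((ρ r * deriv ρ r) • Ω.bilin e (ray a₀ (u t) r) (u t - a₀)) (fderiv ℝ u t 1) := by
    have hks : H (r, t) ∈ e.source := e.map_target (hkt _)
    rw [Ω.density_eq he ((hH _).mdifferentiableAt (by simp)) hks, hek]
    have hkd := (hk.differentiable (by simp) (r, t)).hasFDerivAt
    have k1 : fderiv ℝ k (r, t) (1, 0) = deriv ρ r • (u t - a₀) := by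
      have h2 : HasDerivAt (fun r : ℝ ↦ (r, t)) ((1 : ℝ), (0 : ℝ)) r :=
        (hasDerivAt_id r).prodMk (hasDerivAt_const r t)
      exact (HasFDerivAt.comp_hasDerivAt (l := k) r hkd h2).unique (hasDerivAt_ray a₀ (u t) r)
    have k2 : fderiv ℝ k (r, t) (0, 1) = ρ r • fderiv ℝ u t 1 := by
      have h2 : HasDerivAt (fun t : ℝ ↦ (r, t)) ((0 : ℝ), (1 : ℝ)) t :=
        (hasDerivAt_const t r).prodMk (hasDerivAt_id t)
      have h3 : HasDerivAt (fun t ↦ k (r, t)) (ρ r • fderiv ℝ u t 1) t :=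
        (((hu.differentiable (by simp) t).hasFDerivAt.hasDerivAt.sub_const a₀).const_smul
          (ρ r)).const_add a₀
      exact (HasFDerivAt.comp_hasDerivAt (l := k) t hkd h2).unique h3
    have k3 : e (H (r, t)) = ray a₀ (u t) r := e.right_inv (hkt (r, t))
    rw [k1, k2, k3]
    simp only [map_smul, smul_apply, smul_eq_mul]
    ring
  -- Integrating along the ray first produces the radial primitive evaluated on the velocity of the
  -- path.
  have hint (t : ℝ) : ∫ r in (0 : ℝ)..1, Ω.density H (1, 0) (0, 1) (r, t) =
      pullbackForm (radialPrimitive (Ω.bilin e) a₀) u t 1 := by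
    simp only [hdens]
    have hc : Continuous fun r ↦ (ρ r * deriv ρ r) • Ω.bilin e (ray a₀ (u t) r) (u t - a₀) := by
      have h1 := (contDiffOn_radialPrimitive_integrand hS ha₀
        (hΩ.contDiffOn_bilin he)).continuousOn
      rw [← continuousOn_univ]
      exact h1.comp (f := fun r : ℝ ↦ (u t, r)) (by fun_prop) fun r _ ↦ ⟨hut t, mem_univ _⟩
    exact (ContinuousLinearMap.intervalIntegral_apply (hc.intervalIntegrable 0 1) _).symm
  rw [hH0, hH1, toFun_const, mul_one] at hsq
  simp only [hint] at hsq
  exact hsq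

/-- The substitution given by the smooth transition turns this into the integral of `κ` over the
straight segment, whose derivative at the source is the value of `κ` there. -/
theorem hasFDerivAt_integral_ray {κ : V → V →L[ℝ] ℝ} {v₀ : V} {r : ℝ} (hr : 0 < r)
    (hκ : ContinuousOn κ (Metric.ball v₀ r)) :
    HasFDerivAt (fun v ↦ ∫ t in (0 : ℝ)..1, κ (ray v₀ v t) (deriv ρ t • (v - v₀))) (κ v₀) v₀ := by
  have h1 : HasFDerivAt (fun v ↦ ∫ᶜ x in Path.segment v₀ v, κ x) (κ v₀) v₀ :=
    HasFDerivAt.curveIntegral_segment_source' (by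
      filter_upwards [Metric.ball_mem_nhds v₀ hr] with z hz
      exact hκ.continuousAt (Metric.isOpen_ball.mem_nhds hz))
  refine h1.congr_of_eventuallyEq ?_
  filter_upwards [Metric.ball_mem_nhds v₀ hr] with v hv
  rw [curveIntegral_segment]
  have h2 := intervalIntegral.integral_deriv_smul_comp' (a := 0) (b := 1) (f := ρ) (f' := deriv ρ)
    (g := fun t ↦ κ (AffineMap.lineMap v₀ v t) (v - v₀))
    (fun x _ ↦ hasDerivAt_smoothTransition x)
    contDiff_deriv_smoothTransition.continuous.continuousOn (by
      have hm : MapsTo (fun t : ℝ ↦ AffineMap.lineMap (k := ℝ) v₀ v t) (ρ '' uIcc 0 1)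
          (Metric.ball v₀ r) := by
        rintro _ ⟨t, _, rfl⟩
        have := Convex.ray_mem (convex_ball v₀ r) (Metric.mem_ball_self hr) hv t
        change AffineMap.lineMap v₀ v (ρ t) ∈ _
        rwa [AffineMap.lineMap_apply_module', add_comm]
      exact (hκ.comp (AffineMap.lineMap_continuous).continuousOn hm).clm_apply continuousOn_const)
  rw [Real.smoothTransition.zero, Real.smoothTransition.one] at h2
  rw [← h2]
  refine intervalIntegral.integral_congr fun t _ ↦ ?_
  simp only [map_smul, Function.comp_apply, AffineMap.lineMap_apply_module', ray, add_comm]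

/-- The frame itself may be discontinuous. Corrected by the value of the character on the image of
the ray from `v₀` to `v`, it equals `frame (g v₀)` times the exponential of `-2πi` times the
integral of the pulled back radial primitive along that ray. The correction depends on `g` but not
on the chart `e`. -/
theorem hasFDerivAt_frame_mul (he : e ∈ IsManifold.maximalAtlas 𝓘(ℝ, E) ∞ X)
    (hS : Convex ℝ e.target) (ha₀ : a₀ ∈ e.target) (hΩ : IsSymplectic Ω)
    {g : V → X} {v₀ : V} {r : ℝ} (hr : 0 < r)
    (hg : ∀ v ∈ Metric.ball v₀ r, ContMDiffAt 𝓘(ℝ, V) 𝓘(ℝ, E) ∞ g v)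
    (hge : ∀ v ∈ Metric.ball v₀ r, g v ∈ e.source) :
    HasFDerivAt (fun v ↦ T.frame e a₀ (g v) * (T.toFun fun t ↦ g (ray v₀ v t))⁻¹)
      (T.frame e a₀ (g v₀) • pullbackForm (fun u ↦ (-2 * Real.pi * Complex.I) •
        (Complex.ofRealCLM ∘L radialPrimitive (Ω.bilin e) a₀ u)) (e ∘ g) v₀) v₀ := by
  set α := radialPrimitive (Ω.bilin e) a₀
  set κ := pullbackForm α (e ∘ g)
  have hα : ContDiffOn ℝ ∞ α e.target :=
    contDiffOn_radialPrimitive hS e.open_target ha₀ (hΩ.contDiffOn_bilin he)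
  have heg (v : V) (hv : v ∈ Metric.ball v₀ r) : ContDiffAt ℝ ∞ (e ∘ g) v :=
    contDiffAt_chart_comp he (hg v hv) (hge v hv)
  have hκ : ContinuousOn κ (Metric.ball v₀ r) := fun v hv ↦
    (contDiffAt_pullbackForm (g := e ∘ g) (hα.contDiffAt (e.open_target.mem_nhds (e.map_source (hge v hv))))
      (heg v hv)).continuousAt.continuousWithinAt
  have h0 : HasFDerivAt (fun v ↦ ((∫ t in (0 : ℝ)..1,
      κ (ray v₀ v t) (deriv ρ t • (v - v₀)) : ℝ) : ℂ)) (Complex.ofRealCLM ∘L κ v₀) v₀ :=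
    Complex.ofRealCLM.hasFDerivAt.comp v₀ (hasFDerivAt_integral_ray hr hκ)
  have h1 := h0.const_mul (-2 * Real.pi * Complex.I : ℂ)
  have h2 := h1.cexp.const_mul (T.frame e a₀ (g v₀))
  have hself : ∫ t in (0 : ℝ)..1, κ (ray v₀ v₀ t) (deriv ρ t • (v₀ - v₀)) = 0 := by simp
  refine (h2.congr_of_eventuallyEq ?_).congr_fderiv ?_
  · filter_upwards [Metric.ball_mem_nhds v₀ hr] with v hv
    have hray (t : ℝ) : ray v₀ v t ∈ Metric.ball v₀ r :=
      Convex.ray_mem (convex_ball v₀ r) (Metric.mem_ball_self hr) hv t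
    have hrayc : ContDiff ℝ ∞ (ray v₀ v) :=
      contDiff_ray.comp (contDiff_const.prodMk (contDiff_const.prodMk contDiff_id))
    have h3 := T.toFun_mul_frame he hS ha₀ hΩ (δ := fun t ↦ g (ray v₀ v t))
      (fun t ↦ (hg _ (hray t)).comp t hrayc.contMDiff.contMDiffAt) (fun t ↦ hge _ (hray t))
    have h4 (t : ℝ) : pullbackForm α (e ∘ fun t ↦ g (ray v₀ v t)) t 1 =
        κ (ray v₀ v t) (deriv ρ t • (v - v₀)) := by
      have h5 : HasFDerivAt (e ∘ g) (fderiv ℝ (e ∘ g) (ray v₀ v t)) (ray v₀ v t) :=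
        ((heg _ (hray t)).differentiableAt (by simp)).hasFDerivAt
      have h6 := (HasFDerivAt.comp_hasDerivAt (l := e ∘ g) t h5 (hasDerivAt_ray v₀ v t))
      exact congrArg (α (e (g (ray v₀ v t)))) h6.deriv
    rw [intervalIntegral.integral_congr (g := fun t ↦ κ (ray v₀ v t) (deriv ρ t • (v - v₀)))
      fun t _ ↦ h4 t] at h3
    simp only [ray_zero, ray_one] at h3
    have h7 := T.ne_zero (fun t ↦ g (ray v₀ v t))
    rw [mul_inv_eq_iff_eq_mul₀ h7, mul_right_comm, mul_comm _ (T.toFun _), h3, mul_assoc,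
      ← Complex.exp_add]
    simp
  · rw [hself]
    ext v
    simp [κ, pullbackForm, mul_assoc]

end PathCharacter

end Square

end BohrSommerfeld

namespace BohrSommerfeld

/-! ### Derivatives read in charts, and charts onto balls. -/

section ChartDerivatives

open Set

variable {E : Type*} [NormedAddCommGroup E] [NormedSpace ℝ E]
  {X : Type*} [TopologicalSpace X] [ChartedSpace E X] [IsManifold 𝓘(ℝ, E) ∞ X]
  {E' : Type*} [NormedAddCommGroup E'] [NormedSpace ℝ E']
  {X' : Type*} [TopologicalSpace X'] [ChartedSpace E' X']
  {G : Type*} [NormedAddCommGroup G] [NormedSpace ℝ G] {e : OpenPartialHomeomorph X E}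

theorem mfderiv_comp_chart_symm (he : e ∈ IsManifold.maximalAtlas 𝓘(ℝ, E) ∞ X) {x : X}
    (hx : x ∈ e.source) {f : X → X'} (hf : MDifferentiableAt 𝓘(ℝ, E) 𝓘(ℝ, E') f x) (v : E) :
    (mfderiv 𝓘(ℝ, E) 𝓘(ℝ, E') (f ∘ e.symm) (e x) : E →L[ℝ] E')
      ((mfderiv 𝓘(ℝ, E) 𝓘(ℝ, E) e x : E →L[ℝ] E) v) =
        (mfderiv 𝓘(ℝ, E) 𝓘(ℝ, E') f x : E →L[ℝ] E') v := by
  have hxt : e x ∈ e.target := e.map_source hx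
  have hf' : MDifferentiableAt 𝓘(ℝ, E) 𝓘(ℝ, E') f (e.symm (e x)) := by rwa [e.left_inv hx]
  have h3 := congrArg (fun l : E →L[ℝ] E' ↦ l (mfderiv 𝓘(ℝ, E) 𝓘(ℝ, E) e x v))
    (mfderiv_comp (e x) hf' (mdifferentiableAt_chart_symm he hxt))
  refine h3.trans ((congrArg (mfderiv 𝓘(ℝ, E) 𝓘(ℝ, E') f (e.symm (e x)))
    (mfderiv_chart_symm_chart he hx v)).trans ?_)
  have : ∀ y : X, y = x → (mfderiv 𝓘(ℝ, E) 𝓘(ℝ, E') f y : E →L[ℝ] E') v =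
    (mfderiv 𝓘(ℝ, E) 𝓘(ℝ, E') f x : E →L[ℝ] E') v := by rintro _ rfl; rfl
  exact this _ (e.left_inv hx)

theorem hasMFDerivAt_of_chart (he : e ∈ IsManifold.maximalAtlas 𝓘(ℝ, E) ∞ X) {x : X}
    (hx : x ∈ e.source) {f : X → G} {f' : E →L[ℝ] G} (hf : HasFDerivAt (f ∘ e.symm) f' (e x)) :
    HasMFDerivAt 𝓘(ℝ, E) 𝓘(ℝ, G) f x
      (f'.comp (mfderiv 𝓘(ℝ, E) 𝓘(ℝ, E) e x : E →L[ℝ] E) : E →L[ℝ] G) := by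
  have h1 := hf.hasMFDerivAt.comp x (mdifferentiableAt_chart he hx).hasMFDerivAt
  refine h1.congr_of_eventuallyEq ?_
  filter_upwards [e.open_source.mem_nhds hx] with y hy
  simp [e.left_inv hy]

/-- A chart can be restricted so that its image becomes a ball. -/
theorem exists_chart_ball (he : e ∈ IsManifold.maximalAtlas 𝓘(ℝ, E) ∞ X) {x : X}
    (hx : x ∈ e.source) {O : Set E} (hO : O ∈ nhds (e x)) :
    ∃ e' ∈ IsManifold.maximalAtlas 𝓘(ℝ, E) ∞ X, x ∈ e'.source ∧ e'.source ⊆ e.source ∧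
      (∀ y, e' y = e y) ∧ (∀ u, e'.symm u = e.symm u) ∧ e'.target ⊆ O ∧
      ∃ r > 0, e'.target = Metric.ball (e x) r := by
  obtain ⟨r, hr, hrO⟩ := Metric.mem_nhds_iff.1
    (Filter.inter_mem hO (e.open_target.mem_nhds (e.map_source hx)))
  let s : Set X := e.source ∩ e ⁻¹' Metric.ball (e x) r
  have hs : IsOpen s := e.isOpen_inter_preimage Metric.isOpen_ball
  have ht : (e.restr s).target = Metric.ball (e x) r := by
    ext u
    rw [e.restr_target, hs.interior_eq]
    constructor
    · rintro ⟨h1, -, h2⟩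
      rwa [mem_preimage, e.right_inv h1] at h2
    · intro hu
      have h1 := (hrO hu).2
      exact ⟨h1, e.map_target h1, by rwa [mem_preimage, e.right_inv h1]⟩
  refine ⟨e.restr s, restr_mem_maximalAtlas _ he hs, ?_, ?_, fun _ ↦ rfl, fun _ ↦ rfl, ?_, r, hr, ht⟩
  · rw [e.restr_source, hs.interior_eq]
    exact ⟨hx, hx, Metric.mem_ball_self hr⟩
  · rw [e.restr_source]
    exact inter_subset_left
  · rw [ht]
    exact fun u hu ↦ (hrO hu).1

end ChartDerivatives

/-! ### The prequantum atlas of a path character. -/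

section AtlasOfCharacter

open Set

variable {E : Type*} [NormedAddCommGroup E] [NormedSpace ℝ E] [FiniteDimensional ℝ E]
  {X : Type*} [TopologicalSpace X] [ChartedSpace E X] [IsManifold 𝓘(ℝ, E) ∞ X]
  {Ω : TwoForm E X} {A : Set X} (T : PathCharacter Ω A)

variable (E X) in
/-- Charts around the points of a manifold with convex images. -/
theorem exists_convex_charts : ∃ e : X → OpenPartialHomeomorph X E,
    ∀ a, e a ∈ IsManifold.maximalAtlas 𝓘(ℝ, E) ∞ X ∧ a ∈ (e a).source ∧
      Convex ℝ (e a).target := by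
  have (a : X) := exists_chart_ball (IsManifold.chart_mem_maximalAtlas (I := 𝓘(ℝ, E)) (n := ∞) a)
    (mem_chart_source E a) Filter.univ_mem
  choose e he h1 _ _ _ _ r _ h2 using this
  exact ⟨e, fun a ↦ ⟨he a, h1 a, by rw [h2]; exact convex_ball _ _⟩⟩

namespace PathCharacter

/-- The connection form associated with the radial primitive of `Ω` in a chart. -/
def radialForm (Ω : TwoForm E X) (e : OpenPartialHomeomorph X E) (a₀ u : E) : E →L[ℝ] ℂ :=
  (-2 * Real.pi * Complex.I) • (Complex.ofRealCLM ∘L radialPrimitive (Ω.bilin e) a₀ u)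

variable {e : OpenPartialHomeomorph X E} {a₀ : E}

theorem contDiffOn_radialForm (he : e ∈ IsManifold.maximalAtlas 𝓘(ℝ, E) ∞ X)
    (hS : Convex ℝ e.target) (ha₀ : a₀ ∈ e.target) (hΩ : IsSymplectic Ω) :
    ContDiffOn ℝ ∞ (radialForm Ω e a₀) e.target :=
  ((ContinuousLinearMap.compL ℝ E ℝ ℂ Complex.ofRealCLM).contDiff.comp_contDiffOn
    (contDiffOn_radialPrimitive hS e.open_target ha₀ (hΩ.contDiffOn_bilin he))).const_smul
      (-2 * Real.pi * Complex.I : ℂ)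

theorem fderiv_radialForm (he : e ∈ IsManifold.maximalAtlas 𝓘(ℝ, E) ∞ X)
    (hS : Convex ℝ e.target) (ha₀ : a₀ ∈ e.target) (hΩ : IsSymplectic Ω) {u : E}
    (hu : u ∈ e.target) (v w : E) :
    fderiv ℝ (radialForm Ω e a₀) u v w - fderiv ℝ (radialForm Ω e a₀) u w v =
      -2 * Complex.I * Real.pi * (Ω.inChart e u ![v, w] : ℝ) := by
  have h1 := (((contDiffOn_radialPrimitive hS e.open_target ha₀
    (hΩ.contDiffOn_bilin he)).contDiffAt (e.open_target.mem_nhds hu)).differentiableAt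
      (by simp)).hasFDerivAt
  have h2 := (((ContinuousLinearMap.compL ℝ E ℝ ℂ Complex.ofRealCLM).hasFDerivAt
    (x := radialPrimitive (Ω.bilin e) a₀ u)).comp u h1).const_smul (-2 * Real.pi * Complex.I : ℂ)
  have h3 : fderiv ℝ (radialForm Ω e a₀) u = _ := h2.fderiv
  have h4 := fderiv_radialPrimitive hS e.open_target ha₀ (hΩ.contDiffOn_bilin he)
    (fun u _ x y ↦ Ω.bilin_swap u x y) (fun u hu x y z ↦ hΩ.bilin_closed he hu x y z) hu v w
  rw [h3, ← Ω.bilin_apply, ← h4]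
  simp only [smul_apply, ContinuousLinearMap.comp_apply,
    ContinuousLinearMap.compL_apply, Complex.ofRealCLM_apply, smul_eq_mul]
  push_cast
  ring

/-- Both frames are corrected by the character on the same rays of the chart `e` centred at `e x`;
in the quotient the corrections cancel, and at the centre they are 1. -/
theorem hasMFDerivAt_frame_div (hΩ : IsSymplectic Ω) {e' : OpenPartialHomeomorph X E} {b₀ : E}
    (he : e ∈ IsManifold.maximalAtlas 𝓘(ℝ, E) ∞ X) (hS : Convex ℝ e.target) (ha₀ : a₀ ∈ e.target)
    (he' : e' ∈ IsManifold.maximalAtlas 𝓘(ℝ, E) ∞ X) (hS' : Convex ℝ e'.target)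
    (hb₀ : b₀ ∈ e'.target) {x : X} (hx : x ∈ e.source) (hx' : x ∈ e'.source) :
    HasMFDerivAt 𝓘(ℝ, E) 𝓘(ℝ, ℂ) (fun y ↦ T.frame e a₀ y / T.frame e' b₀ y) x
      ((T.frame e a₀ x / T.frame e' b₀ x) •
        ((radialForm Ω e a₀ (e x)).comp (mfderiv 𝓘(ℝ, E) 𝓘(ℝ, E) e x) -
          (radialForm Ω e' b₀ (e' x)).comp (mfderiv 𝓘(ℝ, E) 𝓘(ℝ, E) e' x) : E →L[ℝ] ℂ)) := by
  have hxt := e.map_source hx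
  obtain ⟨r, hr, hrs⟩ := Metric.mem_nhds_iff.1 (Filter.inter_mem (e.open_target.mem_nhds hxt)
    ((e.symm.continuousAt hxt).preimage_mem_nhds (e'.open_source.mem_nhds
      (show e.symm (e x) ∈ e'.source by rwa [e.left_inv hx]))))
  have hg (v : E) (hv : v ∈ Metric.ball (e x) r) :=
    contMDiffAt_chart_symm he (hrs hv).1
  have h1 := T.hasFDerivAt_frame_mul he hS ha₀ hΩ hr hg fun v hv ↦ e.map_target (hrs hv).1
  have h2 := T.hasFDerivAt_frame_mul he' hS' hb₀ hΩ hr hg fun v hv ↦ (hrs hv).2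
  have hne (v : E) := T.ne_zero fun t ↦ e.symm (ray (e x) v t)
  have hconst : T.toFun (fun t ↦ e.symm (ray (e x) (e x) t)) = 1 := by
    have : (fun t ↦ e.symm (ray (e x) (e x) t)) = fun _ ↦ x := by
      ext t
      simp [ray, e.left_inv hx]
    rw [this, T.toFun_const]
  have h3 := hasFDerivAt_div h1 h2 (mul_ne_zero (T.ne_zero _) (inv_ne_zero (hne _)))
  have h4 : HasFDerivAt ((fun y ↦ T.frame e a₀ y / T.frame e' b₀ y) ∘ e.symm) _ (e x) :=
    h3.congr_of_eventuallyEq (.of_forall fun v ↦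
      (mul_div_mul_right _ _ (inv_ne_zero (hne v))).symm)
  refine (hasMFDerivAt_of_chart he hx h4).congr_mfderiv ?_
  have hne' : T.frame e' b₀ x ≠ 0 := T.ne_zero _
  ext v
  have hp (f : OpenPartialHomeomorph X E) (hf : f ∈ IsManifold.maximalAtlas 𝓘(ℝ, E) ∞ X)
      (hxf : x ∈ f.source) (c₀ : E) :
      pullbackForm (radialForm Ω f c₀) (f ∘ e.symm) (e x)
        ((mfderiv 𝓘(ℝ, E) 𝓘(ℝ, E) e x : E →L[ℝ] E) v) =
      radialForm Ω f c₀ (f x) ((mfderiv 𝓘(ℝ, E) 𝓘(ℝ, E) f x : E →L[ℝ] E) v) := by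
    have h5 := mfderiv_comp_chart_symm he hx (mdifferentiableAt_chart hf hxf) v
    rw [mfderiv_eq_fderiv] at h5
    have h6 : (f ∘ e.symm) (e x) = f x := by simp [e.left_inv hx]
    change radialForm Ω f c₀ ((f ∘ e.symm) (e x)) _ = _
    rw [h6]
    exact congrArg (radialForm Ω f c₀ (f x)) h5
  simp only [hconst, e.left_inv hx, inv_one, mul_one]
  change (T.frame e' b₀ x)⁻¹ • (T.frame e a₀ x • pullbackForm (radialForm Ω e a₀) (e ∘ e.symm) (e x)
      ((mfderiv 𝓘(ℝ, E) 𝓘(ℝ, E) e x : E →L[ℝ] E) v)) -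
    (T.frame e a₀ x / T.frame e' b₀ x ^ 2) • (T.frame e' b₀ x •
      pullbackForm (radialForm Ω e' b₀) (e' ∘ e.symm) (e x)
        ((mfderiv 𝓘(ℝ, E) 𝓘(ℝ, E) e x : E →L[ℝ] E) v)) =
    (T.frame e a₀ x / T.frame e' b₀ x) •
      (radialForm Ω e a₀ (e x) ((mfderiv 𝓘(ℝ, E) 𝓘(ℝ, E) e x : E →L[ℝ] E) v) -
        radialForm Ω e' b₀ (e' x) ((mfderiv 𝓘(ℝ, E) 𝓘(ℝ, E) e' x : E →L[ℝ] E) v))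
  rw [hp e he hx, hp e' he' hx']
  simp only [smul_eq_mul]
  field_simp

/-- The local frames and connection forms given by a path character. -/
def atlas (hΩ : IsSymplectic Ω) : PrequantumAtlas Ω where
  chart := (exists_convex_charts E X).choose
  chart_mem a := ((exists_convex_charts E X).choose_spec a).1
  mem_source a := ((exists_convex_charts E X).choose_spec a).2.1
  c a := T.frame ((exists_convex_charts E X).choose a) ((exists_convex_charts E X).choose a a)
  c_ne_zero _ _ := T.ne_zero _
  θ a := radialForm Ω ((exists_convex_charts E X).choose a) ((exists_convex_charts E X).choose a a)
  contDiffOn_θ a :=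
    have h := (exists_convex_charts E X).choose_spec a
    contDiffOn_radialForm h.1 h.2.2 (OpenPartialHomeomorph.map_source _ h.2.1) hΩ
  curvature a _ hu v w :=
    have h := (exists_convex_charts E X).choose_spec a
    fderiv_radialForm h.1 h.2.2 (OpenPartialHomeomorph.map_source _ h.2.1) hΩ hu v w
  compat a b _ hx hx' :=
    have h := (exists_convex_charts E X).choose_spec a
    have h' := (exists_convex_charts E X).choose_spec b
    T.hasMFDerivAt_frame_div hΩ h.1 h.2.2 (OpenPartialHomeomorph.map_source _ h.2.1) h'.1 h'.2.2
      (OpenPartialHomeomorph.map_source _ h'.2.1) hx hx'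

/-- The character is unitary and the connection forms are imaginary, so both sides are zero. -/
theorem isHermitian_atlas (hΩ : IsSymplectic Ω) : (T.atlas hΩ).IsHermitian := by
  intro a x hx
  have h1 : (fun y ↦ Complex.normSq ((T.atlas hΩ).c a y)) = fun _ ↦ 1 :=
    funext fun y ↦ T.normSq_eq_one _
  rw [h1]
  refine (hasMFDerivAt_const (1 : ℝ) x).congr_mfderiv ?_
  ext v
  have h2 : ((T.atlas hΩ).form a x v).re = 0 := by
    change ((-2 * Real.pi * Complex.I : ℂ) • ((_ : ℝ) : ℂ)).re = 0
    simp
  change (0 : ℝ) = (2 * Complex.normSq ((T.atlas hΩ).c a x)) • ((T.atlas hΩ).form a x v).re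
  rw [h2, smul_zero]

/-- The rays in a chart of `Q` are mapped by `ι` to paths in the submanifold, on which the character
is 1; so the correction factor disappears and `c a ∘ ι` itself is differentiable. -/
theorem isFlatAlong_atlas {F : Type*} [NormedAddCommGroup F] [NormedSpace ℝ F]
    {Q : Type*} [TopologicalSpace Q] [ChartedSpace F Q] [IsManifold 𝓘(ℝ, F) ∞ Q] {ι : Q → X}
    (T : PathCharacter Ω (range ι)) (hΩ : IsSymplectic Ω)
    (hι : ContMDiff 𝓘(ℝ, F) 𝓘(ℝ, E) ∞ ι) : (T.atlas hΩ).IsFlatAlong (F := F) ι := by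
  intro a q hq
  obtain ⟨h1, h2, h3⟩ := (exists_convex_charts E X).choose_spec a
  set P := T.atlas hΩ
  have he := IsManifold.chart_mem_maximalAtlas (I := 𝓘(ℝ, F)) (n := ∞) q
  set e := chartAt F q
  have hqe : q ∈ e.source := mem_chart_source F q
  have hqt := e.map_source hqe
  have hgq : ContMDiffAt 𝓘(ℝ, F) 𝓘(ℝ, E) ∞ (ι ∘ e.symm) (e q) :=
    (hι _).comp _ (contMDiffAt_chart_symm he hqt)
  have hgm : (ι ∘ e.symm) (e q) ∈ (P.chart a).source := by
    simpa [e.left_inv hqe] using hq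
  obtain ⟨r, hr, hrs⟩ := Metric.mem_nhds_iff.1 (Filter.inter_mem (e.open_target.mem_nhds hqt)
    (hgq.continuousAt.preimage_mem_nhds ((P.chart a).open_source.mem_nhds hgm)))
  have hg (v : F) (hv : v ∈ Metric.ball (e q) r) :
      ContMDiffAt 𝓘(ℝ, F) 𝓘(ℝ, E) ∞ (ι ∘ e.symm) v :=
    (hι _).comp _ (contMDiffAt_chart_symm he (hrs hv).1)
  have h4 := T.hasFDerivAt_frame_mul h1 h3 (OpenPartialHomeomorph.map_source _ h2) hΩ hr hg
    fun v hv ↦ (hrs hv).2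
  have h5 : HasFDerivAt ((fun q ↦ P.c a (ι q)) ∘ e.symm)
      (P.c a ((ι ∘ e.symm) (e q)) •
        pullbackForm (P.θ a) (P.chart a ∘ ι ∘ e.symm) (e q)) (e q) := by
    refine h4.congr_of_eventuallyEq ?_
    filter_upwards [Metric.ball_mem_nhds _ hr] with v hv
    have hray : ContDiff ℝ ∞ (ray (e q) v) :=
      contDiff_ray.comp (contDiff_const.prodMk (contDiff_const.prodMk contDiff_id))
    rw [T.eq_one_of_mem (fun t ↦ (ι ∘ e.symm) (ray (e q) v t)) (fun t ↦
      ContMDiffAt.comp (f := ray (e q) v) (g := ι ∘ e.symm) t (hg _ (Convex.ray_mem (convex_ball _ _)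
      (Metric.mem_ball_self hr) hv t)) hray.contMDiff.contMDiffAt)
        fun t ↦ ⟨_, rfl⟩, inv_one, mul_one]
    rfl
  refine (hasMFDerivAt_of_chart he hqe h5).congr_mfderiv ?_
  ext v
  have h6 := P.form_comp_mfderiv (hgq.mdifferentiableAt (by simp)) hgm
  have h7 := mfderiv_comp_chart_symm he hqe ((hι q).mdifferentiableAt (by simp)) v
  have h8 : (ι ∘ e.symm) (e q) = ι q := by simp [e.left_inv hqe]
  change P.c a ((ι ∘ e.symm) (e q)) • pullbackForm (P.θ a) (P.chart a ∘ ι ∘ e.symm) (e q)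
    ((mfderiv 𝓘(ℝ, F) 𝓘(ℝ, F) e q : F →L[ℝ] F) v) = P.c a (ι q) • P.form a (ι q)
      ((mfderiv 𝓘(ℝ, F) 𝓘(ℝ, E) ι q : F →L[ℝ] E) v)
  rw [← h6, h8, ← h7]
  rfl

end PathCharacter

/-- Integral relative periods give local frames of a Hermitian bundle that is flat and trivial
along the submanifold. -/
theorem exists_prequantumAtlas {F : Type*} [NormedAddCommGroup F] [NormedSpace ℝ F]
    {Q : Type*} [TopologicalSpace Q] [ChartedSpace F Q] [IsManifold 𝓘(ℝ, F) ∞ Q] {ι : Q → X}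
    (hΩ : IsSymplectic Ω) (hι : ContMDiff 𝓘(ℝ, F) 𝓘(ℝ, E) ∞ ι)
    (h : HasIntegralRelativePeriods Ω (range ι)) :
    ∃ P : PrequantumAtlas Ω, P.IsHermitian ∧ P.IsFlatAlong (F := F) ι := by
  obtain ⟨T⟩ := exists_pathCharacter h
  exact ⟨T.atlas hΩ, T.isHermitian_atlas hΩ, T.isFlatAlong_atlas hΩ hι⟩

end AtlasOfCharacter

end BohrSommerfeld

namespace BohrSommerfeld

/-! ### The line bundle and the connection of an atlas. -/

section BundleOfAtlas

open Set

variable {E : Type*} [NormedAddCommGroup E] [NormedSpace ℝ E]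
  {X : Type*} [TopologicalSpace X] [ChartedSpace E X] [IsManifold 𝓘(ℝ, E) ∞ X]
  {G : Type*} [NormedAddCommGroup G] [NormedSpace ℝ G]

/-- The differential of a vector valued function on a manifold, as a linear map on the model
space. -/
def diff (f : X → G) (x : X) : E →L[ℝ] G := mfderiv 𝓘(ℝ, E) 𝓘(ℝ, G) f x

theorem diff_eq {f : X → G} {x : X} {f' : E →L[ℝ] G}
    (h : HasMFDerivAt 𝓘(ℝ, E) 𝓘(ℝ, G) f x f') : diff f x = f' :=
  h.mfderiv

theorem hasMFDerivAt_diff {f : X → G} {x : X} (h : MDifferentiableAt 𝓘(ℝ, E) 𝓘(ℝ, G) f x) :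
    HasMFDerivAt 𝓘(ℝ, E) 𝓘(ℝ, G) f x (diff f x : E →L[ℝ] G) :=
  h.hasMFDerivAt

theorem contMDiffAt_of_chart {e : OpenPartialHomeomorph X E}
    (he : e ∈ IsManifold.maximalAtlas 𝓘(ℝ, E) ∞ X) {x : X} (hx : x ∈ e.source) {f : X → G}
    (hf : ContDiffAt ℝ ∞ (f ∘ e.symm) (e x)) : ContMDiffAt 𝓘(ℝ, E) 𝓘(ℝ, G) ∞ f x := by
  have h1 := hf.contMDiffAt.comp x (contMDiffAt_chart he hx)
  refine h1.congr_of_eventuallyEq ?_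
  filter_upwards [e.open_source.mem_nhds hx] with y hy
  simp [e.left_inv hy]

theorem contDiffAt_comp_chart_symm {e : OpenPartialHomeomorph X E}
    (he : e ∈ IsManifold.maximalAtlas 𝓘(ℝ, E) ∞ X) {u : E} (hu : u ∈ e.target) {f : X → G}
    (hf : ContMDiffAt 𝓘(ℝ, E) 𝓘(ℝ, G) ∞ f (e.symm u)) : ContDiffAt ℝ ∞ (f ∘ e.symm) u :=
  (hf.comp u (contMDiffAt_chart_symm he hu)).contDiffAt

theorem fderiv_comp_chart_symm {e : OpenPartialHomeomorph X E}
    (he : e ∈ IsManifold.maximalAtlas 𝓘(ℝ, E) ∞ X) {x : X} (hx : x ∈ e.source) {f : X → G}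
    (hf : MDifferentiableAt 𝓘(ℝ, E) 𝓘(ℝ, G) f x) (v : E) :
    fderiv ℝ (f ∘ e.symm) (e x) ((mfderiv 𝓘(ℝ, E) 𝓘(ℝ, E) e x : E →L[ℝ] E) v) = diff f x v := by
  have h := mfderiv_comp_chart_symm he hx hf v
  rw [mfderiv_eq_fderiv] at h
  exact h

namespace PrequantumAtlas

variable {Ω : TwoForm E X} (P : PrequantumAtlas Ω)

/-- In a chart the quotient has a smooth logarithmic derivative, so smoothness bootstraps from
differentiability. -/
theorem contMDiffAt_c_div {a b x : X} (ha : x ∈ (P.chart a).source) (hb : x ∈ (P.chart b).source) :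
    ContMDiffAt 𝓘(ℝ, E) 𝓘(ℝ, ℂ) ∞ (fun x ↦ P.c a x / P.c b x) x := by
  set e := P.chart a
  have he := P.chart_mem a
  have hU : IsOpen (e.target ∩ e.symm ⁻¹' (P.chart b).source) :=
    e.symm.isOpen_inter_preimage (P.chart b).open_source
  have hs (u : E) (hu : u ∈ e.target) := contMDiffAt_chart_symm he hu
  have h := contDiffOn_of_hasFDerivAt_smul (g := fun u ↦ P.c a (e.symm u) / P.c b (e.symm u))
    (κ := fun u ↦ pullbackForm (P.θ a) (P.chart a ∘ e.symm) u -
      pullbackForm (P.θ b) (P.chart b ∘ e.symm) u) hU (fun u hu ↦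
        ((P.contDiffAt_pullback (hs u hu.1) (e.map_target hu.1)).sub
          (P.contDiffAt_pullback (hs u hu.1) hu.2)).contDiffWithinAt)
      (fun u hu ↦ P.hasFDerivAt_c_div_c ((hs u hu.1).mdifferentiableAt (by simp))
        (e.map_target hu.1) hu.2)
  refine contMDiffAt_of_chart he ha (h.contDiffAt (hU.mem_nhds ⟨e.map_source ha, ?_⟩))
  rwa [mem_preimage, e.left_inv ha]

/-- The vector bundle with transition functions `c i / c j`. -/
def core : VectorBundleCore ℝ X ℂ X where
  baseSet i := (P.chart i).source
  isOpen_baseSet i := (P.chart i).open_source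
  -- The fibre over `x` is read in the frame labelled by `x` itself. This is the origin of the
  -- factors `P.c x x` in the coefficients, the metric and the derivative.
  indexAt x := x
  mem_baseSet_at x := P.mem_source x
  coordChange i j x := ContinuousLinearMap.mul ℝ ℂ (P.c i x / P.c j x)
  coordChange_self i x _ v := by simp [div_self (P.c_ne_zero i x)]
  continuousOn_coordChange i j :=
    (ContinuousLinearMap.mul ℝ ℂ).continuous.comp_continuousOn fun _ hx ↦
      (P.contMDiffAt_c_div hx.1 hx.2).continuousAt.continuousWithinAt
  coordChange_comp i j k x _ v := by
    have := P.c_ne_zero j x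
    have := P.c_ne_zero k x
    simp only [ContinuousLinearMap.mul_apply']
    field_simp

instance : P.core.IsContMDiff 𝓘(ℝ, E) ∞ where
  contMDiffOn_coordChange _ _ :=
    ((ContinuousLinearMap.mul ℝ ℂ).contMDiff (n := ∞)).comp_contMDiffOn fun _ hx ↦
      (P.contMDiffAt_c_div hx.1 hx.2).contMDiffWithinAt

instance (x : X) : Module ℂ (P.core.Fiber x) := inferInstanceAs (Module ℂ ℂ)

/-- The line bundle defined by local frames. -/
def lineBundle : LineBundle E X where
  Fiber := P.core.Fiber
  isTopologicalAddGroup x := inferInstanceAs (IsTopologicalAddGroup ℂ)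
  continuousSMul x := inferInstanceAs (ContinuousSMul ℝ ℂ)
  vectorBundle := P.core.vectorBundle
  contMDiffVectorBundle := VectorBundleCore.instContMDiffVectorBundle P.core
  complex_linear := by
    rintro _ ⟨i, rfl⟩ x hx a v
    have (z w v : ℂ) : z * (w * v) = w * (z * v) := by ring
    exact this (P.c x x / P.c i x) a v

/-- The local trivialization in which the frame `c i` is constant. -/
def triv (i : X) : Trivialization ℂ (π ℂ P.lineBundle.Fiber) := P.core.localTriv i

instance (i : X) : MemTrivializationAtlas (P.triv i) := ⟨i, rfl⟩

/-- The coefficient of a section with respect to a local frame. -/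
def coef (i : X) (σ : X → ℂ) (x : X) : ℂ := P.c x x / P.c i x * σ x

theorem coef_self (x : X) (σ : X → ℂ) : P.coef x σ x = σ x := by
  simp [coef, div_self (P.c_ne_zero x x)]

theorem coef_eq (i j : X) (σ : X → ℂ) (x : X) :
    P.coef j σ x = P.c i x / P.c j x * P.coef i σ x := by
  have := P.c_ne_zero i x
  have := P.c_ne_zero j x
  simp only [coef]
  field_simp

theorem mdifferentiableAt_section_iff {i x : X} (hx : x ∈ (P.chart i).source)
    (σ : (x : X) → P.lineBundle.Fiber x) :
    P.lineBundle.DifferentiableSectionAt σ x ↔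
      MDifferentiableAt 𝓘(ℝ, E) 𝓘(ℝ, ℂ) (P.coef i σ) x :=
  haveI : ContMDiffVectorBundle 1 ℂ P.lineBundle.Fiber 𝓘(ℝ, E) := .of_le (n := ∞) (by simp)
  (P.triv i).mdifferentiableAt_section_iff 𝓘(ℝ, E) σ hx

theorem contMDiffAt_section_iff {i x : X} (hx : x ∈ (P.chart i).source)
    (σ : (x : X) → P.lineBundle.Fiber x) :
    ContMDiffAt 𝓘(ℝ, E) (𝓘(ℝ, E).prod 𝓘(ℝ, ℂ)) ∞ (fun x ↦ TotalSpace.mk' ℂ x (σ x)) x ↔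
      ContMDiffAt 𝓘(ℝ, E) 𝓘(ℝ, ℂ) ∞ (P.coef i σ) x :=
  (P.triv i).contMDiffAt_section_iff (s := σ) (n := ∞) (IB := 𝓘(ℝ, E)) hx

/-- The covariant derivative whose connection forms are those of the atlas. -/
def deriv (σ : X → ℂ) (x : X) : E →L[ℝ] ℂ := diff (P.coef x σ) x + σ x • P.form x x

/-- The definition uses the frame labelled by the point. The transition rule for the connection
forms shows that any other frame gives the same vector, the factor converting its coordinate to the
one at `x`. -/
theorem deriv_eq {i x : X} {σ : X → ℂ} {f' : E →L[ℝ] ℂ} (hx : x ∈ (P.chart i).source)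
    (h : HasMFDerivAt 𝓘(ℝ, E) 𝓘(ℝ, ℂ) (P.coef i σ) x f') :
    P.deriv σ x = (P.c i x / P.c x x) • (f' + P.coef i σ x • P.form i x) := by
  have h1 := (P.compat i x x hx (P.mem_source x)).mul h
  have h2 : HasMFDerivAt 𝓘(ℝ, E) 𝓘(ℝ, ℂ) (P.coef x σ) x
      ((P.c i x / P.c x x) • f' + P.coef i σ x • (P.c i x / P.c x x) •
        (P.form i x - P.form x x) : E →L[ℝ] ℂ) :=
    h1.congr_of_eventuallyEq (.of_forall fun y ↦ P.coef_eq i x σ y)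
  rw [deriv, diff_eq h2]
  have h3 : σ x = P.c i x / P.c x x * P.coef i σ x := by rw [← P.coef_eq, P.coef_self]
  rw [h3]
  ext v
  simp only [add_apply, smul_apply, sub_apply, smul_eq_mul]
  ring

theorem deriv_add {x : X} {σ τ : X → ℂ}
    (hσ : MDifferentiableAt 𝓘(ℝ, E) 𝓘(ℝ, ℂ) (P.coef x σ) x)
    (hτ : MDifferentiableAt 𝓘(ℝ, E) 𝓘(ℝ, ℂ) (P.coef x τ) x) :
    P.deriv (σ + τ) x = P.deriv σ x + P.deriv τ x := by
  have h : HasMFDerivAt 𝓘(ℝ, E) 𝓘(ℝ, ℂ) (P.coef x (σ + τ)) x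
      (diff (P.coef x σ) x + diff (P.coef x τ) x : E →L[ℝ] ℂ) :=
    ((hasMFDerivAt_diff hσ).add (hasMFDerivAt_diff hτ)).congr_of_eventuallyEq
      (.of_forall fun y ↦ by simp [coef, mul_add])
  rw [deriv, diff_eq h, deriv, deriv, Pi.add_apply, add_smul]
  abel

theorem deriv_mul {x : X} {σ : X → ℂ} {g : X → ℂ}
    (hσ : MDifferentiableAt 𝓘(ℝ, E) 𝓘(ℝ, ℂ) (P.coef x σ) x)
    (hg : MDifferentiableAt 𝓘(ℝ, E) 𝓘(ℝ, ℂ) g x) :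
    P.deriv (g * σ) x = g x • P.deriv σ x + σ x • diff g x := by
  have h : HasMFDerivAt 𝓘(ℝ, E) 𝓘(ℝ, ℂ) (P.coef x (g * σ)) x
      (g x • diff (P.coef x σ) x + P.coef x σ x • diff g x : E →L[ℝ] ℂ) :=
    ((hasMFDerivAt_diff hg).mul (hasMFDerivAt_diff hσ)).congr_of_eventuallyEq
      (.of_forall fun y ↦ by simp only [coef, Pi.mul_apply]; ring)
  rw [deriv, diff_eq h, deriv, coef_self, Pi.mul_apply]
  ext v
  simp only [add_apply, smul_apply, smul_eq_mul]
  ring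

theorem _root_.BohrSommerfeld.hasMFDerivAt_ofReal {g : X → ℝ} {x : X} (hg : MDifferentiableAt 𝓘(ℝ, E) 𝓘(ℝ, ℝ) g x) :
    HasMFDerivAt 𝓘(ℝ, E) 𝓘(ℝ, ℂ) (fun y ↦ (g y : ℂ)) x
      (Complex.ofRealCLM.comp (diff g x) : E →L[ℝ] ℂ) :=
  (Complex.ofRealCLM.hasFDerivAt (x := g x)).hasMFDerivAt.comp x (hasMFDerivAt_diff hg)

theorem deriv_smul {x : X} {σ : X → ℂ} {g : X → ℝ}
    (hσ : MDifferentiableAt 𝓘(ℝ, E) 𝓘(ℝ, ℂ) (P.coef x σ) x)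
    (hg : MDifferentiableAt 𝓘(ℝ, E) 𝓘(ℝ, ℝ) g x) :
    P.deriv (g • σ) x = g x • P.deriv σ x + (diff g x).smulRight (σ x) := by
  have hg' := hasMFDerivAt_ofReal hg
  have h2 : (g • σ : X → ℂ) = (fun y ↦ (g y : ℂ)) * σ := funext fun y ↦ Complex.real_smul
  rw [h2, P.deriv_mul hσ hg'.mdifferentiableAt, diff_eq hg']
  ext v
  simp only [add_apply, smul_apply, ContinuousLinearMap.comp_apply, Complex.ofRealCLM_apply,
    ContinuousLinearMap.smulRight_apply, Complex.real_smul, smul_eq_mul]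
  ring

/-- The connection defined by the connection forms of an atlas. -/
def connection : P.lineBundle.Connection where
  toFun σ x := P.deriv σ x
  isCovariantDerivativeOnUniv :=
    { add := by
        intro σ τ x hσ hτ _
        exact P.deriv_add ((P.mdifferentiableAt_section_iff (P.mem_source x) σ).1 hσ)
          ((P.mdifferentiableAt_section_iff (P.mem_source x) τ).1 hτ)
      leibniz := by
        intro σ g x hσ hg _
        exact P.deriv_smul ((P.mdifferentiableAt_section_iff (P.mem_source x) σ).1 hσ) hg }

end PrequantumAtlas

end BundleOfAtlas

end BohrSommerfeld

namespace BohrSommerfeld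

/-! ### The Hermitian metric, and smoothness and unitarity of the connection. -/

section UnitaryConnection

open Set

variable {E : Type*} [NormedAddCommGroup E] [NormedSpace ℝ E]
  {X : Type*} [TopologicalSpace X] [ChartedSpace E X] [IsManifold 𝓘(ℝ, E) ∞ X]

namespace PrequantumAtlas

variable {Ω : TwoForm E X} {P : PrequantumAtlas Ω}

theorem IsHermitian.hasMFDerivAt_normSq (hP : P.IsHermitian) {i x : X}
    (hx : x ∈ (P.chart i).source) :
    HasMFDerivAt 𝓘(ℝ, E) 𝓘(ℝ, ℂ) (fun y ↦ (Complex.normSq (P.c i y) : ℂ)) x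
      ((Complex.normSq (P.c i x) : ℂ) •
        (P.form i x + Complex.conjCLE.toContinuousLinearMap.comp (P.form i x)) : E →L[ℝ] ℂ) := by
  have h := hasMFDerivAt_ofReal (hP i x hx).mdifferentiableAt
  rw [diff_eq (hP i x hx)] at h
  refine h.congr_mfderiv ?_
  ext v
  have : P.form i x v + (starRingEnd ℂ) (P.form i x v) = ((2 * (P.form i x v).re : ℝ) : ℂ) :=
    Complex.add_conj _
  change (((2 * Complex.normSq (P.c i x)) * (P.form i x v).re : ℝ) : ℂ) =
    (Complex.normSq (P.c i x) : ℂ) * (P.form i x v + (starRingEnd ℂ) (P.form i x v))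
  rw [this]
  push_cast
  ring

/-- The logarithmic derivative is the connection form plus its conjugate, which is smooth, so the
bootstrap applies. -/
theorem IsHermitian.contMDiffAt_normSq (hP : P.IsHermitian) {i x : X}
    (hx : x ∈ (P.chart i).source) :
    ContMDiffAt 𝓘(ℝ, E) 𝓘(ℝ, ℂ) ∞ (fun y ↦ (Complex.normSq (P.c i y) : ℂ)) x := by
  set e := P.chart i
  have he := P.chart_mem i
  have hs (u : E) (hu : u ∈ e.target) := contMDiffAt_chart_symm he hu
  have hpb (u : E) (hu : u ∈ e.target) :
      ContDiffAt ℝ ∞ (pullbackForm (P.θ i) (P.chart i ∘ e.symm)) u :=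
    P.contDiffAt_pullback (hs u hu) (e.map_target hu)
  have h := contDiffOn_of_hasFDerivAt_smul (g := fun u ↦ (Complex.normSq (P.c i (e.symm u)) : ℂ))
    (κ := fun u ↦ pullbackForm (P.θ i) (P.chart i ∘ e.symm) u +
      Complex.conjCLE.toContinuousLinearMap.comp (pullbackForm (P.θ i) (P.chart i ∘ e.symm) u))
    e.open_target (fun u hu ↦ ((hpb u hu).add
      (contDiffAt_const.clm_comp (hpb u hu))).contDiffWithinAt) (fun u hu ↦ by
        have h1 := (hP.hasMFDerivAt_normSq (e.map_target hu)).comp u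
          ((hs u hu).mdifferentiableAt (by simp)).hasMFDerivAt
        rw [← P.form_comp_mfderiv ((hs u hu).mdifferentiableAt (by simp)) (e.map_target hu)]
        exact h1.hasFDerivAt)
  exact contMDiffAt_of_chart he hx (h.contDiffAt (e.open_target.mem_nhds (e.map_source hx)))

variable (P) in
/-- The Hermitian form for which the global frame has norm one. -/
def inner (x : X) : ℂ →ₗ⋆[ℂ] ℂ →ₗ[ℂ] ℂ :=
  LinearMap.mk₂'ₛₗ (starRingEnd ℂ) (RingHom.id ℂ)
    (fun u v ↦ starRingEnd ℂ (P.c x x * u) * (P.c x x * v))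
    (fun u u' v ↦ by simp only [mul_add, map_add, add_mul])
    (fun c u v ↦ by simp only [map_mul, smul_eq_mul]; ring)
    (fun u v v' ↦ by simp only [mul_add])
    (fun c u v ↦ by simp only [RingHom.id_apply, smul_eq_mul]; ring)

theorem inner_apply (x : X) (u v : ℂ) :
    P.inner x u v = starRingEnd ℂ (P.c x x * u) * (P.c x x * v) := rfl

theorem inner_eq (i x : X) (σ τ : X → ℂ) : P.inner x (σ x) (τ x) =
    Complex.normSq (P.c i x) * (starRingEnd ℂ (P.coef i σ x) * P.coef i τ x) := by
  have hi := P.c_ne_zero i x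
  have h (σ : X → ℂ) : P.c x x * σ x = P.c i x * P.coef i σ x := by
    simp only [coef]
    field_simp
  rw [inner_apply, h, h, map_mul, Complex.normSq_eq_conj_mul_self]
  ring

theorem contMDiffAt_conj {f : X → ℂ} {x : X} (hf : ContMDiffAt 𝓘(ℝ, E) 𝓘(ℝ, ℂ) ∞ f x) :
    ContMDiffAt 𝓘(ℝ, E) 𝓘(ℝ, ℂ) ∞ (fun y ↦ starRingEnd ℂ (f y)) x :=
  Complex.conjCLE.toContinuousLinearMap.contDiff.contMDiff.contMDiffAt.comp x hf

theorem contMDiffAt_mul {f g : X → ℂ} {x : X} (hf : ContMDiffAt 𝓘(ℝ, E) 𝓘(ℝ, ℂ) ∞ f x)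
    (hg : ContMDiffAt 𝓘(ℝ, E) 𝓘(ℝ, ℂ) ∞ g x) :
    ContMDiffAt 𝓘(ℝ, E) 𝓘(ℝ, ℂ) ∞ (fun y ↦ f y * g y) x :=
  (contDiff_mul (𝕜 := ℝ) (𝔸 := ℂ)).contMDiff.contMDiffAt.comp x (hf.prodMk_space hg)

/-- The Hermitian metric of an atlas. -/
def metric (hP : P.IsHermitian) : P.lineBundle.HermitianMetric where
  inner x := P.inner x
  conj_symm x u v := by
    have (u v : ℂ) : starRingEnd ℂ (P.inner x u v) = P.inner x v u := by
      simp only [inner_apply, map_mul, Complex.conj_conj]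
      ring
    exact this u v
  pos x v hv := by
    have (v : ℂ) (hv : v ≠ 0) : 0 < (P.inner x v v).re := by
      rw [inner_apply, ← Complex.normSq_eq_conj_mul_self, Complex.ofReal_re, Complex.normSq_pos]
      exact mul_ne_zero (P.c_ne_zero x x) hv
    exact this v hv
  smooth σ τ hσ hτ x := by
    have h1 := (P.contMDiffAt_section_iff (P.mem_source x) σ).1 (hσ x)
    have h2 := (P.contMDiffAt_section_iff (P.mem_source x) τ).1 (hτ x)
    exact ((contMDiffAt_mul (hP.contMDiffAt_normSq (P.mem_source x))
      (contMDiffAt_mul (contMDiffAt_conj h1) h2))).congr_of_eventuallyEq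
        (.of_forall fun y ↦ inner_eq x y σ τ)

/-- In the frame labelled by `x` the metric has weight `|c x|²`. The derivative of the weight
supplies the connection form and its conjugate, which complete the derivatives of the two
coefficients to covariant ones. -/
theorem diff_inner (hP : P.IsHermitian) {x : X} {σ τ : X → ℂ}
    (hσ : MDifferentiableAt 𝓘(ℝ, E) 𝓘(ℝ, ℂ) (P.coef x σ) x)
    (hτ : MDifferentiableAt 𝓘(ℝ, E) 𝓘(ℝ, ℂ) (P.coef x τ) x) (v : E) :
    diff (fun y ↦ P.inner y (σ y) (τ y)) x v =
      P.inner x (P.deriv σ x v) (τ x) + P.inner x (σ x) (P.deriv τ x v) := by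
  have h0 : HasMFDerivAt 𝓘(ℝ, E) 𝓘(ℝ, ℂ) (fun y ↦ starRingEnd ℂ (P.coef x σ y)) x
      (Complex.conjCLE.toContinuousLinearMap.comp (diff (P.coef x σ) x) : E →L[ℝ] ℂ) :=
    (Complex.conjCLE.toContinuousLinearMap.hasFDerivAt (x := P.coef x σ x)).hasMFDerivAt.comp x
      (hasMFDerivAt_diff hσ)
  have h1 := (hP.hasMFDerivAt_normSq (P.mem_source x)).mul (h0.mul (hasMFDerivAt_diff hτ))
  have h2 : HasMFDerivAt 𝓘(ℝ, E) 𝓘(ℝ, ℂ) (fun y ↦ P.inner y (σ y) (τ y)) x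
      ((Complex.normSq (P.c x x) : ℂ) • ((starRingEnd ℂ) (P.coef x σ x) • diff (P.coef x τ) x +
        P.coef x τ x • Complex.conjCLE.toContinuousLinearMap.comp (diff (P.coef x σ) x)) +
      ((starRingEnd ℂ) (P.coef x σ x) * P.coef x τ x) • (Complex.normSq (P.c x x) : ℂ) •
        (P.form x x + Complex.conjCLE.toContinuousLinearMap.comp (P.form x x)) : E →L[ℝ] ℂ) :=
    h1.congr_of_eventuallyEq (.of_forall fun y ↦ inner_eq x y σ τ)
  rw [diff_eq h2, inner_apply, inner_apply]
  simp only [deriv, Complex.normSq_eq_conj_mul_self, add_apply, smul_apply,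
    ContinuousLinearMap.comp_apply, smul_eq_mul, map_mul, map_add, coef_self,
    ContinuousLinearEquiv.coe_coe, Complex.conjCLE_apply]
  ring

theorem deriv_const_mul {x : X} {σ : X → ℂ} (a : ℂ)
    (hσ : MDifferentiableAt 𝓘(ℝ, E) 𝓘(ℝ, ℂ) (P.coef x σ) x) :
    P.deriv (fun y ↦ a * σ y) x = a • P.deriv σ x := by
  have h := P.deriv_mul (g := fun _ ↦ a) hσ mdifferentiableAt_const
  rwa [show diff (fun _ : X ↦ a) x = 0 from diff_eq (hasMFDerivAt_const _ _), smul_zero,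
    add_zero] at h

/-- Smoothness of a section of a bundle of homomorphisms is tested in trivializations; there the
covariant derivative takes its familiar shape `df + f θ`, which is visibly smooth. -/
theorem inCoordinates_deriv {x₀ : X} {u : E} {σ : (x : X) → P.lineBundle.Fiber x}
    (hu : u ∈ (chartAt E x₀).target) (hx' : (chartAt E x₀).symm u ∈ (P.chart x₀).source)
    (hσ : MDifferentiableAt 𝓘(ℝ, E) 𝓘(ℝ, ℂ) (P.coef x₀ σ) ((chartAt E x₀).symm u)) :
    ContinuousLinearMap.inCoordinates E (TangentSpace 𝓘(ℝ, E) (M := X)) ℂ P.lineBundle.Fiber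
        x₀ ((chartAt E x₀).symm u) x₀ ((chartAt E x₀).symm u)
        (P.connection σ ((chartAt E x₀).symm u)) =
      fderiv ℝ (P.coef x₀ σ ∘ (chartAt E x₀).symm) u +
        P.coef x₀ σ ((chartAt E x₀).symm u) •
          pullbackForm (P.θ x₀) (P.chart x₀ ∘ (chartAt E x₀).symm) u := by
  have he := IsManifold.chart_mem_maximalAtlas (I := 𝓘(ℝ, E)) (n := ∞) x₀
  have hx : (chartAt E x₀).symm u ∈ (chartAt E x₀).source := (chartAt E x₀).map_target hu
  have hs := mdifferentiableAt_chart_symm he hu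
  have h1 := P.deriv_eq hx' (hasMFDerivAt_diff hσ)
  have h2 := TangentBundle.symmL_trivializationAt (I := 𝓘(ℝ, E)) hx
  rw [← P.form_comp_mfderiv hs hx']
  refine ContinuousLinearMap.ext fun v ↦ ?_
  have h3 : (trivializationAt E (TangentSpace 𝓘(ℝ, E)) x₀).symmL ℝ ((chartAt E x₀).symm u) v =
      mfderiv 𝓘(ℝ, E) 𝓘(ℝ, E) (chartAt E x₀).symm u v := by
    refine (congrArg (fun l : E →L[ℝ] E ↦ l v) h2).trans ?_
    simp only [mfld_simps, mfderivWithin_univ]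
    have (u' : E) (h : u' = u) : (mfderiv 𝓘(ℝ, E) 𝓘(ℝ, E) (chartAt E x₀).symm u' : E →L[ℝ] E) v =
      (mfderiv 𝓘(ℝ, E) 𝓘(ℝ, E) (chartAt E x₀).symm u : E →L[ℝ] E) v := by rw [h]
    exact this _ ((chartAt E x₀).right_inv hu)
  have h4 := P.core.trivializationAt_continuousLinearMapAt (b₀ := x₀) hx'
  refine (congrArg (fun l : ℂ →L[ℝ] ℂ ↦ l (P.deriv σ ((chartAt E x₀).symm u)
    ((trivializationAt E (TangentSpace 𝓘(ℝ, E)) x₀).symmL ℝ ((chartAt E x₀).symm u) v))) h4).trans ?_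
  rw [h3]
  have h5 := congrArg (fun l : E →L[ℝ] ℂ ↦ l v) (mfderiv_comp u hσ hs)
  rw [mfderiv_eq_fderiv] at h5
  rw [add_apply, show fderiv ℝ (P.coef x₀ σ ∘ (chartAt E x₀).symm) u v = _ from h5, h1]
  generalize (mfderiv 𝓘(ℝ, E) 𝓘(ℝ, E) (chartAt E x₀).symm u : E →L[ℝ] E) = l
  have hne := P.c_ne_zero ((chartAt E x₀).symm u) ((chartAt E x₀).symm u)
  have hne' := P.c_ne_zero x₀ ((chartAt E x₀).symm u)
  generalize (chartAt E x₀).symm u = y at *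
  have h6 (z : ℂ) : P.c y y / P.c x₀ y * (P.c x₀ y / P.c y y * z) = z := by field_simp
  exact h6 (diff (E := E) (P.coef x₀ σ) y (l v) + P.coef x₀ σ y * P.form x₀ y (l v))

theorem isUnitary_connection (hP : P.IsHermitian) :
    LineBundle.IsUnitary P.connection (metric hP) where
  smooth := ⟨⟨by
    intro σ hσ x₀ _
    apply ContMDiffAt.contMDiffWithinAt
    rw [contMDiffAt_hom_bundle]
    refine ⟨contMDiffAt_id, ?_⟩
    have he := IsManifold.chart_mem_maximalAtlas (I := 𝓘(ℝ, E)) (n := ∞) x₀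
    set e := chartAt E x₀
    have hx₀ : x₀ ∈ e.source := mem_chart_source E x₀
    have hxt := e.map_source hx₀
    have hS : (P.chart x₀).source ∈ nhds (e.symm (e x₀)) := by
      rw [e.left_inv hx₀]
      exact (P.chart x₀).open_source.mem_nhds (P.mem_source x₀)
    have hσ' (y : X) (hy : y ∈ (P.chart x₀).source) :
        ContMDiffAt 𝓘(ℝ, E) 𝓘(ℝ, ℂ) ∞ (P.coef x₀ σ) y :=
      (P.contMDiffAt_section_iff hy σ).1
        (((hσ y (mem_univ y)).contMDiffAt Filter.univ_mem).of_le (by simp))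
    have h1 : ContDiffAt ℝ ∞ (P.coef x₀ σ ∘ e.symm) (e x₀) :=
      contDiffAt_comp_chart_symm he hxt (hσ' _ (mem_of_mem_nhds hS))
    have h2 : ContDiffAt ℝ ∞ (pullbackForm (P.θ x₀) (P.chart x₀ ∘ e.symm)) (e x₀) :=
      P.contDiffAt_pullback (contMDiffAt_chart_symm he hxt) (mem_of_mem_nhds hS)
    refine contMDiffAt_of_chart he hx₀ (((h1.fderiv_right (m := ∞) (by simp)).add
      (h1.smul h2)).congr_of_eventuallyEq ?_)
    filter_upwards [e.open_target.mem_nhds hxt,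
      (e.symm.continuousAt hxt).preimage_mem_nhds hS] with u hu hu'
    exact inCoordinates_deriv hu hu' ((hσ' _ hu').mdifferentiableAt (by simp))⟩⟩
  complex_linear σ x hσ v :=
    congrArg (fun l : E →L[ℝ] ℂ ↦ l v)
      (deriv_const_mul Complex.I ((P.mdifferentiableAt_section_iff (P.mem_source x) σ).1 hσ))
  metric σ τ x hσ hτ v :=
    diff_inner hP ((P.mdifferentiableAt_section_iff (P.mem_source x) σ).1 hσ)
      ((P.mdifferentiableAt_section_iff (P.mem_source x) τ).1 hτ) v

end PrequantumAtlas

end UnitaryConnection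

end BohrSommerfeld

namespace BohrSommerfeld

/-! ### Vector fields and Lie brackets in charts. -/

section FieldsInCharts

open Set

variable {E : Type*} [NormedAddCommGroup E] [NormedSpace ℝ E] [CompleteSpace E]
  {X : Type*} [TopologicalSpace X] [ChartedSpace E X] [IsManifold 𝓘(ℝ, E) ∞ X]
  {e : OpenPartialHomeomorph X E}

/-- The expression of a vector field in a chart. -/
def fieldInChart (e : OpenPartialHomeomorph X E) (U : (x : X) → TangentSpace 𝓘(ℝ, E) x) (u : E) :
    E :=
  (mfderiv 𝓘(ℝ, E) 𝓘(ℝ, E) e (e.symm u) : E →L[ℝ] E) (U (e.symm u))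

theorem isInvertible_mfderiv_chart_symm (he : e ∈ IsManifold.maximalAtlas 𝓘(ℝ, E) ∞ X) {u : E}
    (hu : u ∈ e.target) : (mfderiv 𝓘(ℝ, E) 𝓘(ℝ, E) e.symm u).IsInvertible ∧
      (mfderiv 𝓘(ℝ, E) 𝓘(ℝ, E) e.symm u).inverse =
        (mfderiv 𝓘(ℝ, E) 𝓘(ℝ, E) e (e.symm u) : E →L[ℝ] E) := by
  have h1 := (chart_mdifferentiable he).comp_symm_deriv hu
  have h2 := (chart_mdifferentiable he).symm_comp_deriv (e.map_target hu)
  have h3 : (mfderiv 𝓘(ℝ, E) 𝓘(ℝ, E) e.symm u : E →L[ℝ] E) ∘L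
      (mfderiv 𝓘(ℝ, E) 𝓘(ℝ, E) e (e.symm u) : E →L[ℝ] E) = .id ℝ E := by
    rw [e.right_inv hu] at h2
    exact h2
  exact ⟨.of_inverse h3 h1, ContinuousLinearMap.inverse_eq h3 h1⟩

theorem mpullback_eq_fieldInChart (he : e ∈ IsManifold.maximalAtlas 𝓘(ℝ, E) ∞ X) {u : E}
    (hu : u ∈ e.target) (U : (x : X) → TangentSpace 𝓘(ℝ, E) x) :
    VectorField.mpullback 𝓘(ℝ, E) 𝓘(ℝ, E) e.symm U u = fieldInChart e U u :=
  congrArg (fun l : E →L[ℝ] E ↦ l (U (e.symm u))) (isInvertible_mfderiv_chart_symm he hu).2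

theorem contDiffAt_fieldInChart (he : e ∈ IsManifold.maximalAtlas 𝓘(ℝ, E) ∞ X) {u : E}
    (hu : u ∈ e.target) {U : (x : X) → TangentSpace 𝓘(ℝ, E) x}
    (hU : ContMDiff 𝓘(ℝ, E) 𝓘(ℝ, E).tangent ∞
      (fun x ↦ (⟨x, U x⟩ : TangentBundle 𝓘(ℝ, E) X))) :
    ContDiffAt ℝ ∞ (fieldInChart e U) u := by
  have h1 := ContMDiffAt.mpullback_vectorField_preimage (m := ∞) (n := ∞) (hU (e.symm u))
    (contMDiffAt_chart_symm he hu) (isInvertible_mfderiv_chart_symm he hu).1 (by simp)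
  have h2 := contMDiffAt_vectorSpace_iff_contDiffAt.1 h1
  refine h2.congr_of_eventuallyEq ?_
  filter_upwards [e.open_target.mem_nhds hu] with w hw
  exact (mpullback_eq_fieldInChart he hw U).symm

/-- The bracket is natural under pullback by the inverse of the chart. -/
theorem mfderiv_chart_mlieBracket (he : e ∈ IsManifold.maximalAtlas 𝓘(ℝ, E) ∞ X) {u : E}
    (hu : u ∈ e.target) {U V : (x : X) → TangentSpace 𝓘(ℝ, E) x}
    (hU : ContMDiff 𝓘(ℝ, E) 𝓘(ℝ, E).tangent ∞
      (fun x ↦ (⟨x, U x⟩ : TangentBundle 𝓘(ℝ, E) X)))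
    (hV : ContMDiff 𝓘(ℝ, E) 𝓘(ℝ, E).tangent ∞
      (fun x ↦ (⟨x, V x⟩ : TangentBundle 𝓘(ℝ, E) X))) :
    (mfderiv 𝓘(ℝ, E) 𝓘(ℝ, E) e (e.symm u) : E →L[ℝ] E)
        (VectorField.mlieBracket 𝓘(ℝ, E) U V (e.symm u)) =
      fderiv ℝ (fieldInChart e V) u (fieldInChart e U u) -
        fderiv ℝ (fieldInChart e U) u (fieldInChart e V u) := by
  have : IsManifold 𝓘(ℝ, E) (minSmoothness ℝ 2) X := by
    rw [minSmoothness_of_isRCLikeNormedField]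
    exact .of_le (n := ∞) (WithTop.coe_le_coe.2 (le_top (a := (2 : ℕ∞))))
  have h1 := VectorField.mpullback_mlieBracket (n := ∞) (f := e.symm) (x₀ := u)
    ((hU (e.symm u)).mdifferentiableAt (by simp)) ((hV (e.symm u)).mdifferentiableAt (by simp))
    (contMDiffAt_chart_symm he hu) (by
      rw [minSmoothness_of_isRCLikeNormedField]
      exact WithTop.coe_le_coe.2 (le_top (a := (2 : ℕ∞))))
  have h2 := (mpullback_eq_fieldInChart he hu (VectorField.mlieBracket 𝓘(ℝ, E) U V)).symm.trans h1
  refine h2.trans ?_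
  have hev (U : (x : X) → TangentSpace 𝓘(ℝ, E) x) :
      VectorField.mpullback 𝓘(ℝ, E) 𝓘(ℝ, E) e.symm U =ᶠ[nhds u] fieldInChart e U := by
    filter_upwards [e.open_target.mem_nhds hu] with w hw
    exact mpullback_eq_fieldInChart he hw U
  rw [← VectorField.mlieBracketWithin_univ]
  refine (congrFun VectorField.mlieBracketWithin_eq_lieBracketWithin u).trans
    ((congrFun VectorField.lieBracketWithin_univ u).trans ?_)
  exact Filter.EventuallyEq.lieBracket_vectorField_eq (hev U) (hev V)

end FieldsInCharts

/-! ### The curvature of the connection of an atlas. -/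

section Curvature

variable {E : Type*} [NormedAddCommGroup E] [NormedSpace ℝ E]

/-- The curvature of the connection `d + θ` on a trivial line bundle. -/
theorem curvature_formula {s : E → ℂ} {θ : E → E →L[ℝ] ℂ} {U V : E → E} {u : E}
    (hs : ContDiffAt ℝ ∞ s u) (hθ : DifferentiableAt ℝ θ u) (hU : DifferentiableAt ℝ U u)
    (hV : DifferentiableAt ℝ V u) :
    fderiv ℝ (fun y ↦ fderiv ℝ s y (V y) + s y * θ y (V y)) u (U u) +
        (fderiv ℝ s u (V u) + s u * θ u (V u)) * θ u (U u) -
      (fderiv ℝ (fun y ↦ fderiv ℝ s y (U y) + s y * θ y (U y)) u (V u) +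
        (fderiv ℝ s u (U u) + s u * θ u (U u)) * θ u (V u)) -
      (fderiv ℝ s u (fderiv ℝ V u (U u) - fderiv ℝ U u (V u)) +
        s u * θ u (fderiv ℝ V u (U u) - fderiv ℝ U u (V u))) =
    (fderiv ℝ θ u (U u) (V u) - fderiv ℝ θ u (V u) (U u)) * s u := by
  have hs1 : HasFDerivAt s (fderiv ℝ s u) u := (hs.differentiableAt (by simp)).hasFDerivAt
  have hs2 : HasFDerivAt (fderiv ℝ s) (fderiv ℝ (fderiv ℝ s) u) u :=
    ((hs.fderiv_right (m := ∞) (by simp)).differentiableAt (by simp)).hasFDerivAt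
  have hsym : IsSymmSndFDerivAt ℝ s u := hs.isSymmSndFDerivAt (by
    rw [minSmoothness_of_isRCLikeNormedField]
    exact WithTop.coe_le_coe.2 (le_top (a := (2 : ℕ∞))))
  have key (W : E → E) (hW : DifferentiableAt ℝ W u) (w : E) :
      fderiv ℝ (fun y ↦ fderiv ℝ s y (W y) + s y * θ y (W y)) u w =
        fderiv ℝ (fderiv ℝ s) u w (W u) + fderiv ℝ s u (fderiv ℝ W u w) +
          (s u * (fderiv ℝ θ u w (W u) + θ u (fderiv ℝ W u w)) + fderiv ℝ s u w * θ u (W u)) := by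
    have h := ((hs2.clm_apply hW.hasFDerivAt).add
      (hs1.mul (hθ.hasFDerivAt.clm_apply hW.hasFDerivAt))).fderiv
    refine (congrArg (fun l : E →L[ℝ] ℂ ↦ l w) h).trans ?_
    simp only [add_apply, smul_apply, ContinuousLinearMap.comp_apply, smul_eq_mul,
      ContinuousLinearMap.flip_apply]
    ring
  -- The second derivatives of `s` cancel by symmetry, the derivatives of the fields against the
  -- bracket, and the products of values of `θ` because `ℂ` is commutative.
  rw [key V hV, key U hU, hsym.eq (U u) (V u), map_sub, map_sub]
  ring

end Curvature

section CurvatureOfAtlas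

variable {E : Type*} [NormedAddCommGroup E] [NormedSpace ℝ E] [CompleteSpace E]
  {X : Type*} [TopologicalSpace X] [ChartedSpace E X] [IsManifold 𝓘(ℝ, E) ∞ X]
  {Ω : TwoForm E X} {P : PrequantumAtlas Ω}

namespace PrequantumAtlas

/-- The covariant derivative in a chart. -/
theorem coef_deriv {i : X} {u : E} {σ : X → ℂ} (hu : u ∈ (P.chart i).target)
    (h : MDifferentiableAt 𝓘(ℝ, E) 𝓘(ℝ, ℂ) (P.coef i σ) ((P.chart i).symm u))
    (U : (x : X) → TangentSpace 𝓘(ℝ, E) x) :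
    P.coef i (fun y ↦ P.deriv σ y (U y)) ((P.chart i).symm u) =
      fderiv ℝ (P.coef i σ ∘ (P.chart i).symm) u (fieldInChart (P.chart i) U u) +
        P.coef i σ ((P.chart i).symm u) * P.θ i u (fieldInChart (P.chart i) U u) := by
  set e := P.chart i
  set x := e.symm u
  have hx : x ∈ e.source := e.map_target hu
  have h1 := P.deriv_eq hx (hasMFDerivAt_diff h)
  have h2 := fderiv_comp_chart_symm (P.chart_mem i) hx h (U x)
  rw [e.right_inv hu] at h2
  have h3 : P.form i x (U x) = P.θ i u (fieldInChart e U u) := by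
    change P.θ i (e (e.symm u)) _ = _
    rw [e.right_inv hu]
    rfl
  have hne := P.c_ne_zero i x
  have hne' := P.c_ne_zero x x
  change P.c x x / P.c i x * P.deriv σ x (U x) = _
  rw [← h3, h1]
  change P.c x x / P.c i x * (P.c i x / P.c x x * (diff (E := E) (P.coef i σ) x (U x) +
    P.coef i σ x * P.form i x (U x))) = _
  rw [← h2]
  field_simp
  rfl

/-- In one chart a covariant derivative along a smooth field has again a smooth coefficient, so the
coordinate formula can be applied twice. This reduces the claim to `d + θ` on a vector space. -/
theorem curvature_deriv {i : X} {u : E} {σ : X → ℂ} (hu : u ∈ (P.chart i).target)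
    (hσ : ∀ y ∈ (P.chart i).source, ContMDiffAt 𝓘(ℝ, E) 𝓘(ℝ, ℂ) ∞ (P.coef i σ) y)
    {U V : (x : X) → TangentSpace 𝓘(ℝ, E) x}
    (hU : ContMDiff 𝓘(ℝ, E) 𝓘(ℝ, E).tangent ∞
      (fun x ↦ (⟨x, U x⟩ : TangentBundle 𝓘(ℝ, E) X)))
    (hV : ContMDiff 𝓘(ℝ, E) 𝓘(ℝ, E).tangent ∞
      (fun x ↦ (⟨x, V x⟩ : TangentBundle 𝓘(ℝ, E) X))) {x : X} (hx : (P.chart i).symm u = x) :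
    P.deriv (fun y ↦ P.deriv σ y (V y)) x (U x) - P.deriv (fun y ↦ P.deriv σ y (U y)) x (V x)
        - P.deriv σ x (VectorField.mlieBracket 𝓘(ℝ, E) U V x) =
      (-2 * Complex.I * Real.pi * (Ω x ![U x, V x] : ℝ) : ℂ) * σ x := by
  have he := P.chart_mem i
  set e := P.chart i
  set s := P.coef i σ ∘ e.symm
  have hxs : x ∈ e.source := hx ▸ e.map_target hu
  have hs (w : E) (hw : w ∈ e.target) : ContDiffAt ℝ ∞ s w :=
    contDiffAt_comp_chart_symm he hw (hσ _ (e.map_target hw))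
  have hd (w : E) (hw : w ∈ e.target) :=
    (hσ _ (e.map_target hw)).mdifferentiableAt (by simp)
  have hθ : ContDiffAt ℝ ∞ (P.θ i) u := (P.contDiffOn_θ i).contDiffAt (e.open_target.mem_nhds hu)
  let g (W : (x : X) → TangentSpace 𝓘(ℝ, E) x) (w : E) : ℂ :=
    fderiv ℝ s w (fieldInChart e W w) + s w * P.θ i w (fieldInChart e W w)
  have hg (W : (x : X) → TangentSpace 𝓘(ℝ, E) x) :
      P.coef i (fun y ↦ P.deriv σ y (W y)) ∘ e.symm =ᶠ[nhds u] g W := by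
    filter_upwards [e.open_target.mem_nhds hu] with w hw
    exact coef_deriv hw (hd w hw) W
  have step (W : (x : X) → TangentSpace 𝓘(ℝ, E) x) (hW : ContMDiff 𝓘(ℝ, E) 𝓘(ℝ, E).tangent ∞
      (fun x ↦ (⟨x, W x⟩ : TangentBundle 𝓘(ℝ, E) X))) (W' : (x : X) → TangentSpace 𝓘(ℝ, E) x) :
      P.coef i (fun y ↦ P.deriv (fun y ↦ P.deriv σ y (W y)) y (W' y)) x =
        fderiv ℝ (g W) u (fieldInChart e W' u) + g W u * P.θ i u (fieldInChart e W' u) := by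
    have hgW : ContDiffAt ℝ ∞ (g W) u :=
      (((hs u hu).fderiv_right (m := ∞) (by simp)).clm_apply
        (contDiffAt_fieldInChart he hu hW)).add ((hs u hu).mul
          (hθ.clm_apply (contDiffAt_fieldInChart he hu hW)))
    have h1 : ContMDiffAt 𝓘(ℝ, E) 𝓘(ℝ, ℂ) ∞ (P.coef i (fun y ↦ P.deriv σ y (W y))) (e.symm u) := by
      refine contMDiffAt_of_chart he (e.map_target hu) ?_
      rw [e.right_inv hu]
      exact hgW.congr_of_eventuallyEq (hg W)
    rw [← hx, coef_deriv hu (h1.mdifferentiableAt (by simp)) W', (hg W).fderiv_eq]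
    exact congrArg (fun z ↦ _ + z * _) (hg W).self_of_nhds
  have h1 := step V hV U
  have h2 := step U hU V
  have h3 := coef_deriv hu (hd u hu) (VectorField.mlieBracket 𝓘(ℝ, E) U V)
  have h4 : fieldInChart e (VectorField.mlieBracket 𝓘(ℝ, E) U V) u = _ :=
    mfderiv_chart_mlieBracket he hu hU hV
  rw [h4] at h3
  have h5 := curvature_formula (hs u hu) (hθ.differentiableAt (by simp))
    ((contDiffAt_fieldInChart he hu hU).differentiableAt (by simp))
    ((contDiffAt_fieldInChart he hu hV).differentiableAt (by simp))
  have h6 := P.curvature i u hu (fieldInChart e U u) (fieldInChart e V u)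
  have h7 : Ω.inChart e u ![fieldInChart e U u, fieldInChart e V u] = Ω x ![U x, V x] := by
    subst hx
    have := Ω.inChart_mfderiv he (e.map_target hu) (U (e.symm u)) (V (e.symm u))
    rw [e.right_inv hu] at this
    exact this
  rw [h6, h7] at h5
  have h8 : P.coef i σ (e.symm u) = P.c x x / P.c i x * σ x := by rw [hx]; rfl
  have hne := P.c_ne_zero i x
  have hne' := P.c_ne_zero x x
  have hne2 : P.c x x / P.c i x ≠ 0 := div_ne_zero hne' hne
  rw [hx] at h3
  refine mul_left_cancel₀ hne2 ?_
  change P.c x x / P.c i x * _ = _ at h1 h2 h3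
  have h9 : s u = P.c x x / P.c i x * σ x := h8
  rw [mul_sub, mul_sub, h1, h2, h3]
  have h10 : P.coef i σ x = s u := by rw [← hx]; rfl
  rw [h10]
  refine h5.trans ?_
  rw [h9]
  ring

theorem hasCurvature_connection : LineBundle.HasCurvature P.connection Ω := by
  intro U V hU hV σ hσ x
  exact curvature_deriv ((P.chart x).map_source (P.mem_source x))
    (fun y hy ↦ (P.contMDiffAt_section_iff hy σ).1 (hσ y)) hU hV
      ((P.chart x).left_inv (P.mem_source x))

end PrequantumAtlas

end CurvatureOfAtlas

end BohrSommerfeld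

namespace BohrSommerfeld

/-! ### Extending functions from an immersed submanifold. -/

section Extension

open Set

variable {E : Type*} [NormedAddCommGroup E] [NormedSpace ℝ E] [FiniteDimensional ℝ E]
  {X : Type*} [TopologicalSpace X] [ChartedSpace E X] [IsManifold 𝓘(ℝ, E) ∞ X] [T2Space X]
  {F : Type*} [NormedAddCommGroup F] [NormedSpace ℝ F]
  {Q : Type*} [TopologicalSpace Q] [ChartedSpace F Q] [IsManifold 𝓘(ℝ, F) ∞ Q]

/-- An immersion has a local retraction. -/
theorem exists_retraction {ι : Q → X} {q : Q} (hι : Manifold.IsImmersionAt 𝓘(ℝ, F) 𝓘(ℝ, E) ∞ ι q) :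
    ∃ r : X → Q, (∀ᶠ x in nhds (ι q), ContMDiffAt 𝓘(ℝ, E) 𝓘(ℝ, F) ∞ r x) ∧
      ∀ᶠ q' in nhds q, r (ι q') = q' := by
  -- In the charts of the immersion `ι` is the inclusion of the first factor, and the projection
  -- onto it is a left inverse.
  let pr : E →L[ℝ] F := (ContinuousLinearMap.fst ℝ F hι.complement).comp
    hι.equiv.symm.toContinuousLinearMap
  have hpr (q' : Q) (hq' : q' ∈ hι.domChart.source) :
      pr (hι.codChart (ι q')) = hι.domChart q' := by
    have hm : hι.domChart q' ∈ (hι.domChart.extend 𝓘(ℝ, F)).target := by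
      simpa using hι.domChart.map_source hq'
    have h := hι.writtenInCharts hm
    simp only [mfld_simps, hι.domChart.left_inv hq', Function.comp_apply] at h
    simp [pr, h]
  have hr0 : pr (hι.codChart (ι q)) ∈ hι.domChart.target := by
    rw [hpr q hι.mem_domChart_source]
    exact hι.domChart.map_source hι.mem_domChart_source
  refine ⟨fun x ↦ hι.domChart.symm (pr (hι.codChart x)), ?_, ?_⟩
  · have hc : ContinuousAt (fun x ↦ pr (hι.codChart x)) (ι q) :=
      pr.continuous.continuousAt.comp (hι.codChart.continuousAt hι.mem_codChart_source)
    filter_upwards [hι.codChart.open_source.mem_nhds hι.mem_codChart_source,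
      hc.preimage_mem_nhds (hι.domChart.open_target.mem_nhds hr0)] with x hx hx'
    exact (contMDiffAt_chart_symm hι.domChart_mem_maximalAtlas hx').comp x
      (pr.contDiff.contMDiff.contMDiffAt.comp x (contMDiffAt_chart hι.codChart_mem_maximalAtlas hx))
  · filter_upwards [hι.domChart.open_source.mem_nhds hι.mem_domChart_source] with q' hq'
    rw [hpr q' hq', hι.domChart.left_inv hq']

/-- A function that is smooth near a point extends to a smooth function with small support. -/
theorem exists_smooth_eventuallyEq {G : Type*} [NormedAddCommGroup G] [NormedSpace ℝ G]
    {f : X → G} {x : X} (hf : ∀ᶠ y in nhds x, ContMDiffAt 𝓘(ℝ, E) 𝓘(ℝ, G) ∞ f y) {W : Set X}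
    (hW : W ∈ nhds x) :
    ∃ g : X → G, ContMDiff 𝓘(ℝ, E) 𝓘(ℝ, G) ∞ g ∧ tsupport g ⊆ W ∧ g =ᶠ[nhds x] f := by
  obtain ⟨b, -, hb⟩ := (SmoothBumpFunction.nhds_basis_tsupport (I := 𝓘(ℝ, E)) x).mem_iff.1
    (Filter.inter_mem hf hW)
  refine ⟨fun y ↦ b y • f y, fun y ↦ ?_, fun y hy ↦ (hb (closure_mono ?_ hy)).2, ?_⟩
  · by_cases hy : y ∈ tsupport b
    · exact b.contMDiffAt.smul (hb hy).1
    · refine (contMDiffAt_const (c := (0 : G))).congr_of_eventuallyEq ?_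
      filter_upwards [notMem_tsupport_iff_eventuallyEq.1 hy] with z hz
      simp [hz]
  · exact Function.support_smul_subset_left _ _
  · filter_upwards [b.eventuallyEq_one] with y hy
    simp [hy]

end Extension

/-! ### The parallel unit section along the submanifold. -/

section FlatAlong

open Set

variable {E : Type*} [NormedAddCommGroup E] [NormedSpace ℝ E] [FiniteDimensional ℝ E]
  {X : Type*} [TopologicalSpace X] [ChartedSpace E X] [IsManifold 𝓘(ℝ, E) ∞ X] [T2Space X]
  {F : Type*} [NormedAddCommGroup F] [NormedSpace ℝ F]
  {Q : Type*} [TopologicalSpace Q] [ChartedSpace F Q] [IsManifold 𝓘(ℝ, F) ∞ Q]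
  {Ω : TwoForm E X} {P : PrequantumAtlas Ω}

namespace PrequantumAtlas

/-- Again a function with smooth logarithmic derivative. -/
theorem IsFlatAlong.contMDiffAt {ι : Q → X} (hP : P.IsFlatAlong (F := F) ι)
    (hι : ContMDiff 𝓘(ℝ, F) 𝓘(ℝ, E) ∞ ι) {a : X} {q : Q} (hq : ι q ∈ (P.chart a).source) :
    ContMDiffAt 𝓘(ℝ, F) 𝓘(ℝ, ℂ) ∞ (fun q ↦ P.c a (ι q)) q := by
  have he := IsManifold.chart_mem_maximalAtlas (I := 𝓘(ℝ, F)) (n := ∞) q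
  set e := chartAt F q
  have hqe : q ∈ e.source := mem_chart_source F q
  have hU : IsOpen (e.target ∩ e.symm ⁻¹' (ι ⁻¹' (P.chart a).source)) :=
    e.symm.isOpen_inter_preimage ((P.chart a).open_source.preimage hι.continuous)
  have h := contDiffOn_of_hasFDerivAt_smul (g := fun u ↦ P.c a (ι (e.symm u))) hU
    (κ := pullbackForm (P.θ a) (P.chart a ∘ ι ∘ e.symm))
    (fun u hu ↦ (P.contDiffAt_pullback ((hι _).comp u (contMDiffAt_chart_symm he hu.1))
      hu.2).contDiffWithinAt)
    (fun u hu ↦ hP.hasFDerivAt_comp hι (mdifferentiableAt_chart_symm he hu.1) hu.2)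
  refine contMDiffAt_of_chart he hqe (h.contDiffAt (hU.mem_nhds ⟨e.map_source hqe, ?_⟩))
  simpa [e.left_inv hqe] using hq

/-- The section with a given coefficient in a local frame. -/
def sectionOfCoef (P : PrequantumAtlas Ω) (a : X) (g : X → ℂ) (x : X) : ℂ :=
  P.c a x / P.c x x * g x

theorem coef_sectionOfCoef (a : X) (g : X → ℂ) : P.coef a (P.sectionOfCoef a g) = g := by
  ext x
  have := P.c_ne_zero a x
  have := P.c_ne_zero x x
  simp only [coef, sectionOfCoef]
  field_simp

theorem isSmoothSection_sectionOfCoef {a : X} {g : X → ℂ} (hg : ContMDiff 𝓘(ℝ, E) 𝓘(ℝ, ℂ) ∞ g)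
    (hs : tsupport g ⊆ (P.chart a).source) :
    P.lineBundle.IsSmoothSection (P.sectionOfCoef a g) := by
  intro x
  by_cases hx : x ∈ tsupport g
  · refine (P.contMDiffAt_section_iff (hs hx) _).2 ?_
    rw [coef_sectionOfCoef]
    exact hg x
  · refine (P.contMDiffAt_section_iff (P.mem_source x) _).2 ?_
    refine (contMDiffAt_const (c := (0 : ℂ))).congr_of_eventuallyEq ?_
    filter_upwards [notMem_tsupport_iff_eventuallyEq.1 hx] with y hy
    simp [coef, sectionOfCoef, hy]

/-- The section is the global frame. Near a point of `Q` its coefficient in a local frame is `1 / c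
a`; composing this with a local retraction onto `Q` and cutting off gives a smooth section on the
ambient manifold. -/
theorem isTrivialFlatAlong_connection (hP : P.IsHermitian) {ι : Q → X}
    (hι : Manifold.IsImmersion 𝓘(ℝ, F) 𝓘(ℝ, E) ∞ ι) (hflat : P.IsFlatAlong (F := F) ι) :
    LineBundle.IsTrivialFlatAlong F P.connection (metric hP) ι := by
  have hsm := hι.contMDiff
  have hne (x : X) := P.c_ne_zero x x
  -- This is the coordinate of the global frame in the frame labelled by `ι q`.
  let s (q : Q) : ℂ := (P.c (ι q) (ι q))⁻¹
  refine ⟨s, fun q ↦ ?_, fun q ↦ ?_⟩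
  · change P.inner (ι q) (P.c (ι q) (ι q))⁻¹ (P.c (ι q) (ι q))⁻¹ = 1
    rw [inner_apply, mul_inv_cancel₀ (hne _), map_one, one_mul]
  obtain ⟨r, hr, hrι⟩ := exists_retraction (hι.isImmersionAt q)
  set a := ι q
  have hUa : (P.chart a).source ∈ nhds (ι q) := (P.chart a).open_source.mem_nhds (P.mem_source a)
  have hrq : r (ι q) = q := hrι.self_of_nhds
  have hrev : ∀ᶠ x in nhds (ι q), ι (r x) ∈ (P.chart a).source := by
    have : ContinuousAt (fun x ↦ ι (r x)) (ι q) :=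
      hsm.continuous.continuousAt.comp hr.self_of_nhds.continuousAt
    exact this.preimage_mem_nhds (by rw [hrq]; exact hUa)
  have hinv : ContDiffOn ℝ ∞ (fun z : ℂ ↦ z⁻¹) {0}ᶜ := fun z hz ↦
    (contDiffAt_inv ℝ hz).contDiffWithinAt
  obtain ⟨g, hg, hgs, hgeq⟩ := exists_smooth_eventuallyEq (E := E)
    (f := fun x ↦ (P.c a (ι (r x)))⁻¹) (x := ι q) (by
      filter_upwards [hr, hrev] with x hx hx'
      have h1 : ContMDiffAt 𝓘(ℝ, E) 𝓘(ℝ, ℂ) ∞ (fun x ↦ P.c a (ι (r x))) x :=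
        (hflat.contMDiffAt hsm hx').comp x hx
      exact (contDiffAt_inv ℝ (P.c_ne_zero a (ι (r x)))).contMDiffAt.comp x h1) hUa
  have hgι : ∀ᶠ q' in nhds q, g (ι q') = (P.c a (ι q'))⁻¹ := by
    filter_upwards [hsm.continuous.continuousAt.eventually hgeq, hrι] with q' h1 h2
    rw [h1, h2]
  refine ⟨P.sectionOfCoef a g, isSmoothSection_sectionOfCoef hg hgs, ?_, fun v ↦ ?_⟩
  · filter_upwards [hgι] with q' hq'
    have h1 := P.c_ne_zero a (ι q')
    change P.c a (ι q') / P.c (ι q') (ι q') * g (ι q') = (P.c (ι q') (ι q'))⁻¹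
    rw [hq']
    field_simp
  · have hd : HasMFDerivAt 𝓘(ℝ, E) 𝓘(ℝ, ℂ) (P.coef a (P.sectionOfCoef a g)) (ι q)
        (diff g (ι q) : E →L[ℝ] ℂ) := by
      rw [coef_sectionOfCoef]
      exact hasMFDerivAt_diff ((hg _).mdifferentiableAt (by simp))
    have h1 := P.deriv_eq (mem_of_mem_nhds hUa) hd
    have h2 := hflat a q (mem_of_mem_nhds hUa)
    have h3 := (hasMFDerivAt_diff (E := E) ((hg (ι q)).mdifferentiableAt (by simp))).comp q
      ((hsm q).mdifferentiableAt (by simp)).hasMFDerivAt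
    -- Differentiating `c a · g = 1` along `ι`, with the flatness of `c a`, yields `dg + g θ = 0` on
    -- vectors tangent to `Q`.
    have h4 : HasMFDerivAt 𝓘(ℝ, F) 𝓘(ℝ, ℂ) (fun _ : Q ↦ (1 : ℂ)) q _ :=
      (h2.mul h3).congr_of_eventuallyEq (by
        filter_upwards [hgι] with q' hq'
        simp [hq', P.c_ne_zero])
    have h5 := congrArg (fun l : F →L[ℝ] ℂ ↦ l v)
      ((hasMFDerivAt_const (1 : ℂ) q).mfderiv.symm.trans h4.mfderiv)
    change (0 : ℂ) = P.c a (ι q) * diff (E := E) g (ι q) (mfderiv 𝓘(ℝ, F) 𝓘(ℝ, E) ι q v) +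
      g (ι q) * (P.c a (ι q) * P.form a (ι q) (mfderiv 𝓘(ℝ, F) 𝓘(ℝ, E) ι q v)) at h5
    refine (congrArg (fun l : E →L[ℝ] ℂ ↦ l (mfderiv 𝓘(ℝ, F) 𝓘(ℝ, E) ι q v)) h1).trans ?_
    rw [coef_sectionOfCoef]
    change P.c a (ι q) / P.c (ι q) (ι q) * (diff (E := E) g (ι q) (mfderiv 𝓘(ℝ, F) 𝓘(ℝ, E) ι q v) +
      g (ι q) * P.form a (ι q) (mfderiv 𝓘(ℝ, F) 𝓘(ℝ, E) ι q v)) = 0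
    generalize diff (E := E) g (ι q) (mfderiv 𝓘(ℝ, F) 𝓘(ℝ, E) ι q v) = A at *
    generalize P.form a (ι q) (mfderiv 𝓘(ℝ, F) 𝓘(ℝ, E) ι q v) = B at *
    linear_combination (-(P.c (ι q) (ι q))⁻¹) * h5

end PrequantumAtlas

end FlatAlong

/-! ### Connection forms of type `(1,0)` give a holomorphic bundle with its Chern connection. -/

section Holomorphic

variable {E : Type*} [NormedAddCommGroup E] [NormedSpace ℝ E]
  {X : Type*} [TopologicalSpace X] [ChartedSpace E X] [IsManifold 𝓘(ℝ, E) ∞ X]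
  {Ω : TwoForm E X} {P : PrequantumAtlas Ω}
  {J : (x : X) → TangentSpace 𝓘(ℝ, E) x →L[ℝ] TangentSpace 𝓘(ℝ, E) x}

namespace PrequantumAtlas

/-- The connection forms are of type `(1, 0)`. -/
def IsHolomorphic (P : PrequantumAtlas Ω)
    (J : (x : X) → TangentSpace 𝓘(ℝ, E) x →L[ℝ] TangentSpace 𝓘(ℝ, E) x) : Prop :=
  ∀ a, ∀ x ∈ (P.chart a).source, ∀ v : TangentSpace 𝓘(ℝ, E) x,
    P.form a x (J x v) = Complex.I * P.form a x v

/-- The transition function has logarithmic derivative `θ i - θ j`, which is complex linear. -/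
theorem IsHolomorphic.lineBundle (hP : P.IsHolomorphic J) : P.lineBundle.IsHolomorphic J := by
  rintro _ _ ⟨i, rfl⟩ ⟨j, rfl⟩ x ⟨hi, hj⟩
  have h1 := P.compat i j x hi hj
  have h2 := h1.congr_of_eventuallyEq (f₁ := fun y ↦ (P.triv i).coordChange (P.triv j) y 1)
    (.of_forall fun y ↦ by
      have := P.c_ne_zero y y
      change P.c y y / P.c j y * (P.c i y / P.c y y * 1) = _
      field_simp)
  refine ⟨h2.mdifferentiableAt, fun v ↦ ?_⟩
  have h3 (v : E) := congrArg (fun l : E →L[ℝ] ℂ ↦ l v) h2.mfderiv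
  have h4 := hP i x hi v
  have h5 := hP j x hj v
  refine (h3 (J x v)).trans (Eq.trans ?_ (congrArg (Complex.I * ·) (h3 v)).symm)
  change P.c i x / P.c j x * (P.form i x (J x v) - P.form j x (J x v)) =
    Complex.I * (P.c i x / P.c j x * (P.form i x v - P.form j x v))
  rw [h4, h5]
  ring

/-- A local frame has constant coefficient 1, so its covariant derivative is its connection form, of
type `(1,0)`. -/
theorem IsHolomorphic.isChernConnection (hP : P.IsHolomorphic J) (hH : P.IsHermitian) :
    LineBundle.IsChernConnection P.connection (metric hH) J where
  unitary := isUnitary_connection hH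
  holomorphic := by
    rintro _ ⟨i, rfl⟩ x hi v
    have h1 : HasMFDerivAt 𝓘(ℝ, E) 𝓘(ℝ, ℂ) (P.coef i (fun y ↦ (P.triv i).symm y (1 : ℂ))) x
        (0 : E →L[ℝ] ℂ) := by
      refine (hasMFDerivAt_const (1 : ℂ) x).congr_of_eventuallyEq ?_
      filter_upwards [(P.chart i).open_source.mem_nhds hi] with y hy
      exact congrArg Prod.snd ((P.triv i).apply_mk_symm hy (1 : ℂ))
    have h2 := P.deriv_eq hi h1
    have h3 (v : E) := congrArg (fun l : E →L[ℝ] ℂ ↦ l v) h2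
    refine (h3 (J x v)).trans (Eq.trans ?_ (congrArg (Complex.I * ·) (h3 v)).symm)
    have h4 := hP i x hi v
    have (z w : ℂ) : z * (0 + w * P.form i x (J x v)) =
        Complex.I * (z * (0 + w * P.form i x v)) := by
      rw [h4]
      ring
    exact this _ _

end PrequantumAtlas

end Holomorphic

end BohrSommerfeld

namespace BohrSommerfeld

/-! ### Line bundles with connection in a trivialization. -/

section Coordinates

open Set

variable {E : Type*} [NormedAddCommGroup E] [NormedSpace ℝ E]
  {X : Type*} [TopologicalSpace X] [ChartedSpace E X]

namespace LineBundle

variable {L : LineBundle E X} (T : Trivialization ℂ (π ℂ L.Fiber)) [MemTrivializationAtlas T]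

/-- The coordinate of a vector in a trivialization. -/
def coord (x : X) (v : L.Fiber x) : ℂ := (T ⟨x, v⟩).2

/-- The frame defined by a trivialization. -/
def frame (x : X) : L.Fiber x := T.symm x 1

variable {T} {x : X}

theorem coord_smul (hx : x ∈ T.baseSet) (a : ℂ) (v : L.Fiber x) :
    coord T x (a • v) = a * coord T x v :=
  L.complex_linear T x hx a v

theorem coord_add (hx : x ∈ T.baseSet) (v w : L.Fiber x) :
    coord T x (v + w) = coord T x v + coord T x w :=
  (T.linear ℝ hx).map_add v w

theorem coord_frame (hx : x ∈ T.baseSet) : coord T x (frame T x) = 1 :=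
  congrArg Prod.snd (T.apply_mk_symm hx (1 : ℂ))

theorem coord_smul_frame (hx : x ∈ T.baseSet) (v : L.Fiber x) :
    coord T x v • frame T x = v := by
  have h1 := T.symm_apply_apply_mk hx (coord T x v • frame T x)
  have h2 := T.symm_apply_apply_mk hx v
  rw [← h1, ← h2]
  congr 1
  change coord T x _ = coord T x _
  rw [coord_smul hx, coord_frame hx, mul_one, h2]

theorem frame_ne_zero (hx : x ∈ T.baseSet) : frame T x ≠ 0 := by
  intro h
  have h1 := coord_frame hx
  have h2 := coord_smul hx (0 : ℂ) (frame T x)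
  rw [zero_smul, zero_mul] at h2
  rw [h, h2] at h1
  exact zero_ne_one h1

theorem coord_ne_zero (hx : x ∈ T.baseSet) {v : L.Fiber x} (hv : v ≠ 0) : coord T x v ≠ 0 := by
  intro h
  have := coord_smul_frame hx v
  rw [h, zero_smul] at this
  exact hv this.symm

theorem differentiableSectionAt_iff (hx : x ∈ T.baseSet) (σ : (x : X) → L.Fiber x) :
    L.DifferentiableSectionAt σ x ↔
      MDifferentiableAt 𝓘(ℝ, E) 𝓘(ℝ, ℂ) (fun y ↦ coord T y (σ y)) x :=
  haveI : ContMDiffVectorBundle 1 ℂ L.Fiber 𝓘(ℝ, E) := .of_le (n := ∞) (by simp)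
  T.mdifferentiableAt_section_iff 𝓘(ℝ, E) σ hx

theorem contMDiffAt_section_iff (hx : x ∈ T.baseSet) (σ : (x : X) → L.Fiber x) :
    ContMDiffAt 𝓘(ℝ, E) (𝓘(ℝ, E).prod 𝓘(ℝ, ℂ)) ∞ (fun x ↦ TotalSpace.mk' ℂ x (σ x)) x ↔
      ContMDiffAt 𝓘(ℝ, E) 𝓘(ℝ, ℂ) ∞ (fun y ↦ coord T y (σ y)) x :=
  T.contMDiffAt_section_iff (s := σ) (n := ∞) (IB := 𝓘(ℝ, E)) hx

variable [IsManifold 𝓘(ℝ, E) ∞ X] {D : L.Connection} {h : L.HermitianMetric}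

variable (T D) in
/-- The connection form in a trivialization. -/
def connectionForm (x : X) : E →L[ℝ] ℂ :=
  (T.continuousLinearMapAt ℝ x).comp (D (frame T) x)

theorem connectionForm_apply (hx : x ∈ T.baseSet) (v : TangentSpace 𝓘(ℝ, E) x) :
    connectionForm T D x v = coord T x (D (frame T) x v) :=
  T.continuousLinearMapAt_apply_of_mem ℝ hx _

theorem eventually_coord_frame (hx : x ∈ T.baseSet) (a : ℂ) :
    (fun y ↦ coord T y (a • frame T y)) =ᶠ[nhds x] fun _ ↦ a := by
  filter_upwards [T.open_baseSet.mem_nhds hx] with y hy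
  rw [coord_smul hy, coord_frame hy, mul_one]

theorem differentiableSectionAt_frame (hx : x ∈ T.baseSet) (a : ℂ) :
    L.DifferentiableSectionAt (fun y ↦ a • frame T y) x :=
  (differentiableSectionAt_iff hx _).2
    (mdifferentiableAt_const.congr_of_eventuallyEq (eventually_coord_frame hx a))

/-- The covariant derivative in a trivialization. -/
theorem IsUnitary.coord_apply (hD : IsUnitary D h) (hx : x ∈ T.baseSet) {σ : (x : X) → L.Fiber x}
    {f' : E →L[ℝ] ℂ}
    (hσ : HasMFDerivAt 𝓘(ℝ, E) 𝓘(ℝ, ℂ) (fun y ↦ coord T y (σ y)) x f')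
    (v : TangentSpace 𝓘(ℝ, E) x) :
    coord T x (D σ x v) = f' v + coord T x (σ x) * connectionForm T D x v := by
  set f := fun y ↦ coord T y (σ y)
  have hcov := D.isCovariantDerivativeOn (s := univ)
  have hg : HasMFDerivAt 𝓘(ℝ, E) 𝓘(ℝ, ℝ) (fun y ↦ (f y).re) x
      (Complex.reCLM.comp f' : E →L[ℝ] ℝ) :=
    (Complex.reCLM.hasFDerivAt (x := f x)).hasMFDerivAt.comp x hσ
  have hk : HasMFDerivAt 𝓘(ℝ, E) 𝓘(ℝ, ℝ) (fun y ↦ (f y).im) x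
      (Complex.imCLM.comp f' : E →L[ℝ] ℝ) :=
    (Complex.imCLM.hasFDerivAt (x := f x)).hasMFDerivAt.comp x hσ
  let t : (x : X) → L.Fiber x := frame T
  let It : (x : X) → L.Fiber x := fun y ↦ Complex.I • t y
  have ht : L.DifferentiableSectionAt t x := by
    simpa using differentiableSectionAt_frame (L := L) hx (1 : ℂ)
  have hIt : L.DifferentiableSectionAt It x := differentiableSectionAt_frame hx Complex.I
  let σ₁ : (x : X) → L.Fiber x := (fun y ↦ (f y).re) • t
  let σ₂ : (x : X) → L.Fiber x := (fun y ↦ (f y).im) • It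
  have e1 (y : X) : σ₁ y = ((f y).re : ℂ) • t y := rfl
  have e2 (y : X) : σ₂ y = ((f y).im : ℂ) • Complex.I • t y := rfl
  have hσ₁ : L.DifferentiableSectionAt σ₁ x := by
    refine (differentiableSectionAt_iff hx _).2 ?_
    refine (hasMFDerivAt_ofReal hg.mdifferentiableAt).mdifferentiableAt.congr_of_eventuallyEq ?_
    filter_upwards [T.open_baseSet.mem_nhds hx] with y hy
    rw [e1, coord_smul hy, coord_frame hy, mul_one]
  have hσ₂ : L.DifferentiableSectionAt σ₂ x := by
    refine (differentiableSectionAt_iff hx _).2 ?_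
    refine ((hasMFDerivAt_ofReal hk.mdifferentiableAt).mdifferentiableAt.mul
      (mdifferentiableAt_const (c := Complex.I))).congr_of_eventuallyEq ?_
    filter_upwards [T.open_baseSet.mem_nhds hx] with y hy
    rw [e2, coord_smul hy, coord_smul hy, coord_frame hy, mul_one]
    rfl
  have hsum : ∀ y ∈ T.baseSet, (σ₁ + σ₂) y = σ y := by
    intro y hy
    change σ₁ y + σ₂ y = _
    rw [e1, e2, smul_smul, ← add_smul, Complex.re_add_im]
    exact coord_smul_frame hy (σ y)
  have hσd : L.DifferentiableSectionAt σ x :=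
    (differentiableSectionAt_iff hx _).2 hσ.mdifferentiableAt
  have hsumd : L.DifferentiableSectionAt (σ₁ + σ₂) x := by
    refine (differentiableSectionAt_iff hx _).2 (hσ.mdifferentiableAt.congr_of_eventuallyEq ?_)
    filter_upwards [T.open_baseSet.mem_nhds hx] with y hy
    rw [hsum y hy]
  have h1 : D σ x = D (σ₁ + σ₂) x :=
    hcov.congr_of_eventuallyEq hσd hsumd Filter.univ_mem (by
      filter_upwards [T.open_baseSet.mem_nhds hx] with y hy
      exact (hsum y hy).symm)
  have h2 : D (σ₁ + σ₂) x = D σ₁ x + D σ₂ x := hcov.add hσ₁ hσ₂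
  have h3 := hcov.leibniz ht hg.mdifferentiableAt
  have h4 := hcov.leibniz hIt hk.mdifferentiableAt
  have h5 := hD.complex_linear t x ht v
  have h6 : D σ x v = ((f x).re : ℂ) • D t x v + (((f' v).re : ℝ) : ℂ) • t x +
      (((f x).im : ℂ) • Complex.I • D t x v + (((f' v).im : ℝ) : ℂ) • Complex.I • t x) := by
    rw [h1, h2]
    change D σ₁ x v + D σ₂ x v = _
    have h9 : D σ₁ x v = ((f x).re : ℂ) • D t x v + (((f' v).re : ℝ) : ℂ) • t x := by
      refine (congrArg (fun l : TangentSpace 𝓘(ℝ, E) x →L[ℝ] L.Fiber x ↦ l v) h3).trans ?_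
      have h11 : mvfderiv 𝓘(ℝ, E) (fun y ↦ (f y).re) x v = (f' v).re :=
        congrArg (fun l : E →L[ℝ] ℝ ↦ l v) hg.mfderiv
      change ((f x).re : ℂ) • D t x v + (mvfderiv 𝓘(ℝ, E) (fun y ↦ (f y).re) x v : ℝ) • t x = _
      rw [h11]
      rfl
    have h10 : D σ₂ x v = ((f x).im : ℂ) • Complex.I • D t x v +
        (((f' v).im : ℝ) : ℂ) • Complex.I • t x := by
      refine (congrArg (fun l : TangentSpace 𝓘(ℝ, E) x →L[ℝ] L.Fiber x ↦ l v) h4).trans ?_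
      have h11 : mvfderiv 𝓘(ℝ, E) (fun y ↦ (f y).im) x v = (f' v).im :=
        congrArg (fun l : E →L[ℝ] ℝ ↦ l v) hk.mfderiv
      change ((f x).im : ℂ) • D It x v + (mvfderiv 𝓘(ℝ, E) (fun y ↦ (f y).im) x v : ℝ) • It x = _
      rw [h11, ← h5]
      rfl
    rw [h9, h10]
  rw [h6, coord_add hx, coord_add hx, coord_add hx, coord_smul hx, coord_smul hx, coord_smul hx,
    coord_smul hx, coord_smul hx, coord_smul hx, coord_frame hx, ← connectionForm_apply hx]
  have h7 : f x = (f x).re + (f x).im * Complex.I := (Complex.re_add_im _).symm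
  have h8 : f' v = (f' v).re + (f' v).im * Complex.I := (Complex.re_add_im _).symm
  linear_combination (-1 : ℂ) * h8 - connectionForm T D x v * h7

end LineBundle

end Coordinates

end BohrSommerfeld

namespace BohrSommerfeld

/-! ### Coordinate vector fields and their global extensions. -/

section CoordinateFields

open Set

variable {E : Type*} [NormedAddCommGroup E] [NormedSpace ℝ E] [FiniteDimensional ℝ E]
  {X : Type*} [TopologicalSpace X] [ChartedSpace E X] [IsManifold 𝓘(ℝ, E) ∞ X]
  {e : OpenPartialHomeomorph X E}

/-- The vector field with constant expression in a chart. -/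
def coordField (e : OpenPartialHomeomorph X E) (v : E) (x : X) : TangentSpace 𝓘(ℝ, E) x :=
  (mfderiv 𝓘(ℝ, E) 𝓘(ℝ, E) e.symm (e x) : E →L[ℝ] E) v

theorem mfderiv_coordField (he : e ∈ IsManifold.maximalAtlas 𝓘(ℝ, E) ∞ X) {x : X}
    (hx : x ∈ e.source) (v : E) :
    (mfderiv 𝓘(ℝ, E) 𝓘(ℝ, E) e x : E →L[ℝ] E) (coordField e v x) = v := by
  have h := mfderiv_chart_chart_symm he (e.map_source hx) v
  rw [e.left_inv hx] at h
  exact h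

theorem coordField_symm {u : E} (hu : u ∈ e.target) (v : E) :
    coordField e v (e.symm u) = (mfderiv 𝓘(ℝ, E) 𝓘(ℝ, E) e.symm u : E →L[ℝ] E) v := by
  have (u' : E) (h : u' = u) : (mfderiv 𝓘(ℝ, E) 𝓘(ℝ, E) e.symm u' : E →L[ℝ] E) v =
    (mfderiv 𝓘(ℝ, E) 𝓘(ℝ, E) e.symm u : E →L[ℝ] E) v := by rw [h]
  exact this _ (e.right_inv hu)

theorem contMDiffAt_coordField (he : e ∈ IsManifold.maximalAtlas 𝓘(ℝ, E) ∞ X) {x : X}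
    (hx : x ∈ e.source) (v : E) :
    ContMDiffAt 𝓘(ℝ, E) 𝓘(ℝ, E).tangent ∞
      (fun y ↦ (⟨y, coordField e v y⟩ : TangentBundle 𝓘(ℝ, E) X)) x := by
  have := FiniteDimensional.complete ℝ E
  have hinv (y : X) (hy : y ∈ e.source) : (mfderiv 𝓘(ℝ, E) 𝓘(ℝ, E) e y).IsInvertible ∧
      (mfderiv 𝓘(ℝ, E) 𝓘(ℝ, E) e y).inverse =
        (mfderiv 𝓘(ℝ, E) 𝓘(ℝ, E) e.symm (e y) : E →L[ℝ] E) := by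
    have h1 := (chart_mdifferentiable he).symm_comp_deriv hy
    have h2 := (chart_mdifferentiable he).comp_symm_deriv (e.map_source hy)
    have h3 : (mfderiv 𝓘(ℝ, E) 𝓘(ℝ, E) e y : E →L[ℝ] E) ∘L
        (mfderiv 𝓘(ℝ, E) 𝓘(ℝ, E) e.symm (e y) : E →L[ℝ] E) = .id ℝ E := by
      rw [e.left_inv hy] at h2
      exact h2
    exact ⟨.of_inverse h3 h1, ContinuousLinearMap.inverse_eq h3 h1⟩
  have hc : ContMDiffAt 𝓘(ℝ, E) 𝓘(ℝ, E).tangent ∞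
      (fun u : E ↦ (⟨u, v⟩ : TangentBundle 𝓘(ℝ, E) E)) (e x) :=
    contMDiffAt_vectorSpace_iff_contDiffAt.2 contDiffAt_const
  have h1 := ContMDiffAt.mpullback_vectorField_preimage (m := ∞) (n := ∞)
    (V := fun _ : E ↦ v) (f := e) (x₀ := x) hc (contMDiffAt_chart he hx) (hinv x hx).1 (by simp)
  refine h1.congr_of_eventuallyEq ?_
  filter_upwards [e.open_source.mem_nhds hx] with y hy
  exact congrArg (TotalSpace.mk y)
    (congrArg (fun l : E →L[ℝ] E ↦ l v) (hinv y hy).2).symm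

variable [T2Space X]

/-- The curvature condition quantifies over global smooth fields, so a coordinate field has to be
cut off away from the point. -/
theorem exists_smooth_coordField (he : e ∈ IsManifold.maximalAtlas 𝓘(ℝ, E) ∞ X) {x : X}
    (hx : x ∈ e.source) (v : E) : ∃ U : (x : X) → TangentSpace 𝓘(ℝ, E) x,
    ContMDiff 𝓘(ℝ, E) 𝓘(ℝ, E).tangent ∞ (fun x ↦ (⟨x, U x⟩ : TangentBundle 𝓘(ℝ, E) X)) ∧
      ∀ᶠ y in nhds x, U y = coordField e v y := by
  obtain ⟨g, hg, hgs, hg1⟩ := exists_smooth_eventuallyEq (E := E) (x := x)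
    (f := fun _ : X ↦ (1 : ℝ)) (.of_forall fun _ ↦ contMDiffAt_const)
    (e.open_source.mem_nhds hx)
  refine ⟨fun y ↦ g y • coordField e v y, fun y ↦ ?_, ?_⟩
  · by_cases hy : y ∈ tsupport g
    · exact (hg y).smul_section (contMDiffAt_coordField he (hgs hy) v)
    · refine (contMDiff_zeroSection ℝ (TangentSpace 𝓘(ℝ, E) (M := X))
        y).congr_of_eventuallyEq ?_
      filter_upwards [notMem_tsupport_iff_eventuallyEq.1 hy] with z hz
      simp only [hz, Pi.zero_apply, zero_smul]
      rfl
  · filter_upwards [hg1] with y hy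
    simp only [hy, one_smul]

end CoordinateFields

/-! ### Connection forms of a bundle and their differential. -/

section AtlasOfBundle

open Set

variable {E : Type*} [NormedAddCommGroup E] [NormedSpace ℝ E] [FiniteDimensional ℝ E]
  {X : Type*} [TopologicalSpace X] [ChartedSpace E X] [IsManifold 𝓘(ℝ, E) ∞ X] [T2Space X]
  {e : OpenPartialHomeomorph X E}

namespace LineBundle

variable {L : LineBundle E X} {T : Trivialization ℂ (π ℂ L.Fiber)} [MemTrivializationAtlas T]
  {D : L.Connection} {h : L.HermitianMetric} {x : X}

theorem coord_sub (hx : x ∈ T.baseSet) (v w : L.Fiber x) :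
    coord T x (v - w) = coord T x v - coord T x w := by
  rw [eq_sub_iff_add_eq, ← coord_add hx, sub_add_cancel]

/-- A frame can be extended to a smooth section. -/
theorem exists_smooth_frame (hx : x ∈ T.baseSet) : ∃ τ : (x : X) → L.Fiber x,
    L.IsSmoothSection τ ∧ (fun y ↦ coord T y (τ y)) =ᶠ[nhds x] fun _ ↦ 1 := by
  obtain ⟨g, hg, hgs, hg1⟩ := exists_smooth_eventuallyEq (E := E) (x := x)
    (f := fun _ : X ↦ (1 : ℂ)) (.of_forall fun _ ↦ contMDiffAt_const)
    (T.open_baseSet.mem_nhds hx)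
  have hc (y : X) (hy : y ∈ T.baseSet) : coord T y (g y • frame T y) = g y := by
    rw [coord_smul hy, coord_frame hy, mul_one]
  refine ⟨fun y ↦ g y • frame T y, fun y ↦ ?_, ?_⟩
  · by_cases hy : y ∈ tsupport g
    · refine (contMDiffAt_section_iff (hgs hy) _).2 ((hg y).congr_of_eventuallyEq ?_)
      filter_upwards [T.open_baseSet.mem_nhds (hgs hy)] with z hz
      exact hc z hz
    · refine (contMDiff_zeroSection ℝ L.Fiber y).congr_of_eventuallyEq ?_
      filter_upwards [notMem_tsupport_iff_eventuallyEq.1 hy] with z hz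
      simp only [hz, Pi.zero_apply, zero_smul]
      rfl
  · filter_upwards [hg1, T.open_baseSet.mem_nhds hx] with y hy hy'
    rw [hc y hy', hy]

theorem IsUnitary.coord_of_eventually (hD : IsUnitary D h) (hx : x ∈ T.baseSet)
    {τ : (x : X) → L.Fiber x} (hτ : (fun y ↦ coord T y (τ y)) =ᶠ[nhds x] fun _ ↦ 1)
    (v : TangentSpace 𝓘(ℝ, E) x) : coord T x (D τ x v) = connectionForm T D x v := by
  have h1 : HasMFDerivAt 𝓘(ℝ, E) 𝓘(ℝ, ℂ) (fun y ↦ coord T y (τ y)) x (0 : E →L[ℝ] ℂ) :=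
    (hasMFDerivAt_const (1 : ℂ) x).congr_of_eventuallyEq hτ
  rw [hD.coord_apply hx h1, show coord T x (τ x) = 1 from hτ.self_of_nhds, one_mul]
  exact zero_add _

/-- Near the point the frame is the germ of a global smooth section, whose covariant derivative is
smooth by assumption. -/
theorem IsUnitary.contMDiffAt_connectionForm (hD : IsUnitary D h) (hx : x ∈ T.baseSet)
    {U : (x : X) → TangentSpace 𝓘(ℝ, E) x}
    (hU : ContMDiffAt 𝓘(ℝ, E) 𝓘(ℝ, E).tangent ∞
      (fun y ↦ (⟨y, U y⟩ : TangentBundle 𝓘(ℝ, E) X)) x) :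
    ContMDiffAt 𝓘(ℝ, E) 𝓘(ℝ, ℂ) ∞ (fun y ↦ connectionForm T D y (U y)) x := by
  obtain ⟨τ, hτ, hτ1⟩ := exists_smooth_frame hx
  have h1 := (hD.smooth.contMDiff.contMDiff (σ := τ) (hτ.contMDiffOn.of_le (by simp)) x
    (mem_univ x)).contMDiffAt Filter.univ_mem
  have h2 := h1.clm_bundle_apply (v := U) hU
  have h3 := (contMDiffAt_section_iff hx (fun y ↦ D τ y (U y))).1 h2
  refine h3.congr_of_eventuallyEq ?_
  filter_upwards [T.open_baseSet.mem_nhds hx, hτ1.eventuallyEq_nhds] with y hy hy'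
  exact (hD.coord_of_eventually hy hy' _).symm

variable (T D) in
/-- The connection form of a trivialization in a chart. -/
def chartForm (e : OpenPartialHomeomorph X E) (u : E) : E →L[ℝ] ℂ :=
  (connectionForm T D (e.symm u)).comp (mfderiv 𝓘(ℝ, E) 𝓘(ℝ, E) e.symm u : E →L[ℝ] E)

theorem chartForm_apply {u : E} (hu : u ∈ e.target) (v : E) :
    chartForm T D e u v = connectionForm T D (e.symm u) (coordField e v (e.symm u)) := by
  rw [coordField_symm hu]
  rfl

theorem chartForm_comp_mfderiv (he : e ∈ IsManifold.maximalAtlas 𝓘(ℝ, E) ∞ X)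
    (hx : x ∈ e.source) :
    (chartForm T D e (e x)).comp (mfderiv 𝓘(ℝ, E) 𝓘(ℝ, E) e x : E →L[ℝ] E) =
      connectionForm T D x := by
  ext v
  have h1 := mfderiv_chart_symm_chart he hx v
  change connectionForm T D (e.symm (e x)) (mfderiv 𝓘(ℝ, E) 𝓘(ℝ, E) e.symm (e x)
    (mfderiv 𝓘(ℝ, E) 𝓘(ℝ, E) e x v)) = _
  rw [h1, e.left_inv hx]
  rfl

theorem IsUnitary.contDiffOn_chartForm (hD : IsUnitary D h)
    (he : e ∈ IsManifold.maximalAtlas 𝓘(ℝ, E) ∞ X) (hs : e.source ⊆ T.baseSet) :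
    ContDiffOn ℝ ∞ (chartForm T D e) e.target := by
  rw [contDiffOn_clm_apply]
  intro v u hu
  refine ContDiffAt.contDiffWithinAt ?_
  have hx := e.map_target hu
  have h1 := hD.contMDiffAt_connectionForm (hs hx) (contMDiffAt_coordField he hx v)
  refine (contDiffAt_comp_chart_symm he hu h1).congr_of_eventuallyEq ?_
  filter_upwards [e.open_target.mem_nhds hu] with w hw
  exact chartForm_apply hw v

/-- The first derivative of a local frame along a coordinate field has coefficient `θ w`; the
coordinate formula for that section gives the derivative of `θ w` plus the product. -/
theorem IsUnitary.coord_apply_apply (hD : IsUnitary D h)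
    (he : e ∈ IsManifold.maximalAtlas 𝓘(ℝ, E) ∞ X) (hs : e.source ⊆ T.baseSet) {u : E}
    (hu : u ∈ e.target) {τ : (x : X) → L.Fiber x}
    (hτ : (fun y ↦ coord T y (τ y)) =ᶠ[nhds (e.symm u)] fun _ ↦ 1)
    {U V : (x : X) → TangentSpace 𝓘(ℝ, E) x} {v w : E}
    (hU : ∀ᶠ y in nhds (e.symm u), U y = coordField e v y)
    (hV : ∀ᶠ y in nhds (e.symm u), V y = coordField e w y) :
    coord T (e.symm u) (D (fun y ↦ D τ y (V y)) (e.symm u) (U (e.symm u))) =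
      fderiv ℝ (chartForm T D e) u v w + chartForm T D e u w * chartForm T D e u v := by
  have hx := e.map_target hu
  set x := e.symm u
  have hev : (fun y ↦ coord T y (D τ y (V y))) =ᶠ[nhds x] fun y ↦ chartForm T D e (e y) w := by
    filter_upwards [e.open_source.mem_nhds hx, hτ.eventuallyEq_nhds, hV] with y hy hy1 hy2
    rw [hD.coord_of_eventually (hs hy) hy1, hy2, chartForm_apply (e.map_source hy),
      e.left_inv hy]
  have hC : HasFDerivAt (chartForm T D e) (fderiv ℝ (chartForm T D e) u) u :=
    (((hD.contDiffOn_chartForm he hs).contDiffAt (e.open_target.mem_nhds hu)).differentiableAt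
      (by simp)).hasFDerivAt
  have hC2 : HasFDerivAt (fun u ↦ chartForm T D e u w)
      ((ContinuousLinearMap.apply ℝ ℂ w).comp (fderiv ℝ (chartForm T D e) u)) u :=
    (ContinuousLinearMap.apply ℝ ℂ w).hasFDerivAt.comp u hC
  have hC3 : HasFDerivAt ((fun y ↦ chartForm T D e (e y) w) ∘ e.symm)
      ((ContinuousLinearMap.apply ℝ ℂ w).comp (fderiv ℝ (chartForm T D e) u)) (e x) := by
    rw [e.right_inv hu]
    refine hC2.congr_of_eventuallyEq ?_
    filter_upwards [e.open_target.mem_nhds hu] with y hy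
    simp [e.right_inv hy]
  have h1 := (hasMFDerivAt_of_chart he hx hC3).congr_of_eventuallyEq hev
  have hUx := hU.self_of_nhds
  rw [hD.coord_apply (hs hx) h1,
    show coord T x (D τ x (V x)) = chartForm T D e (e x) w from hev.self_of_nhds, hUx,
    e.right_inv hu]
  have h2 := mfderiv_coordField he hx v
  have h3 := chartForm_apply (T := T) (D := D) hu v
  rw [h3]
  congr 1
  change fderiv ℝ (chartForm T D e) u ((mfderiv 𝓘(ℝ, E) 𝓘(ℝ, E) e x : E →L[ℝ] E)
    (coordField e v x)) w = _
  rw [h2]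

/-- Tested on coordinate fields, the bracket vanishes, and the products of values of the connection
form are symmetric in the two fields; only its differential survives. -/
theorem IsUnitary.curvature_chartForm (hD : IsUnitary D h) {Ω : TwoForm E X}
    (hc : HasCurvature D Ω) (he : e ∈ IsManifold.maximalAtlas 𝓘(ℝ, E) ∞ X)
    (hs : e.source ⊆ T.baseSet) {u : E} (hu : u ∈ e.target) (v w : E) :
    fderiv ℝ (chartForm T D e) u v w - fderiv ℝ (chartForm T D e) u w v =
      -2 * Complex.I * Real.pi * (Ω.inChart e u ![v, w] : ℝ) := by
  have := FiniteDimensional.complete ℝ E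
  have hx := e.map_target hu
  obtain ⟨τ, hτ, hτ1⟩ := exists_smooth_frame (hs hx)
  obtain ⟨U, hU, hU1⟩ := exists_smooth_coordField he hx v
  obtain ⟨V, hV, hV1⟩ := exists_smooth_coordField he hx w
  have key := hc U V hU hV τ hτ (e.symm u)
  have hconst (W : (x : X) → TangentSpace 𝓘(ℝ, E) x) (v : E)
      (hW : ∀ᶠ y in nhds (e.symm u), W y = coordField e v y) :
      fderiv ℝ (fieldInChart e W) u = 0 := by
    have : fieldInChart e W =ᶠ[nhds u] fun _ ↦ v := by
      filter_upwards [e.open_target.mem_nhds hu, (e.symm.continuousAt hu).eventually hW]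
        with y hy hy'
      change (mfderiv 𝓘(ℝ, E) 𝓘(ℝ, E) e (e.symm y) : E →L[ℝ] E) (W (e.symm y)) = v
      rw [hy']
      exact mfderiv_coordField he (e.map_target hy) v
    rw [this.fderiv_eq, fderiv_const_apply]
  have hbr : VectorField.mlieBracket 𝓘(ℝ, E) U V (e.symm u) = 0 := by
    have h1 := mfderiv_chart_mlieBracket he hu hU hV
    rw [hconst U v hU1, hconst V w hV1, zero_apply, zero_apply, sub_zero] at h1
    have h2 := mfderiv_chart_symm_chart he hx (VectorField.mlieBracket 𝓘(ℝ, E) U V (e.symm u))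
    rw [← h2]
    refine (congrArg _ h1).trans ?_
    exact map_zero _
  rw [hbr, map_zero, sub_zero] at key
  have key2 := congrArg (coord T (e.symm u)) key
  rw [coord_sub (hs hx), coord_smul (hs hx),
    show coord T (e.symm u) (τ (e.symm u)) = 1 from hτ1.self_of_nhds,
    hD.coord_apply_apply he hs hu hτ1 hU1 hV1, hD.coord_apply_apply he hs hu hτ1 hV1 hU1,
    hU1.self_of_nhds, hV1.self_of_nhds, coordField_symm hu, coordField_symm hu] at key2
  rw [Ω.inChart_apply]
  linear_combination key2

end LineBundle

end AtlasOfBundle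

end BohrSommerfeld

namespace BohrSommerfeld

/-! ### From a bundle trivial along the submanifold to a flat atlas. -/

section AtlasOfConnection

open Set

variable {E : Type*} [NormedAddCommGroup E] [NormedSpace ℝ E] [FiniteDimensional ℝ E]
  {X : Type*} [TopologicalSpace X] [ChartedSpace E X] [IsManifold 𝓘(ℝ, E) ∞ X] [T2Space X]

namespace LineBundle

variable {L : LineBundle E X} {D : L.Connection} {h : L.HermitianMetric} {Ω : TwoForm E X}

/-- The transition function of two trivializations and the connection forms. -/
theorem IsUnitary.hasMFDerivAt_coord_frame (hD : IsUnitary D h)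
    {T T' : Trivialization ℂ (π ℂ L.Fiber)} [MemTrivializationAtlas T] [MemTrivializationAtlas T']
    {x : X} (hx : x ∈ T.baseSet) (hx' : x ∈ T'.baseSet) :
    HasMFDerivAt 𝓘(ℝ, E) 𝓘(ℝ, ℂ) (fun y ↦ coord T' y (frame T y)) x
      (coord T' x (frame T x) • (connectionForm T D x - connectionForm T' D x) : E →L[ℝ] ℂ) := by
  have h0 : L.DifferentiableSectionAt (frame T) x := by
    simpa using differentiableSectionAt_frame (L := L) hx (1 : ℂ)
  have h1 := hasMFDerivAt_diff ((differentiableSectionAt_iff hx' _).1 h0)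
  refine h1.congr_mfderiv (ContinuousLinearMap.ext fun v ↦ ?_)
  have h2 := hD.coord_apply hx' h1 v
  have h3 (v : TangentSpace 𝓘(ℝ, E) x) :
      coord T' x (D (frame T) x v) = connectionForm T D x v * coord T' x (frame T x) := by
    rw [connectionForm_apply hx, ← coord_smul hx', coord_smul_frame hx]
  have h4 : diff (E := E) (fun y ↦ coord T' y (frame T y)) x v =
      coord T' x (frame T x) * (connectionForm T D x v - connectionForm T' D x v) := by
    linear_combination h3 v - h2
  exact h4

/-- A nowhere vanishing section along a subset extends to a nowhere vanishing section. -/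
theorem exists_section_extending {Q : Type*} {ι : Q → X} (hι : Function.Injective ι)
    (s : (q : Q) → L.Fiber (ι q)) (hs : ∀ q, s q ≠ 0) :
    ∃ σ : (x : X) → L.Fiber x, (∀ x, σ x ≠ 0) ∧ ∀ q, σ (ι q) = s q := by
  have (x : X) : ∃ v : L.Fiber x, v ≠ 0 ∧ ∀ (q : Q) (hq : ι q = x), hq ▸ s q = v := by
    by_cases hx : ∃ q, ι q = x
    · obtain ⟨q, rfl⟩ := hx
      refine ⟨s q, hs q, fun q' hq' ↦ ?_⟩
      obtain rfl := hι hq'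
      rfl
    · exact ⟨frame (trivializationAt ℂ L.Fiber x) x,
        frame_ne_zero (FiberBundle.mem_baseSet_trivializationAt' x),
        fun q hq ↦ (hx ⟨q, hq⟩).elim⟩
  choose σ h1 h2 using this
  exact ⟨σ, h1, fun q ↦ (h2 (ι q) q rfl).symm⟩

open Classical in
/-- The coefficient of the frame of a trivialization with respect to a global section. -/
def frameCoef (σ : (x : X) → L.Fiber x) (a x : X) : ℂ :=
  if x ∈ (trivializationAt ℂ L.Fiber a).baseSet then
    (coord (trivializationAt ℂ L.Fiber a) x (σ x))⁻¹ else 1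

theorem frameCoef_of_mem (σ : (x : X) → L.Fiber x) {a x : X}
    (hx : x ∈ (trivializationAt ℂ L.Fiber a).baseSet) :
    frameCoef σ a x = (coord (trivializationAt ℂ L.Fiber a) x (σ x))⁻¹ :=
  if_pos hx

variable (L) in
/-- The restriction of a chart to the domain of a trivialization. -/
def bundleChart (a : X) : OpenPartialHomeomorph X E :=
  (chartAt E a).restr (trivializationAt ℂ L.Fiber a).baseSet

theorem bundleChart_source_subset (a : X) :
    (bundleChart L a).source ⊆ (trivializationAt ℂ L.Fiber a).baseSet := by
  rw [bundleChart, OpenPartialHomeomorph.restr_source]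
  exact inter_subset_right.trans interior_subset

theorem bundleChart_mem (a : X) : bundleChart L a ∈ IsManifold.maximalAtlas 𝓘(ℝ, E) ∞ X :=
  restr_mem_maximalAtlas _ (IsManifold.chart_mem_maximalAtlas a)
    (trivializationAt ℂ L.Fiber a).open_baseSet

theorem frameCoef_div {σ : (x : X) → L.Fiber x} (hσ : ∀ x, σ x ≠ 0) {a b x : X}
    (ha : x ∈ (trivializationAt ℂ L.Fiber a).baseSet)
    (hb : x ∈ (trivializationAt ℂ L.Fiber b).baseSet) :
    frameCoef σ a x / frameCoef σ b x = coord (trivializationAt ℂ L.Fiber b) x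
      (frame (trivializationAt ℂ L.Fiber a) x) := by
  have h1 := coord_ne_zero ha (hσ x)
  have h2 := coord_smul hb (coord (trivializationAt ℂ L.Fiber a) x (σ x))
    (frame (trivializationAt ℂ L.Fiber a) x)
  rw [coord_smul_frame ha] at h2
  rw [frameCoef_of_mem σ ha, frameCoef_of_mem σ hb, h2]
  field_simp

/-- The local frames and connection forms of a line bundle with connection. -/
def atlas (hD : IsUnitary D h) (hc : HasCurvature D Ω) {σ : (x : X) → L.Fiber x}
    (hσ : ∀ x, σ x ≠ 0) : PrequantumAtlas Ω where
  chart a := bundleChart L a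
  chart_mem a := bundleChart_mem a
  mem_source a := by
    rw [bundleChart, OpenPartialHomeomorph.restr_source,
      (trivializationAt ℂ L.Fiber a).open_baseSet.interior_eq]
    exact ⟨mem_chart_source E a, FiberBundle.mem_baseSet_trivializationAt' a⟩
  c := frameCoef σ
  c_ne_zero a x := by
    by_cases hx : x ∈ (trivializationAt ℂ L.Fiber a).baseSet
    · rw [frameCoef_of_mem σ hx]
      exact inv_ne_zero (coord_ne_zero hx (hσ x))
    · rw [frameCoef, if_neg hx]
      exact one_ne_zero
  θ a := chartForm (trivializationAt ℂ L.Fiber a) D (bundleChart L a)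
  contDiffOn_θ a := hD.contDiffOn_chartForm (bundleChart_mem a) (bundleChart_source_subset a)
  curvature a _ hu v w :=
    hD.curvature_chartForm hc (bundleChart_mem a) (bundleChart_source_subset a) hu v w
  compat a b x ha hb := by
    have ha' := bundleChart_source_subset a ha
    have hb' := bundleChart_source_subset b hb
    have h1 := hD.hasMFDerivAt_coord_frame ha' hb'
    rw [← frameCoef_div hσ ha' hb', ← chartForm_comp_mfderiv (bundleChart_mem a) ha,
      ← chartForm_comp_mfderiv (bundleChart_mem b) hb] at h1
    refine h1.congr_of_eventuallyEq ?_
    filter_upwards [(trivializationAt ℂ L.Fiber a).open_baseSet.mem_nhds ha',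
      (trivializationAt ℂ L.Fiber b).open_baseSet.mem_nhds hb'] with y hy hy'
    exact frameCoef_div hσ hy hy'

/-- A line bundle with connection that is trivial along an embedding gives local frames that are
flat along it. -/
theorem IsUnitary.exists_prequantumAtlas (hD : IsUnitary D h) (hc : HasCurvature D Ω)
    {F : Type*} [NormedAddCommGroup F] [NormedSpace ℝ F]
    {Q : Type*} [TopologicalSpace Q] [ChartedSpace F Q] [IsManifold 𝓘(ℝ, F) ∞ Q] {ι : Q → X}
    (hι : ContMDiff 𝓘(ℝ, F) 𝓘(ℝ, E) ∞ ι) (hinj : Function.Injective ι)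
    (hflat : IsTrivialFlatAlong F D h ι) : ∃ P : PrequantumAtlas Ω, P.IsFlatAlong (F := F) ι := by
  obtain ⟨s, hs1, hs⟩ := hflat
  have hs0 (q : Q) : s q ≠ 0 := by
    intro h0
    have := hs1 q
    rw [h0, map_zero] at this
    exact zero_ne_one this
  -- The global frame of the atlas is any nowhere vanishing extension of the parallel section; no
  -- continuity is needed away from `Q`.
  obtain ⟨σ₀, hσ₀, hσs⟩ := exists_section_extending hinj s hs0
  refine ⟨atlas hD hc hσ₀, fun a q hq ↦ ?_⟩
  have ha := bundleChart_source_subset a hq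
  set T := trivializationAt ℂ L.Fiber a
  obtain ⟨σ, hσ, hσeq, hσflat⟩ := hs q
  have hform : (atlas hD hc hσ₀).form a (ι q) = connectionForm T D (ι q) :=
    chartForm_comp_mfderiv (bundleChart_mem a) hq
  have hd := hasMFDerivAt_diff (((contMDiffAt_section_iff ha σ).1 (hσ (ι q))).mdifferentiableAt
    (by simp))
  have h1 := hd.comp q ((hι q).mdifferentiableAt (by simp)).hasMFDerivAt
  have hne : coord T (ι q) (σ (ι q)) ≠ 0 := by
    rw [hσeq.self_of_nhds]
    exact coord_ne_zero ha (hs0 q)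
  have hinv : HasFDerivAt (fun z : ℂ ↦ z⁻¹) (-ContinuousLinearMap.mulLeftRight ℝ ℂ
      (coord T (ι q) (σ (ι q)))⁻¹ (coord T (ι q) (σ (ι q)))⁻¹) (coord T (ι q) (σ (ι q))) :=
    hasFDerivAt_inv' hne
  have h2 := hinv.hasMFDerivAt.comp q h1
  have hceq (q' : Q) (h' : ι q' ∈ T.baseSet) (h'' : σ (ι q') = s q') :
      frameCoef σ₀ a (ι q') = (coord T (ι q') (σ (ι q')))⁻¹ := by
    rw [frameCoef_of_mem _ h', hσs, h'']
  refine (h2.congr_of_eventuallyEq (f₁ := fun q' ↦ (atlas hD hc hσ₀).c a (ι q')) ?_).congr_mfderiv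
    (ContinuousLinearMap.ext fun v ↦ ?_)
  · filter_upwards [hι.continuous.continuousAt.preimage_mem_nhds (T.open_baseSet.mem_nhds ha),
      hσeq] with q' h' h''
    exact hceq q' h' h''
  -- The coordinate `f` of the parallel section satisfies `df + f θ = 0` along `Q`, so `1 / f`,
  -- which is `c a` there, has logarithmic derivative `θ`.
  · have h3 := hD.coord_apply ha hd (mfderiv 𝓘(ℝ, F) 𝓘(ℝ, E) ι q v)
    rw [hσflat v] at h3
    have h4 : coord T (ι q) (0 : L.Fiber (ι q)) = 0 := by
      have := coord_smul ha (0 : ℂ) (0 : L.Fiber (ι q))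
      rwa [zero_smul, zero_mul] at this
    rw [h4] at h3
    rw [hform]
    change -((coord T (ι q) (σ (ι q)))⁻¹ * diff (E := E) (fun y ↦ coord T y (σ y)) (ι q)
      (mfderiv 𝓘(ℝ, F) 𝓘(ℝ, E) ι q v) * (coord T (ι q) (σ (ι q)))⁻¹) =
      frameCoef σ₀ a (ι q) * connectionForm T D (ι q) (mfderiv 𝓘(ℝ, F) 𝓘(ℝ, E) ι q v)
    rw [hceq q ha hσeq.self_of_nhds]
    generalize diff (E := E) (fun y ↦ coord T y (σ y)) (ι q)
      (mfderiv 𝓘(ℝ, F) 𝓘(ℝ, E) ι q v) = A at *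
    generalize connectionForm T D (ι q) (mfderiv 𝓘(ℝ, F) 𝓘(ℝ, E) ι q v) = B at *
    field_simp
    linear_combination h3

end LineBundle

end AtlasOfConnection

end BohrSommerfeld

namespace BohrSommerfeld

/-! ### The Cauchy transform along a complex line. -/

section CauchyTransform

open Set MeasureTheory intervalIntegral

variable {V G : Type*} [NormedAddCommGroup V] [NormedSpace ℝ V] [FiniteDimensional ℝ V]
  [NormedAddCommGroup G] [NormedSpace ℝ G] [CompleteSpace G]

theorem contDiff_integral_unitInterval {F : V × ℝ → G} (hF : ContDiff ℝ ∞ F) :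
    ContDiff ℝ ∞ fun v ↦ ∫ r in (0 : ℝ)..1, F (v, r) :=
  contDiffOn_univ.1 (contDiffOn_integral_unitInterval isOpen_univ hF.contDiffOn)

theorem fderiv_integral_unitInterval {F : V × ℝ → G} (hF : ContDiff ℝ ∞ F) (v w : V) :
    fderiv ℝ (fun v ↦ ∫ r in (0 : ℝ)..1, F (v, r)) v w =
      ∫ r in (0 : ℝ)..1, fderiv ℝ (fun v ↦ F (v, r)) v w := by
  have hd (r : ℝ) : fderiv ℝ (fun v ↦ F (v, r)) v = (fderiv ℝ F (v, r)).comp (.inl ℝ V ℝ) :=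
    ((hF.differentiable (by simp) _).hasFDerivAt.comp v (hasFDerivAt_prodMk_left v r)).fderiv
  have hc : Continuous fun r : ℝ ↦ (fderiv ℝ F (v, r)).comp (.inl ℝ V ℝ) := by
    have := hF.continuous_fderiv (by simp)
    fun_prop
  rw [(hasFDerivAt_integral_unitInterval isOpen_univ hF.contDiffOn (mem_univ v)).fderiv,
    ContinuousLinearMap.intervalIntegral_apply (hc.intervalIntegrable _ _)]
  simp only [hd]

variable {E : Type*} [NormedAddCommGroup E] [NormedSpace ℝ E] [FiniteDimensional ℝ E]

/-- The `(0,1)`-part, up to a factor `2`, of a real linear form with complex values. -/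
def antilinearPart (j : E →L[ℝ] E) : (E →L[ℝ] ℂ) →L[ℝ] E →L[ℝ] ℂ :=
  .id ℝ _ + Complex.I • (ContinuousLinearMap.compL ℝ E E ℂ).flip j

@[simp] theorem antilinearPart_apply (j : E →L[ℝ] E) (l : E →L[ℝ] ℂ) (v : E) :
    antilinearPart j l v = l v + Complex.I * l (j v) := rfl

/-- The points of the circle through `v` in the plane of `v` and `j v`. -/
def circleDir (j : E →L[ℝ] E) (v : E) (s : ℝ) : E :=
  Real.cos (2 * Real.pi * s) • v + Real.sin (2 * Real.pi * s) • j v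

variable (j : E →L[ℝ] E) (v₀ : E) (R : ℝ) {g : E → ℂ}

theorem contDiff_circleDir : ContDiff ℝ ∞ (circleDir j v₀) := by
  unfold circleDir
  have := Real.contDiff_cos (n := ∞)
  have := Real.contDiff_sin (n := ∞)
  fun_prop

theorem norm_circleDir_le (s : ℝ) : ‖circleDir j v₀ s‖ ≤ ‖v₀‖ + ‖j v₀‖ := by
  refine (norm_add_le _ _).trans (add_le_add ?_ ?_) <;> rw [norm_smul, Real.norm_eq_abs]
  · exact mul_le_of_le_one_left (norm_nonneg _) (Real.abs_cos_le_one _)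
  · exact mul_le_of_le_one_left (norm_nonneg _) (Real.abs_sin_le_one _)

/-- The Cauchy transform of `g` in the complex line of `v₀`, in polar coordinates. -/
def cauchyTransform (g : E → ℂ) (u : E) : ℂ :=
  ∫ s in (0 : ℝ)..1, ∫ r in (0 : ℝ)..1,
    Complex.exp (-(2 * Real.pi * s * Complex.I)) * g (u + (R * r) • circleDir j v₀ s)

/-- In polar coordinates the area element absorbs the pole of the Cauchy kernel, leaving a factor
`exp (-iφ)`. The integrand is smooth in all variables, so one may differentiate under both
integrals. -/
theorem contDiff_cauchyTransform_integrand (hg : ContDiff ℝ ∞ g) :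
    ContDiff ℝ ∞ fun q : (E × ℝ) × ℝ ↦ Complex.exp (-(2 * Real.pi * q.1.2 * Complex.I)) *
      g (q.1.1 + (R * q.2) • circleDir j v₀ q.1.2) := by
  have h1 := contDiff_circleDir j v₀
  have h2 : ContDiff ℝ ∞ fun s : ℝ ↦ (s : ℂ) := Complex.ofRealCLM.contDiff
  have h3 : ContDiff ℝ ∞ Complex.exp := Complex.contDiff_exp
  fun_prop

theorem contDiff_cauchyTransform (hg : ContDiff ℝ ∞ g) :
    ContDiff ℝ ∞ (cauchyTransform j v₀ R g) :=
  contDiff_integral_unitInterval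
    (contDiff_integral_unitInterval (contDiff_cauchyTransform_integrand j v₀ R hg))

theorem fderiv_cauchyTransform (hg : ContDiff ℝ ∞ g) (u w : E) :
    fderiv ℝ (cauchyTransform j v₀ R g) u w = ∫ s in (0 : ℝ)..1, ∫ r in (0 : ℝ)..1,
      Complex.exp (-(2 * Real.pi * s * Complex.I)) *
        fderiv ℝ g (u + (R * r) • circleDir j v₀ s) w := by
  have h0 := contDiff_cauchyTransform_integrand j v₀ R hg
  refine (fderiv_integral_unitInterval (contDiff_integral_unitInterval h0) u w).trans
    (integral_congr fun s _ ↦ ?_)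
  refine (fderiv_integral_unitInterval (F := fun q : E × ℝ ↦
    Complex.exp (-(2 * Real.pi * s * Complex.I)) * g (q.1 + (R * q.2) • circleDir j v₀ s))
    (h0.comp (f := fun q : E × ℝ ↦ ((q.1, s), q.2)) (by fun_prop)) u w).trans
    (integral_congr fun r _ ↦ ?_)
  have h1 : HasFDerivAt (fun v ↦ g (v + (R * r) • circleDir j v₀ s)) _ u :=
    (hg.differentiable (by simp) _).hasFDerivAt.comp u ((hasFDerivAt_id u).add_const _)
  change fderiv ℝ (fun v ↦ Complex.exp (-(2 * Real.pi * s * Complex.I)) *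
    g (v + (R * r) • circleDir j v₀ s)) u w = _
  rw [(h1.const_mul _).fderiv]
  simp

theorem antilinearPart_fderiv_cauchyTransform (hg : ContDiff ℝ ∞ g) (u w : E) :
    antilinearPart j (fderiv ℝ (cauchyTransform j v₀ R g) u) w =
      ∫ s in (0 : ℝ)..1, ∫ r in (0 : ℝ)..1, Complex.exp (-(2 * Real.pi * s * Complex.I)) *
        antilinearPart j (fderiv ℝ g (u + (R * r) • circleDir j v₀ s)) w := by
  have hc (w : E) : Continuous fun q : ℝ × ℝ ↦ Complex.exp (-(2 * Real.pi * q.1 * Complex.I)) *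
      fderiv ℝ g (u + (R * q.2) • circleDir j v₀ q.1) w := by
    have h1 := hg.continuous_fderiv (by simp)
    have h2 := (contDiff_circleDir j v₀).continuous
    fun_prop
  have hi (w : E) (s : ℝ) := ((hc w).comp (f := fun r : ℝ ↦ (s, r)) (by fun_prop)).intervalIntegrable
    (μ := volume) 0 1
  have hi' (w : E) := (continuous_parametric_intervalIntegral_of_continuous' (μ := volume)
    (f := fun s r : ℝ ↦ Complex.exp (-(2 * Real.pi * s * Complex.I)) *
      fderiv ℝ g (u + (R * r) • circleDir j v₀ s) w) (hc w) 0 1).intervalIntegrable (μ := volume) 0 1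
  rw [antilinearPart_apply, fderiv_cauchyTransform j v₀ R hg, fderiv_cauchyTransform j v₀ R hg,
    ← intervalIntegral.integral_const_mul, ← integral_add (hi' w) ((hi' (j w)).const_mul _)]
  refine integral_congr fun s _ ↦ ?_
  rw [← intervalIntegral.integral_const_mul]
  refine (integral_add (hi w s) ((hi (j w) s).const_mul _)).symm.trans (integral_congr fun r _ ↦ ?_)
  simp only [Function.comp, antilinearPart_apply]
  ring

/-- The Cauchy transform is holomorphic in the directions in which the function is. -/
theorem antilinearPart_fderiv_cauchyTransform_eq_zero (hg : ContDiff ℝ ∞ g) {u w : E}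
    (h : ∀ s, ∀ r ∈ Icc (0 : ℝ) 1,
      antilinearPart j (fderiv ℝ g (u + (R * r) • circleDir j v₀ s)) w = 0) :
    antilinearPart j (fderiv ℝ (cauchyTransform j v₀ R g) u) w = 0 := by
  rw [antilinearPart_fderiv_cauchyTransform j v₀ R hg]
  refine (integral_congr fun s _ ↦ ?_).trans (integral_zero (a := (0 : ℝ)) (b := 1))
  refine (integral_congr fun r hr ↦ ?_).trans (integral_zero (a := (0 : ℝ)) (b := 1))
  rw [uIcc_of_le zero_le_one] at hr
  simp only [h s r hr, mul_zero]

/-- The Cauchy transform solves the Cauchy-Riemann equation. -/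
theorem antilinearPart_fderiv_cauchyTransform_self (hg : ContDiff ℝ ∞ g) (hR : 0 < R) {u : E}
    (h : ∀ s, g (u + R • circleDir j v₀ s) = 0) :
    antilinearPart j (fderiv ℝ (cauchyTransform j v₀ R g) u) v₀ = -(R : ℂ)⁻¹ * g u := by
  let D' (s : ℝ) : E :=
    -Real.sin (2 * Real.pi * s) • v₀ + Real.cos (2 * Real.pi * s) • j v₀
  have hD' : Continuous D' := by fun_prop
  have hdir (s : ℝ) : HasDerivAt (circleDir j v₀) ((2 * Real.pi) • D' s) s := by
    have h0 : HasDerivAt (fun s : ℝ ↦ 2 * Real.pi * s) (2 * Real.pi) s := by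
      simpa using (hasDerivAt_id s).const_mul (2 * Real.pi)
    refine ((h0.cos.smul_const v₀).add (h0.sin.smul_const (j v₀))).congr_deriv ?_
    simp only [D', smul_add, smul_smul]
    congr 2 <;> ring
  have hgc := hg.continuous_fderiv (by simp)
  have hcc := (contDiff_circleDir j v₀).continuous
  have hc1 : Continuous fun q : ℝ × ℝ ↦
      fderiv ℝ g (u + (R * q.2) • circleDir j v₀ q.1) (circleDir j v₀ q.1) := by fun_prop
  have hc2 : Continuous fun q : ℝ × ℝ ↦
      fderiv ℝ g (u + (R * q.2) • circleDir j v₀ q.1) (D' q.1) := by fun_prop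
  -- Multiplied by `exp (-iφ)`, the Cauchy-Riemann operator is the radial derivative plus `I` times
  -- the angular one.
  have hsplit (s r : ℝ) : Complex.exp (-(2 * Real.pi * s * Complex.I)) *
      antilinearPart j (fderiv ℝ g (u + (R * r) • circleDir j v₀ s)) v₀ =
      fderiv ℝ g (u + (R * r) • circleDir j v₀ s) (circleDir j v₀ s) +
        Complex.I * fderiv ℝ g (u + (R * r) • circleDir j v₀ s) (D' s) := by
    generalize fderiv ℝ g (u + (R * r) • circleDir j v₀ s) = l
    have he : Complex.exp (-(2 * Real.pi * s * Complex.I)) =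
        (Real.cos (2 * Real.pi * s) : ℂ) - Real.sin (2 * Real.pi * s) * Complex.I := by
      rw [← neg_mul, Complex.exp_mul_I, Complex.cos_neg, Complex.sin_neg]
      push_cast
      ring
    simp only [circleDir, D', he, antilinearPart_apply, map_add, map_smul, Complex.real_smul,
      Complex.ofReal_neg]
    linear_combination (-Real.sin (2 * Real.pi * s) * l (j v₀)) * Complex.I_sq
  -- The radial part integrates to a difference of boundary values; the outer one vanishes by
  -- hypothesis and the inner one is at the centre `u`.
  have hr (s : ℝ) : ∫ r in (0 : ℝ)..1,
      fderiv ℝ g (u + (R * r) • circleDir j v₀ s) (circleDir j v₀ s) = -(R : ℂ)⁻¹ * g u := by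
    have hd (r : ℝ) : HasDerivAt (fun r : ℝ ↦ (R : ℂ)⁻¹ * g (u + (R * r) • circleDir j v₀ s))
        (fderiv ℝ g (u + (R * r) • circleDir j v₀ s) (circleDir j v₀ s)) r := by
      have h0 : HasDerivAt (fun r : ℝ ↦ u + (R * r) • circleDir j v₀ s) (R • circleDir j v₀ s) r := by
        simpa using (((hasDerivAt_id r).const_mul R).smul_const (circleDir j v₀ s)).const_add u
      have h1 := ((hg.differentiable (by simp) _).hasFDerivAt.comp_hasDerivAt r h0).const_mul
        (R : ℂ)⁻¹
      refine h1.congr_deriv ?_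
      rw [map_smul, Complex.real_smul, ← mul_assoc, inv_mul_cancel₀ (by exact_mod_cast hR.ne'),
        one_mul]
    rw [integral_eq_sub_of_hasDerivAt (fun r _ ↦ hd r) ((hc1.comp
      (f := fun r : ℝ ↦ (s, r)) (by fun_prop)).intervalIntegrable _ _)]
    simp [h s]
  -- The angular part is an exact derivative on a full circle, so its integral is zero. The excluded
  -- radius `r = 0` is negligible.
  have hs (r : ℝ) (hr : r ≠ 0) : ∫ s in (0 : ℝ)..1,
      fderiv ℝ g (u + (R * r) • circleDir j v₀ s) (D' s) = 0 := by
    have hne : (R * r * (2 * Real.pi) : ℂ) ≠ 0 := by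
      have : R * r * (2 * Real.pi) ≠ 0 := by positivity
      exact_mod_cast this
    have hd (s : ℝ) : HasDerivAt
        (fun s : ℝ ↦ (R * r * (2 * Real.pi) : ℂ)⁻¹ * g (u + (R * r) • circleDir j v₀ s))
        (fderiv ℝ g (u + (R * r) • circleDir j v₀ s) (D' s)) s := by
      have h0 := ((hdir s).const_smul (R * r)).const_add u
      have h1 := ((hg.differentiable (by simp) _).hasFDerivAt.comp_hasDerivAt s h0).const_mul
        (R * r * (2 * Real.pi) : ℂ)⁻¹
      refine h1.congr_deriv ?_
      rw [smul_smul, map_smul, Complex.real_smul, ← mul_assoc]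
      push_cast
      rw [inv_mul_cancel₀ hne, one_mul]
      rfl
    rw [integral_eq_sub_of_hasDerivAt (fun r _ ↦ hd r) ((hc2.comp
      (f := fun s : ℝ ↦ (s, r)) (by fun_prop)).intervalIntegrable _ _)]
    simp [circleDir]
  have hswap : ∫ s in (0 : ℝ)..1, ∫ r in (0 : ℝ)..1,
      fderiv ℝ g (u + (R * r) • circleDir j v₀ s) (D' s) = 0 := by
    rw [intervalIntegral_intervalIntegral_swap (F := fun s r : ℝ ↦
      fderiv ℝ g (u + (R * r) • circleDir j v₀ s) (D' s))
      (hc2.continuousOn.integrableOn_compact (isCompact_uIcc.prod isCompact_uIcc)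
        |>.mono_set (prod_mono uIoc_subset_uIcc uIoc_subset_uIcc))]
    refine (intervalIntegral.integral_congr_ae ?_).trans (integral_zero (a := (0 : ℝ)) (b := 1))
    refine .of_forall fun r hr ↦ hs r ?_
    rw [uIoc_of_le zero_le_one] at hr
    exact hr.1.ne'
  have hi1 (s : ℝ) := (hc1.comp (f := fun r : ℝ ↦ (s, r)) (by fun_prop)).intervalIntegrable
    (μ := volume) 0 1
  have hi2 (s : ℝ) := (hc2.comp (f := fun r : ℝ ↦ (s, r)) (by fun_prop)).intervalIntegrable
    (μ := volume) 0 1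
  have hi2' := (continuous_parametric_intervalIntegral_of_continuous' (μ := volume)
    (f := fun s r : ℝ ↦ fderiv ℝ g (u + (R * r) • circleDir j v₀ s) (D' s)) hc2 0 1
      ).intervalIntegrable (μ := volume) 0 1
  rw [antilinearPart_fderiv_cauchyTransform j v₀ R hg]
  have hin (s : ℝ) : ∫ r in (0 : ℝ)..1, Complex.exp (-(2 * Real.pi * s * Complex.I)) *
      antilinearPart j (fderiv ℝ g (u + (R * r) • circleDir j v₀ s)) v₀ = -(R : ℂ)⁻¹ * g u +
      Complex.I * ∫ r in (0 : ℝ)..1, fderiv ℝ g (u + (R * r) • circleDir j v₀ s) (D' s) := by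
    rw [← hr s, ← intervalIntegral.integral_const_mul]
    simp only [hsplit]
    exact integral_add (hi1 s) ((hi2 s).const_mul _)
  simp only [hin]
  rw [integral_add intervalIntegrable_const (hi2'.const_mul _),
    intervalIntegral.integral_const_mul Complex.I, hswap]
  simp

end CauchyTransform

end BohrSommerfeld

namespace BohrSommerfeld

/-! ### The Dolbeault lemma for `(0,1)`-forms. -/

section Dolbeault

open Set

variable {E : Type*} [NormedAddCommGroup E] [NormedSpace ℝ E] [FiniteDimensional ℝ E]
  {j : E →L[ℝ] E} {u₀ : E}

/-- Complex linear forms separate points from complex subspaces. -/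
theorem exists_complexLinear_form (hj : ∀ v, j (j v) = -v) {W : Submodule ℝ E}
    (hW : ∀ w ∈ W, j w ∈ W) {v₀ : E} (hv₀ : v₀ ∉ W) :
    ∃ l : E →L[ℝ] ℂ, (∀ v, l (j v) = Complex.I * l v) ∧ (∀ w ∈ W, l w = 0) ∧ l v₀ = 1 := by
  obtain ⟨m, hm0, hmW⟩ := Submodule.exists_le_ker_of_notMem hv₀
  let k : E →L[ℝ] ℂ := Complex.ofRealCLM ∘L m.toContinuousLinearMap
  -- For a real form `m` the combination `m - I m ∘ j` is complex linear, and it vanishes on `W`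
  -- because `W` is stable under `j`. Its real part at `v₀` is `m v₀ ≠ 0`.
  let l : E →L[ℝ] ℂ := k - Complex.I • k.comp j
  have hl (v : E) : l v = (m v : ℂ) - Complex.I * m (j v) := rfl
  have h0 : l v₀ ≠ 0 := by
    intro h
    have := congrArg Complex.re h
    rw [hl] at this
    simp at this
    exact hm0 this
  have hlW (w : E) (hw : w ∈ W) : l w = 0 := by
    have h1 : m w = 0 := hmW hw
    have h2 : m (j w) = 0 := hmW (hW w hw)
    simp [hl, h1, h2]
  refine ⟨(l v₀)⁻¹ • l, fun v ↦ ?_, fun w hw ↦ ?_, ?_⟩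
  · change (l v₀)⁻¹ * l (j v) = Complex.I * ((l v₀)⁻¹ * l v)
    rw [hl (j v), hl v, hj, map_neg, Complex.ofReal_neg]
    linear_combination ((l v₀)⁻¹ * m (j v)) * Complex.I_sq
  · change (l v₀)⁻¹ * l w = 0
    rw [hlW w hw, mul_zero]
  · exact inv_mul_cancel₀ h0

theorem fderiv_apply_const {η : E → E →L[ℝ] ℂ} {u : E} (h : DifferentiableAt ℝ η u) (v w : E) :
    fderiv ℝ (fun u ↦ η u w) u v = fderiv ℝ η u v w := by
  rw [(h.hasFDerivAt.clm_apply (hasFDerivAt_const w u)).fderiv]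
  simp

/-- One step in the solution of the Cauchy-Riemann equations. -/
theorem exists_antilinearPart_fderiv_eq_of_notMem (hj : ∀ v, j (j v) = -v) {R : ℝ} (hR : 0 < R)
    {η : E → E →L[ℝ] ℂ} (hη : ContDiffOn ℝ ∞ η (Metric.ball u₀ R))
    (hclosed : ∀ u ∈ Metric.ball u₀ R, ∀ v w, antilinearPart j (fderiv ℝ (fun u ↦ η u w) u) v =
      antilinearPart j (fderiv ℝ (fun u ↦ η u v) u) w)
    {W : Submodule ℝ E} (hW : ∀ w ∈ W, j w ∈ W)
    (hηW : ∀ u ∈ Metric.ball u₀ R, ∀ w ∈ W, η u w = 0) {v₀ : E} (hv₀ : v₀ ∉ W) :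
    ∃ r > 0, ∃ f : E → ℂ, ContDiff ℝ ∞ f ∧ ∀ u ∈ Metric.ball u₀ r,
      (∀ w ∈ W, antilinearPart j (fderiv ℝ f u) w = 0) ∧
        antilinearPart j (fderiv ℝ f u) v₀ = η u v₀ := by
  obtain ⟨l, hlj, hlW, hlv⟩ := exists_complexLinear_form hj hW hv₀
  obtain ⟨h, hh, -, hheq⟩ := exists_smooth_eventuallyEq (E := E) (X := E) (f := fun u ↦ η u v₀)
    (x := u₀) (W := univ) (by
      filter_upwards [Metric.ball_mem_nhds u₀ hR] with u hu
      exact ((hη.contDiffAt (Metric.isOpen_ball.mem_nhds hu)).clm_apply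
        contDiffAt_const).contMDiffAt) Filter.univ_mem
  replace hh : ContDiff ℝ ∞ h := hh.contDiff
  obtain ⟨p, hp, hpsub⟩ := Metric.mem_nhds_iff.1 (Filter.inter_mem hheq (Metric.ball_mem_nhds u₀ hR))
  set K := ‖v₀‖ + ‖j v₀‖ with hK
  have hK0 : 0 ≤ K := by positivity
  -- The circle of radius `ε` in the line of `v₀` has norm at most `ε K < p / 2`, so translates by
  -- points within `p / 2` of the centre stay in the ball of radius `p`.
  set ε := p / (2 * (K + 1)) with hε
  have hε0 : 0 < ε := by positivity
  have hεK : ε * K < p / 2 := by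
    rw [hε, div_mul_eq_mul_div, div_lt_div_iff₀ (by positivity) (by positivity)]
    nlinarith
  -- The cutoff is composed with `l`, hence constant along `W`: it truncates in the direction `v₀`
  -- without disturbing the equations already satisfied along `W`.
  let χ : ContDiffBump (0 : ℂ) := ⟨ε / 4, ε / 2, by positivity, by linarith⟩
  let g : E → ℂ := fun u ↦ χ (l (u - u₀)) • h u
  have hχ : ContDiff ℝ ∞ χ := χ.contDiff
  have hg : ContDiff ℝ ∞ g := by fun_prop
  -- The first bound keeps the discs inside the ball of radius `p`; the second gives `‖l (u - u₀)‖ ≤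
  -- ε / 4`, where the cutoff is 1.
  set δ := min (p / 2) (ε / (4 * (‖l‖ + 1))) with hδ
  have hδ0 : 0 < δ := by positivity
  have hlδ {u : E} (hu : u ∈ Metric.ball u₀ δ) : ‖l (u - u₀)‖ ≤ ε / 4 := by
    rw [mem_ball_iff_norm] at hu
    calc ‖l (u - u₀)‖ ≤ ‖l‖ * ‖u - u₀‖ := l.le_opNorm _
      _ ≤ (‖l‖ + 1) * (ε / (4 * (‖l‖ + 1))) := by
        gcongr
        · linarith
        · exact hu.le.trans (min_le_right _ _)
      _ = ε / 4 := by field_simp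
  have hmem {u : E} (hu : u ∈ Metric.ball u₀ δ) (s : ℝ) {r : ℝ} (hr : r ∈ Icc (0 : ℝ) 1) :
      u + (ε * r) • circleDir j v₀ s ∈ Metric.ball u₀ p := by
    rw [mem_ball_iff_norm] at hu ⊢
    have h1 : ‖(ε * r) • circleDir j v₀ s‖ ≤ ε * K := by
      rw [norm_smul, Real.norm_eq_abs, abs_of_nonneg (mul_nonneg hε0.le hr.1)]
      gcongr
      · exact mul_le_of_le_one_right hε0.le hr.2
      · exact norm_circleDir_le j v₀ s
    have h2 : u + (ε * r) • circleDir j v₀ s - u₀ = (u - u₀) + (ε * r) • circleDir j v₀ s := by abel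
    rw [h2]
    have := norm_add_le (u - u₀) ((ε * r) • circleDir j v₀ s)
    have := hu.trans_le (min_le_left (p / 2) _)
    linarith
  -- Closedness exchanges the derivative of `η v₀` along `W` with the derivative of `η w` along
  -- `v₀`, which is zero since `η` vanishes on `W`.
  have hgW {u : E} (hu : u ∈ Metric.ball u₀ p) {w : E} (hw : w ∈ W) :
      antilinearPart j (fderiv ℝ g u) w = 0 := by
    have h1 : HasFDerivAt (fun u ↦ χ (l (u - u₀))) ((fderiv ℝ χ (l (u - u₀))).comp l) u :=
      (hχ.differentiable (by simp) _).hasFDerivAt.comp u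
        (l.hasFDerivAt.comp u ((hasFDerivAt_id u).sub_const u₀))
    have h2 : fderiv ℝ g u = χ (l (u - u₀)) • fderiv ℝ h u +
        ((fderiv ℝ χ (l (u - u₀))).comp l).smulRight (h u) :=
      (h1.smul (hh.differentiable (by simp) u).hasFDerivAt).fderiv
    have h3 : fderiv ℝ h u = fderiv ℝ (fun u ↦ η u v₀) u := by
      refine Filter.EventuallyEq.fderiv_eq ?_
      filter_upwards [Metric.isOpen_ball.mem_nhds hu] with y hy using (hpsub hy).1
    have h4 : fderiv ℝ (fun u ↦ η u w) u = 0 := by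
      refine (Filter.EventuallyEq.fderiv_eq (f := fun _ ↦ 0) ?_).trans (by simp)
      filter_upwards [Metric.isOpen_ball.mem_nhds hu] with y hy using hηW y (hpsub hy).2 w hw
    have h5 := hclosed u (hpsub hu).2 w v₀
    rw [h4, ← h3, map_zero, zero_apply, antilinearPart_apply] at h5
    rw [h2, antilinearPart_apply]
    simp only [add_apply, smul_apply, ContinuousLinearMap.smulRight_apply,
      ContinuousLinearMap.comp_apply, hlW w hw, hlW _ (hW w hw), map_zero, zero_smul, add_zero,
      Complex.real_smul]
    linear_combination (χ (l (u - u₀)) : ℂ) * h5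
  -- On the circle `l` is shifted by a complex number of modulus `ε`, so its modulus is at least `3ε
  -- / 4`, beyond the support radius `ε / 2` of the cutoff.
  have hgR {u : E} (hu : u ∈ Metric.ball u₀ δ) (s : ℝ) : g (u + ε • circleDir j v₀ s) = 0 := by
    have h1 : l (u + ε • circleDir j v₀ s - u₀) =
        l (u - u₀) + ε * Complex.exp ((2 * Real.pi * s : ℝ) * Complex.I) := by
      rw [add_sub_right_comm, map_add, map_smul, Complex.exp_mul_I, circleDir, map_add, map_smul,
        map_smul, hlj, hlv]
      simp [mul_add]
    have h2 : ‖(ε : ℂ) * Complex.exp ((2 * Real.pi * s : ℝ) * Complex.I)‖ = ε := by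
      rw [norm_mul, Complex.norm_exp_ofReal_mul_I, Complex.norm_real, Real.norm_eq_abs,
        abs_of_pos hε0, mul_one]
    have h3 : χ (l (u + ε • circleDir j v₀ s - u₀)) = 0 := by
      refine χ.zero_of_le_dist ?_
      rw [dist_zero_right, h1]
      have h4 := norm_sub_norm_le ((ε : ℂ) * Complex.exp ((2 * Real.pi * s : ℝ) * Complex.I))
        (-l (u - u₀))
      rw [norm_neg, sub_neg_eq_add, h2, add_comm] at h4
      have := hlδ hu
      change ε / 2 ≤ _
      linarith
    change χ (l (u + ε • circleDir j v₀ s - u₀)) • _ = (0 : ℂ)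
    rw [h3, zero_smul]
  have hsmooth := contDiff_cauchyTransform j v₀ ε hg
  have hfd (u : E) : fderiv ℝ (fun u ↦ (-ε : ℂ) * cauchyTransform j v₀ ε g u) u =
      (-ε : ℂ) • fderiv ℝ (cauchyTransform j v₀ ε g) u :=
    ((hsmooth.differentiable (by simp) u).hasFDerivAt.const_mul _).fderiv
  have hA (u w : E) : antilinearPart j
      (fderiv ℝ (fun u ↦ (-ε : ℂ) * cauchyTransform j v₀ ε g u) u) w =
        -ε * antilinearPart j (fderiv ℝ (cauchyTransform j v₀ ε g) u) w := by
    rw [hfd, antilinearPart_apply, antilinearPart_apply, smul_apply, smul_apply, smul_eq_mul,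
      smul_eq_mul]
    ring
  refine ⟨δ, hδ0, fun u ↦ (-ε : ℂ) * cauchyTransform j v₀ ε g u, contDiff_const.mul hsmooth,
    fun u hu ↦ ⟨fun w hw ↦ ?_, ?_⟩⟩
  · rw [hA, antilinearPart_fderiv_cauchyTransform_eq_zero j v₀ ε hg
      fun s r hr ↦ hgW (hmem hu s hr) hw, mul_zero]
  · rw [hA, antilinearPart_fderiv_cauchyTransform_self j v₀ ε hg hε0 (hgR hu)]
    have h1 : χ (l (u - u₀)) = 1 := χ.one_of_mem_closedBall (by simpa using hlδ hu)
    have h2 : h u = η u v₀ :=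
      (hpsub (Metric.ball_subset_ball ((min_le_left _ _).trans (by linarith)) hu)).1
    have h3 : (ε : ℂ) ≠ 0 := by exact_mod_cast hε0.ne'
    change -ε * (-(ε : ℂ)⁻¹ * (χ (l (u - u₀)) • h u)) = _
    rw [h1, one_smul, h2]
    field_simp

/-- This is `∂̄² = 0`, a consequence of the symmetry of the second derivative. -/
theorem antilinearPart_fderiv_symm {f : E → ℂ} {u : E} (hf : ContDiffAt ℝ ∞ f u) (v w : E) :
    antilinearPart j (fderiv ℝ (fun u ↦ antilinearPart j (fderiv ℝ f u) w) u) v =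
      antilinearPart j (fderiv ℝ (fun u ↦ antilinearPart j (fderiv ℝ f u) v) u) w := by
  have hs : IsSymmSndFDerivAt ℝ f u := hf.isSymmSndFDerivAt (by
    rw [minSmoothness_of_isRCLikeNormedField]
    exact WithTop.coe_le_coe.2 (le_top (a := (2 : ℕ∞))))
  have hd : DifferentiableAt ℝ (fderiv ℝ f) u :=
    (hf.fderiv_right (m := ∞) (by simp)).differentiableAt (by simp)
  have hd' := ((antilinearPart j).hasFDerivAt.comp u hd.hasFDerivAt)
  have hc (v w : E) : fderiv ℝ (fun u ↦ antilinearPart j (fderiv ℝ f u) w) u v =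
      antilinearPart j (fderiv ℝ (fderiv ℝ f) u v) w := by
    refine (fderiv_apply_const hd'.differentiableAt v w).trans ?_
    rw [hd'.fderiv]
    rfl
  rw [antilinearPart_apply, antilinearPart_apply, hc, hc, hc, hc]
  simp only [antilinearPart_apply, hs.eq v w, hs.eq v (j w), hs.eq (j v) w, hs.eq (j v) (j w)]
  ring

/-- The Dolbeault lemma for `(0,1)`-forms that vanish on a complex subspace. -/
theorem exists_antilinearPart_fderiv_eq_of_vanishing (hj : ∀ v, j (j v) = -v) (W : Submodule ℝ E) :
    ∀ R > 0, ∀ η : E → E →L[ℝ] ℂ, ContDiffOn ℝ ∞ η (Metric.ball u₀ R) →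
    (∀ u ∈ Metric.ball u₀ R, ∀ v, η u (j v) = -Complex.I * η u v) →
    (∀ u ∈ Metric.ball u₀ R, ∀ v w, antilinearPart j (fderiv ℝ (fun u ↦ η u w) u) v =
      antilinearPart j (fderiv ℝ (fun u ↦ η u v) u) w) →
    (∀ w ∈ W, j w ∈ W) → (∀ u ∈ Metric.ball u₀ R, ∀ w ∈ W, η u w = 0) →
    ∃ r > 0, ∃ f : E → ℂ, ContDiffOn ℝ ∞ f (Metric.ball u₀ r) ∧
      ∀ u ∈ Metric.ball u₀ r, antilinearPart j (fderiv ℝ f u) = η u := by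
  -- The induction runs upwards on the subspace where `η` vanishes, and it terminates because the
  -- dimension is finite; when `W` is everything, `η` is zero.
  induction W using WellFoundedGT.induction with
  | ind W ih =>
  intro R hR η hη htype hclosed hW hηW
  by_cases htop : W = ⊤
  · refine ⟨R, hR, fun _ ↦ 0, contDiffOn_const, fun u hu ↦ ?_⟩
    ext v
    simp [hηW u hu v (by rw [htop]; trivial)]
  obtain ⟨v₀, hv₀⟩ : ∃ v₀, v₀ ∉ W := by
    by_contra! hall
    exact htop (Submodule.eq_top_iff'.2 hall)
  obtain ⟨r₁, hr₁, f₁, hf₁, hf₁W⟩ :=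
    exists_antilinearPart_fderiv_eq_of_notMem hj hR hη hclosed hW hηW hv₀
  have hsub1 : Metric.ball u₀ (min r₁ R) ⊆ Metric.ball u₀ r₁ :=
    Metric.ball_subset_ball (min_le_left _ _)
  have hsub2 : Metric.ball u₀ (min r₁ R) ⊆ Metric.ball u₀ R :=
    Metric.ball_subset_ball (min_le_right _ _)
  have hdb : ContDiff ℝ ∞ fun u ↦ antilinearPart j (fderiv ℝ f₁ u) :=
    (antilinearPart j).contDiff.comp (hf₁.fderiv_right (by simp))
  have htype1 (u v : E) : antilinearPart j (fderiv ℝ f₁ u) (j v) =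
      -Complex.I * antilinearPart j (fderiv ℝ f₁ u) v := by
    rw [antilinearPart_apply, antilinearPart_apply, hj, map_neg]
    linear_combination fderiv ℝ f₁ u (j v) * Complex.I_sq
  -- After subtracting the antilinear part of the differential of `f₁` the form vanishes on `W` and
  -- at `v₀`, and at `j v₀` because of its type: it vanishes on a strictly larger complex subspace.
  let W' := W ⊔ Submodule.span ℝ {v₀, j v₀}
  have hv₀' : v₀ ∈ W' := Submodule.mem_sup_right (Submodule.subset_span (by simp))
  have hjv₀' : j v₀ ∈ W' := Submodule.mem_sup_right (Submodule.subset_span (by simp))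
  have hlt : W < W' := lt_of_le_of_ne le_sup_left fun h ↦ hv₀ (h ▸ hv₀')
  have hW' : W' ≤ W'.comap j.toLinearMap := by
    refine sup_le (fun w hw ↦ Submodule.mem_sup_left (hW w hw)) (Submodule.span_le.2 ?_)
    rintro _ (rfl | rfl)
    · exact hjv₀'
    · change j (j _) ∈ W'
      rw [hj]
      exact neg_mem hv₀'
  obtain ⟨r₂, hr₂, f₂, hf₂, hf₂η⟩ := ih W' hlt (min r₁ R) (lt_min hr₁ hR)
    (fun u ↦ η u - antilinearPart j (fderiv ℝ f₁ u)) ((hη.mono hsub2).sub hdb.contDiffOn)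
    (fun u hu v ↦ by
      rw [sub_apply, sub_apply, htype1, htype u (hsub2 hu)]
      ring)
    (fun u hu v w ↦ by
      have hsplit (w : E) : fderiv ℝ (fun u ↦ (η u - antilinearPart j (fderiv ℝ f₁ u)) w) u =
          fderiv ℝ (fun u ↦ η u w) u -
            fderiv ℝ (fun u ↦ antilinearPart j (fderiv ℝ f₁ u) w) u :=
        fderiv_fun_sub
          (((hη.contDiffAt (Metric.isOpen_ball.mem_nhds (hsub2 hu))).differentiableAt
            (by simp)).clm_apply (differentiableAt_const _))
          ((hdb.differentiable (by simp) u).clm_apply (differentiableAt_const _))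
      rw [hsplit, hsplit, map_sub, map_sub, sub_apply, sub_apply, hclosed u (hsub2 hu),
        antilinearPart_fderiv_symm hf₁.contDiffAt])
    hW'
    (fun u hu ↦ by
      have hle : W' ≤ LinearMap.ker (η u - antilinearPart j (fderiv ℝ f₁ u)).toLinearMap := by
        have h0 : η u v₀ - antilinearPart j (fderiv ℝ f₁ u) v₀ = 0 := by
          rw [(hf₁W u (hsub1 hu)).2, sub_self]
        refine sup_le (fun w hw ↦ ?_) (Submodule.span_le.2 ?_)
        · change η u w - antilinearPart j (fderiv ℝ f₁ u) w = 0
          rw [(hf₁W u (hsub1 hu)).1 w hw, hηW u (hsub2 hu) w hw, sub_zero]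
        · rintro _ (rfl | rfl)
          · exact h0
          · change η u (j _) - antilinearPart j (fderiv ℝ f₁ u) (j _) = 0
            rw [htype1, htype u (hsub2 hu), ← mul_sub, h0, mul_zero]
      exact fun w hw ↦ hle hw)
  refine ⟨r₂, hr₂, fun u ↦ f₁ u + f₂ u, hf₁.contDiffOn.add hf₂, fun u hu ↦ ?_⟩
  rw [fderiv_fun_add (hf₁.differentiable (by simp) u)
    ((hf₂.contDiffAt (Metric.isOpen_ball.mem_nhds hu)).differentiableAt (by simp)), map_add,
    hf₂η u hu, add_sub_cancel]

/-- A connection form whose curvature is of type `(1,1)` is of type `(1,0)` in a suitable frame. -/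
theorem exists_add_fderiv_complexLinear (hj : ∀ v, j (j v) = -v) {R : ℝ} (hR : 0 < R)
    {θ : E → E →L[ℝ] ℂ} (hθ : ContDiffOn ℝ ∞ θ (Metric.ball u₀ R))
    (hcurv : ∀ u ∈ Metric.ball u₀ R, ∀ v w,
      fderiv ℝ θ u (j v) (j w) - fderiv ℝ θ u (j w) (j v) =
        fderiv ℝ θ u v w - fderiv ℝ θ u w v) :
    ∃ r > 0, ∃ f : E → ℂ, ContDiffOn ℝ ∞ f (Metric.ball u₀ r) ∧
      ∀ u ∈ Metric.ball u₀ r, ∀ v,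
        (θ u + fderiv ℝ f u) (j v) = Complex.I * (θ u + fderiv ℝ f u) v := by
  have hd (u : E) (hu : u ∈ Metric.ball u₀ R) : DifferentiableAt ℝ θ u :=
    (hθ.contDiffAt (Metric.isOpen_ball.mem_nhds hu)).differentiableAt (by simp)
  -- The lemma is applied with `W = ⊥` to minus the antilinear part of `θ`. Closedness of that form
  -- is obtained by combining the invariance of `dθ` for the pairs `(v, w)` and `(v, j w)`.
  obtain ⟨r, hr, f, hf, hfη⟩ := exists_antilinearPart_fderiv_eq_of_vanishing (u₀ := u₀) hj ⊥ R hR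
    (fun u ↦ -antilinearPart j (θ u)) ((antilinearPart j).contDiff.comp_contDiffOn hθ).neg
    (fun u _ v ↦ by
      rw [neg_apply, neg_apply, antilinearPart_apply, antilinearPart_apply, hj, map_neg]
      linear_combination -θ u (j v) * Complex.I_sq)
    (fun u hu v w ↦ by
      have hc (v w : E) : fderiv ℝ (fun u ↦ (-antilinearPart j (θ u)) w) u v =
          -(fderiv ℝ θ u v w + Complex.I * fderiv ℝ θ u v (j w)) := by
        have h1 := ((antilinearPart j).hasFDerivAt.comp u (hd u hu).hasFDerivAt).neg
        refine (fderiv_apply_const h1.differentiableAt v w).trans ?_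
        rw [h1.fderiv]
        rfl
      rw [antilinearPart_apply, antilinearPart_apply, hc, hc, hc, hc]
      have h1 := hcurv u hu v w
      have h2 := hcurv u hu v (j w)
      rw [hj, map_neg, map_neg, neg_apply] at h2
      linear_combination h1 + Complex.I * h2 -
        (fderiv ℝ θ u (j v) (j w) - fderiv ℝ θ u (j w) (j v)) * Complex.I_sq)
    (by simp) (by simp)
  refine ⟨r, hr, f, hf, fun u hu v ↦ ?_⟩
  have h1 := congrArg (fun l : E →L[ℝ] ℂ ↦ l v) (hfη u hu)
  simp only [neg_apply, antilinearPart_apply] at h1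
  rw [add_apply, add_apply]
  linear_combination -Complex.I * h1 + (fderiv ℝ f u (j v) + θ u (j v)) * Complex.I_sq

end Dolbeault

end BohrSommerfeld

namespace BohrSommerfeld

/-! ### Changes of local frames. -/

section Gauge

open Set

variable {F : Type*} [NormedAddCommGroup F] [NormedSpace ℝ F]
  {M : Type*} [TopologicalSpace M] [ChartedSpace F M]
  {𝔸 : Type*} [NormedCommRing 𝔸] [NormedAlgebra ℝ 𝔸]

/-- Logarithmic derivatives add up. -/
theorem hasMFDerivAt_mul_smul {g h : M → 𝔸} {x : M} {κ κ' : F →L[ℝ] 𝔸}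
    (hg : HasMFDerivAt 𝓘(ℝ, F) 𝓘(ℝ, 𝔸) g x (g x • κ : F →L[ℝ] 𝔸))
    (hh : HasMFDerivAt 𝓘(ℝ, F) 𝓘(ℝ, 𝔸) h x (h x • κ' : F →L[ℝ] 𝔸)) :
    HasMFDerivAt 𝓘(ℝ, F) 𝓘(ℝ, 𝔸) (fun y ↦ g y * h y) x ((g x * h x) • (κ + κ') : F →L[ℝ] 𝔸) := by
  refine (hg.mul hh).congr_mfderiv (ContinuousLinearMap.ext fun v ↦ ?_)
  change g x * (h x * κ' v) + h x * (g x * κ v) = (g x * h x) * (κ v + κ' v)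
  ring

theorem hasMFDerivAt_cexp {φ : M → ℂ} {x : M} {κ : F →L[ℝ] ℂ}
    (h : HasMFDerivAt 𝓘(ℝ, F) 𝓘(ℝ, ℂ) φ x κ) :
    HasMFDerivAt 𝓘(ℝ, F) 𝓘(ℝ, ℂ) (fun y ↦ Complex.exp (φ y)) x
      (Complex.exp (φ x) • κ : F →L[ℝ] ℂ) := by
  have h1 : HasFDerivAt Complex.exp (Complex.exp (φ x) • ContinuousLinearMap.id ℝ ℂ) (φ x) := by
    refine ((Complex.hasDerivAt_exp (φ x)).hasFDerivAt.restrictScalars ℝ).congr_fderiv ?_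
    ext; simp [mul_comm]
  exact (h1.hasMFDerivAt.comp x h).congr_mfderiv (ContinuousLinearMap.ext fun v ↦ rfl)

theorem hasMFDerivAt_normSq_cexp {φ : M → ℂ} {x : M} {κ : F →L[ℝ] ℂ}
    (h : HasMFDerivAt 𝓘(ℝ, F) 𝓘(ℝ, ℂ) φ x κ) :
    HasMFDerivAt 𝓘(ℝ, F) 𝓘(ℝ, ℝ) (fun y ↦ Complex.normSq (Complex.exp (φ y))) x
      (Complex.normSq (Complex.exp (φ x)) • ((2 : ℝ) • Complex.reCLM.comp κ) : F →L[ℝ] ℝ) := by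
  have hn (z : ℂ) : Complex.normSq (Complex.exp z) = Real.exp (2 * z.re) := by
    rw [Complex.normSq_eq_norm_sq, Complex.norm_exp, ← Real.exp_nat_mul]
    simp
  have h1 : HasFDerivAt (fun z : ℂ ↦ Real.exp (2 * z.re))
      (Real.exp (2 * (φ x).re) • ((2 : ℝ) • Complex.reCLM)) (φ x) :=
    (Complex.reCLM.hasFDerivAt.const_mul (2 : ℝ)).exp
  rw [hn]
  refine HasMFDerivAt.congr_of_eventuallyEq ?_ (.of_forall fun y ↦ hn (φ y))
  exact (h1.hasMFDerivAt.comp x h).congr_mfderiv (ContinuousLinearMap.ext fun v ↦ rfl)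

variable {E : Type*} [NormedAddCommGroup E] [NormedSpace ℝ E]
  {X : Type*} [TopologicalSpace X] [ChartedSpace E X] [IsManifold 𝓘(ℝ, E) ∞ X] {Ω : TwoForm E X}

namespace PrequantumAtlas

variable (P : PrequantumAtlas Ω)

/-- A change of the local frame `P.c a` in a smaller chart around `a`. -/
structure GaugeChange (a : X) where
  chart : OpenPartialHomeomorph X E
  chart_mem : chart ∈ IsManifold.maximalAtlas 𝓘(ℝ, E) ∞ X
  mem_source : a ∈ chart.source
  source_subset : chart.source ⊆ (P.chart a).source
  f : E → ℂ
  contDiffOn_f : ContDiffOn ℝ ∞ f chart.target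

variable {P}

namespace GaugeChange

variable {a : X} (T : P.GaugeChange a)

/-- The connection form of the new frame in the new chart. -/
def θ (u : E) : E →L[ℝ] ℂ :=
  pullbackForm (P.θ a) (P.chart a ∘ T.chart.symm) u + fderiv ℝ T.f u

/-- The derivative of the logarithm of the change of frames. -/
def df (x : X) : E →L[ℝ] ℂ :=
  (fderiv ℝ T.f (T.chart x)).comp (mfderiv 𝓘(ℝ, E) 𝓘(ℝ, E) T.chart x)

theorem symm_mem {u : E} (hu : u ∈ T.chart.target) : T.chart.symm u ∈ (P.chart a).source :=
  T.source_subset (T.chart.map_target hu)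

theorem contDiffAt_f {u : E} (hu : u ∈ T.chart.target) : ContDiffAt ℝ ∞ T.f u :=
  T.contDiffOn_f.contDiffAt (T.chart.open_target.mem_nhds hu)

theorem contDiffOn_θ : ContDiffOn ℝ ∞ T.θ T.chart.target := fun _ hu ↦
  ((P.contDiffAt_pullback (contMDiffAt_chart_symm T.chart_mem hu) (T.symm_mem hu)).add
    ((T.contDiffAt_f hu).fderiv_right (by simp))).contDiffWithinAt

/-- An exact form is added to the connection form, and the second derivative of `f` is symmetric. -/
theorem curvature {u : E} (hu : u ∈ T.chart.target) (v w : E) :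
    fderiv ℝ T.θ u v w - fderiv ℝ T.θ u w v =
      -2 * Complex.I * Real.pi * (Ω.inChart T.chart u ![v, w] : ℝ) := by
  have h1 := P.fderiv_pullback_sub (contMDiffAt_chart_symm T.chart_mem hu) (T.symm_mem hu) v w
  have h2 := P.contDiffAt_pullback (contMDiffAt_chart_symm T.chart_mem hu) (T.symm_mem hu)
  have h3 := (T.contDiffAt_f hu).fderiv_right (m := ∞) (by simp)
  have hs : IsSymmSndFDerivAt ℝ T.f u := (T.contDiffAt_f hu).isSymmSndFDerivAt (by
    rw [minSmoothness_of_isRCLikeNormedField]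
    exact WithTop.coe_le_coe.2 (le_top (a := (2 : ℕ∞))))
  have h4 : fderiv ℝ T.θ u = _ :=
    fderiv_fun_add (h2.differentiableAt (by simp)) (h3.differentiableAt (by simp))
  rw [h4, add_apply, add_apply, add_apply, add_apply, hs.eq v w, TwoForm.inChart_apply]
  linear_combination h1

theorem θ_comp_mfderiv {x : X} (hx : x ∈ T.chart.source) :
    (T.θ (T.chart x)).comp (mfderiv 𝓘(ℝ, E) 𝓘(ℝ, E) T.chart x : E →L[ℝ] E) =
      P.form a x + T.df x := by
  have hu := T.chart.map_source hx
  refine ContinuousLinearMap.ext fun v ↦ congrArg (· + T.df x v) ?_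
  rw [← P.form_comp_mfderiv (mdifferentiableAt_chart_symm T.chart_mem hu) (T.symm_mem hu)]
  refine (congrArg (P.form a (T.chart.symm (T.chart x)))
    (mfderiv_chart_symm_chart T.chart_mem hx v)).trans ?_
  rw [T.chart.left_inv hx]
  rfl

theorem hasMFDerivAt_f {x : X} (hx : x ∈ T.chart.source) :
    HasMFDerivAt 𝓘(ℝ, E) 𝓘(ℝ, ℂ) (fun y ↦ T.f (T.chart y)) x (T.df x) :=
  ((T.contDiffAt_f (T.chart.map_source hx)).differentiableAt (by simp)).hasFDerivAt.hasMFDerivAt.comp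
    x (mdifferentiableAt_chart T.chart_mem hx).hasMFDerivAt

end GaugeChange

/-- Local frames after a change of gauge. -/
def gauge (T : (a : X) → P.GaugeChange a) : PrequantumAtlas Ω where
  chart a := (T a).chart
  chart_mem a := (T a).chart_mem
  mem_source a := (T a).mem_source
  c a x := P.c a x * Complex.exp ((T a).f ((T a).chart x))
  c_ne_zero a x := mul_ne_zero (P.c_ne_zero a x) (Complex.exp_ne_zero _)
  θ a := (T a).θ
  contDiffOn_θ a := (T a).contDiffOn_θ
  curvature a _ hu := (T a).curvature hu
  compat a b x ha hb := by
    rw [(T a).θ_comp_mfderiv ha, (T b).θ_comp_mfderiv hb]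
    have h1 := P.compat a b x ((T a).source_subset ha) ((T b).source_subset hb)
    have h2 := hasMFDerivAt_cexp (((T a).hasMFDerivAt_f ha).sub ((T b).hasMFDerivAt_f hb))
    have h3 := hasMFDerivAt_mul_smul h1 h2
    have hc (y : X) : P.c a y * Complex.exp ((T a).f ((T a).chart y)) /
        (P.c b y * Complex.exp ((T b).f ((T b).chart y))) = P.c a y / P.c b y *
          Complex.exp ((T a).f ((T a).chart y) - (T b).f ((T b).chart y)) := by
      rw [Complex.exp_sub, mul_div_mul_comm]
    rw [hc]
    refine (h3.congr_mfderiv ?_).congr_of_eventuallyEq (.of_forall hc)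
    change _ • ((P.form a x - P.form b x) + _) = _
    congr 1
    abel

variable {T : (a : X) → P.GaugeChange a}

theorem gauge_form {a x : X} (hx : x ∈ (T a).chart.source) :
    (gauge T).form a x = P.form a x + (T a).df x :=
  (T a).θ_comp_mfderiv hx

/-- The global frame is unchanged: multiplying `c a` by `exp f` adds `2 Re df` to the logarithmic
derivative of `|c a|²`, in step with the connection form. -/
theorem IsHermitian.gauge (hP : P.IsHermitian) : (gauge T).IsHermitian := by
  intro a x hx
  rw [gauge_form hx]
  have h0 : HasMFDerivAt 𝓘(ℝ, E) 𝓘(ℝ, ℝ) (fun y ↦ Complex.normSq (P.c a y)) x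
      (Complex.normSq (P.c a x) • ((2 : ℝ) • Complex.reCLM.comp (P.form a x)) : E →L[ℝ] ℝ) := by
    refine (hP a x ((T a).source_subset hx)).congr_mfderiv ?_
    rw [smul_smul, mul_comm]
  have h1 := hasMFDerivAt_mul_smul h0 (hasMFDerivAt_normSq_cexp ((T a).hasMFDerivAt_f hx))
  have hc (y : X) : Complex.normSq ((PrequantumAtlas.gauge T).c a y) = Complex.normSq (P.c a y) *
      Complex.normSq (Complex.exp ((T a).f ((T a).chart y))) := Complex.normSq_mul _ _
  rw [hc]
  refine (h1.congr_mfderiv ?_).congr_of_eventuallyEq (.of_forall hc)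
  rw [← smul_add, smul_smul, ContinuousLinearMap.comp_add, mul_comm (2 : ℝ)]

/-- Along `ι` the logarithmic derivative of `c a` and the connection form both gain `ι^* df`. -/
theorem IsFlatAlong.gauge {ι : M → X} (hι : MDifferentiable 𝓘(ℝ, F) 𝓘(ℝ, E) ι)
    (hP : P.IsFlatAlong (F := F) ι) : (gauge T).IsFlatAlong (F := F) ι := by
  intro a q hq
  rw [gauge_form hq]
  have h1 : HasMFDerivAt 𝓘(ℝ, F) 𝓘(ℝ, ℂ) (fun q' ↦ (T a).f ((T a).chart (ι q'))) q
      (((T a).df (ι q)).comp (mfderiv 𝓘(ℝ, F) 𝓘(ℝ, E) ι q : F →L[ℝ] E) : F →L[ℝ] ℂ) :=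
    ((T a).hasMFDerivAt_f hq).comp q (hι q).hasMFDerivAt
  have h2 := hasMFDerivAt_mul_smul (hP a q ((T a).source_subset hq)) (hasMFDerivAt_cexp h1)
  exact (h2.congr_mfderiv (ContinuousLinearMap.ext fun v ↦ rfl)).congr_of_eventuallyEq
    (.of_forall fun _ ↦ rfl)

end PrequantumAtlas

end Gauge

/-! ### Holomorphic frames over a Kähler manifold. -/

section Kahler

open Set

variable {E : Type*} [NormedAddCommGroup E] [NormedSpace ℝ E] [FiniteDimensional ℝ E]
  {X : Type*} [TopologicalSpace X] [ChartedSpace E X] [IsManifold 𝓘(ℝ, E) ∞ X] {Ω : TwoForm E X}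
  {J : (x : X) → TangentSpace 𝓘(ℝ, E) x →L[ℝ] TangentSpace 𝓘(ℝ, E) x}

/-- Around each point there is a local frame whose connection form is of type `(1,0)`. -/
theorem IsKahler.exists_gaugeChange (hJ : IsKahler Ω J) (P : PrequantumAtlas Ω) (a : X) :
    ∃ T : P.GaugeChange a, ∀ x ∈ T.chart.source, ∀ v : TangentSpace 𝓘(ℝ, E) x,
      T.θ (T.chart x) (mfderiv 𝓘(ℝ, E) 𝓘(ℝ, E) T.chart x (J x v)) =
        Complex.I * T.θ (T.chart x) (mfderiv 𝓘(ℝ, E) 𝓘(ℝ, E) T.chart x v) := by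
  obtain ⟨e, he, ha, j, hj⟩ := hJ.integrable a
  have hsq (v : E) : j (j v) = -v := by
    have h1 (v : TangentSpace 𝓘(ℝ, E) a) : j (j (mfderiv 𝓘(ℝ, E) 𝓘(ℝ, E) e a v)) =
        -(mfderiv 𝓘(ℝ, E) 𝓘(ℝ, E) e a v : E) := by
      rw [← hj a ha, ← hj a ha, hJ.sq]
      exact map_neg _ _
    have h2 := mfderiv_chart_chart_symm he (e.map_source ha) v
    have h3 (y : X) (hy : y = a) (w : E) :
        j (j ((mfderiv 𝓘(ℝ, E) 𝓘(ℝ, E) e y : E →L[ℝ] E) w)) =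
          -((mfderiv 𝓘(ℝ, E) 𝓘(ℝ, E) e y : E →L[ℝ] E) w) := by
      subst hy
      exact h1 w
    have h4 := h3 _ (e.left_inv ha) (mfderiv 𝓘(ℝ, E) 𝓘(ℝ, E) e.symm (e a) v)
    have h5 : (mfderiv 𝓘(ℝ, E) 𝓘(ℝ, E) e (e.symm (e a)) : E →L[ℝ] E)
      (mfderiv 𝓘(ℝ, E) 𝓘(ℝ, E) e.symm (e a) v) = v := h2
    rwa [h5] at h4
  have hO : e.target ∩ e.symm ⁻¹' (P.chart a).source ∈ nhds (e a) := by
    refine Filter.inter_mem (e.open_target.mem_nhds (e.map_source ha)) ?_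
    refine (e.symm.continuousAt (e.map_source ha)).preimage_mem_nhds ?_
    rw [e.left_inv ha]
    exact (P.chart a).open_source.mem_nhds (P.mem_source a)
  obtain ⟨R, hR, hRO⟩ := Metric.mem_nhds_iff.1 hO
  have hsymm {u : E} (hu : u ∈ Metric.ball (e a) R) :
      ContMDiffAt 𝓘(ℝ, E) 𝓘(ℝ, E) ∞ e.symm u := contMDiffAt_chart_symm he (hRO hu).1
  obtain ⟨r, hr, f, hf, hfj⟩ := exists_add_fderiv_complexLinear (u₀ := e a) hsq hR
    (θ := pullbackForm (P.θ a) (P.chart a ∘ e.symm))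
    (fun u hu ↦ (P.contDiffAt_pullback (hsymm hu) (hRO hu).2).contDiffWithinAt)
    (fun u hu v w ↦ by
      have hjs (v : E) : mfderiv 𝓘(ℝ, E) 𝓘(ℝ, E) e.symm u (j v) =
          J (e.symm u) (mfderiv 𝓘(ℝ, E) 𝓘(ℝ, E) e.symm u v) := by
        have h1 := hj (e.symm u) (e.map_target (hRO hu).1) (mfderiv 𝓘(ℝ, E) 𝓘(ℝ, E) e.symm u v)
        rw [mfderiv_chart_chart_symm he (hRO hu).1] at h1
        rw [← h1]
        have h2 := mfderiv_chart_symm_chart he (e.map_target (hRO hu).1)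
          (J (e.symm u) (mfderiv 𝓘(ℝ, E) 𝓘(ℝ, E) e.symm u v))
        rwa [e.right_inv (hRO hu).1] at h2
      -- In a holomorphic chart the constant structure `j` corresponds to `J`, so the compatibility
      -- of `Ω` with `J` says that the curvature has type `(1,1)`.
      rw [P.fderiv_pullback_sub (hsymm hu) (hRO hu).2, P.fderiv_pullback_sub (hsymm hu) (hRO hu).2,
        hjs, hjs, hJ.compatible])
  -- The holomorphic chart is shrunk so as to lie in the domain of the old frame and in the ball
  -- where `f` solves the equation.
  obtain ⟨e', he', ha', hsub, heq, hseq, htar, -⟩ := exists_chart_ball he ha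
    (Filter.inter_mem hO (Metric.ball_mem_nhds (e a) hr))
  have hfun : (e' : X → E) = e := funext heq
  have hfun' : (e'.symm : E → X) = e.symm := funext hseq
  refine ⟨⟨e', he', ha', fun x hx ↦ ?_, f, hf.mono fun u hu ↦ (htar hu).2⟩, fun x hx v ↦ ?_⟩
  · have h1 := (htar (e'.map_source hx)).1.2
    rwa [← hfun', mem_preimage, e'.left_inv hx] at h1
  · change (pullbackForm (P.θ a) (P.chart a ∘ e'.symm) (e' x) + fderiv ℝ f (e' x))
      (mfderiv 𝓘(ℝ, E) 𝓘(ℝ, E) e' x (J x v)) = Complex.I *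
      (pullbackForm (P.θ a) (P.chart a ∘ e'.symm) (e' x) + fderiv ℝ f (e' x))
      (mfderiv 𝓘(ℝ, E) 𝓘(ℝ, E) e' x v)
    have h1 := hfj (e' x) (htar (e'.map_source hx)).2
    rw [hfun'] at *
    rw [hfun] at *
    rw [hj x (hsub hx)]
    exact h1 _

/-- The local frames of a prequantum bundle over a Kähler manifold can be made holomorphic. -/
theorem IsKahler.exists_isHolomorphic (hJ : IsKahler Ω J) {F : Type*} [NormedAddCommGroup F]
    [NormedSpace ℝ F] {Q : Type*} [TopologicalSpace Q] [ChartedSpace F Q] {ι : Q → X}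
    (hι : MDifferentiable 𝓘(ℝ, F) 𝓘(ℝ, E) ι) (P : PrequantumAtlas Ω) (hP : P.IsHermitian)
    (hflat : P.IsFlatAlong (F := F) ι) :
    ∃ P' : PrequantumAtlas Ω, P'.IsHermitian ∧ P'.IsFlatAlong (F := F) ι ∧ P'.IsHolomorphic J := by
  choose T hT using hJ.exists_gaugeChange P
  exact ⟨.gauge T, hP.gauge, hflat.gauge hι, hT⟩

end Kahler

end BohrSommerfeld

end

/-! ### The theorem. -/

theorem mainTheorem5
    {E : Type*} [NormedAddCommGroup E] [NormedSpace ℝ E] [FiniteDimensional ℝ E]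
    {X : Type*} [TopologicalSpace X] [ChartedSpace E X] [IsManifold 𝓘(ℝ, E) ∞ X]
    [T2Space X] [CompactSpace X]
    {F : Type*} [NormedAddCommGroup F] [NormedSpace ℝ F] [FiniteDimensional ℝ F]
    {Q : Type*} [TopologicalSpace Q] [ChartedSpace F Q] [IsManifold 𝓘(ℝ, F) ∞ Q]
    (Ω : BohrSommerfeld.TwoForm E X) (hω : BohrSommerfeld.IsSymplectic Ω)
    (hint : BohrSommerfeld.HasIntegralPeriods Ω)
    (ι : Q → X) (hι : Manifold.IsSmoothEmbedding 𝓘(ℝ, F) 𝓘(ℝ, E) ∞ ι)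
    (hdim : Module.finrank ℝ E = 2 * Module.finrank ℝ F) :
    (BohrSommerfeld.IsBohrSommerfeldLagrangian F Ω ι ↔
      ∃ (L : BohrSommerfeld.LineBundle E X) (h : L.HermitianMetric) (D : L.Connection),
        BohrSommerfeld.LineBundle.IsUnitary D h ∧
        BohrSommerfeld.LineBundle.HasCurvature D Ω ∧
        BohrSommerfeld.LineBundle.IsTrivialFlatAlong F D h ι) ∧
    (BohrSommerfeld.IsBohrSommerfeldLagrangian F Ω ι →
      ∀ J : (x : X) → TangentSpace 𝓘(ℝ, E) x →L[ℝ] TangentSpace 𝓘(ℝ, E) x,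
        BohrSommerfeld.IsKahler Ω J →
        ∃ (L : BohrSommerfeld.LineBundle E X) (h : L.HermitianMetric) (D : L.Connection),
          L.IsHolomorphic J ∧
          BohrSommerfeld.LineBundle.IsChernConnection D h J ∧
          BohrSommerfeld.LineBundle.HasCurvature D Ω ∧
          BohrSommerfeld.LineBundle.IsTrivialFlatAlong F D h ι) := by
  have := FiniteDimensional.complete ℝ E
  have hιs := hι.contMDiff
  refine ⟨⟨fun h ↦ ?_, ?_⟩, fun h J hJ ↦ ?_⟩
  · obtain ⟨P, hP, hflat⟩ := BohrSommerfeld.exists_prequantumAtlas hω hιs h.integral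
    exact ⟨P.lineBundle, BohrSommerfeld.PrequantumAtlas.metric hP, P.connection,
      BohrSommerfeld.PrequantumAtlas.isUnitary_connection hP, P.hasCurvature_connection,
      BohrSommerfeld.PrequantumAtlas.isTrivialFlatAlong_connection hP hι.isImmersion hflat⟩
  · rintro ⟨L, h, D, hD, hc, hflat⟩
    obtain ⟨P, hP⟩ := hD.exists_prequantumAtlas hc hιs hι.isEmbedding.injective hflat
    exact ⟨⟨hdim, P.isotropic hιs hP⟩, P.hasIntegralRelativePeriods hω hι hP⟩
  · obtain ⟨P₀, hP₀, hflat₀⟩ := BohrSommerfeld.exists_prequantumAtlas hω hιs h.integral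
    obtain ⟨P, hP, hflat, hhol⟩ :=
      hJ.exists_isHolomorphic (hιs.mdifferentiable (by simp)) P₀ hP₀ hflat₀
    exact ⟨P.lineBundle, BohrSommerfeld.PrequantumAtlas.metric hP, P.connection, hhol.lineBundle,
      hhol.isChernConnection hP, P.hasCurvature_connection,
      BohrSommerfeld.PrequantumAtlas.isTrivialFlatAlong_connection hP hι.isImmersion hflat⟩
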